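/- **Setting.** Let $N\in\mathbb N$ and $\mathcal H=\ell^2(\mathbb N)\oplus\ell^2(\mathbb N)\oplus\mathbb C^N$ (two leads and a sample), where $\mathbb N=\{0,1,\dots\}$ and $\zeta_1,\dots,\zeta_N$ is the standard basis of $\mathbb C^N$. A vector of $\mathcal H$ is compactly supported if all but finitely many of its lead coordinates vanish. Let $h_1,h_2$ be copies of the Dirichlet Laplacian $(\Delta_D\psi)(n)=t_c(\psi(n+1)+\psi(n-1))$, with $\psi(-1):=0$, on $\ell^2(\mathbb N)$, where $t_c>0$; let $h_s$ be a self-adjoint operator on $\mathbb C^N$, let $\tau>0$, let $L_j$ be a compactly supported vector of lead $j$ and $S_j\in\mathbb C^N$, and put $h_\tau=\tau\sum_{j=1}^2(|S_j\rangle\langle L_j|+|L_j\rangle\langle S_j|)$, $H_L=h_1+h_2$, $H=h_1+h_2+h_s+h_\tau$. For $\nu_{jk}\in\mathbb R$ ($1\le j,k\le N$) and $\lambda\ge0$ let $$V_\lambda\{\gamma\}=\lambda\sum_{j=1}^N\Big(\sum_{k=1}^N\nu_{jk}\langle\zeta_k,\gamma\zeta_k\rangle\Big)|\zeta_j\rangle\langle\zeta_j|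 ,$$ for operators $\gamma$ on $\mathbb C^N$ or on $\mathcal H$. Fix $0<\beta_1,\beta_2\le\infty$, $\mu_1,\mu_2\in\mathbb R$, $0<\beta_s<\infty$ and $0<\mathcal N<N$. For each $\lambda$ considered let $\rho_s=\rho_{s,\lambda}\ge0$ be a self-consistent equilibrium density matrix of the sample: $\rho_s=(e^{\beta_s(h_s+V_\lambda\{\rho_s\}-x)}+1)^{-1}$ for some $x\in\mathbb R$, with $\operatorname{Tr}\rho_s=\mathcal N$. Put $$\rho_i=\frac1{e^{\beta_1(h_1-\mu_1)}+1}\oplus\frac1{e^{\beta_2(h_2-\mu_2)}+1}\oplus\rho_s$$ (with $\chi_{(-\infty,\mu_j]}(h_j)$ in the $j$-th place if $\beta_j=\infty$), and let $\rho_\lambda(t)$, $t\ge0$, be the solution in operator norm of $$\mathrm i\,\rho'(t)=[H+V_\lambda\{\rho(t)\},\rho(t)]\quad(t>0),\qquad \rho(0)=\rho_i .$$ For self-adjoint $A,B$ let $W_-(A,B)=\operatorname{s-lim}_{t\to\infty}e^{-\mathrm itA}e^{\mathrm itB}P_{\rm ac}(B)$, where $P_{\rm ac}(B)$ is the projection onto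 the absolutely continuous subspace of $B$. Let $$H_{\mathrm{eff},\lambda}=H+V_\lambda\{W_-(H,H_L)\,\rho_i\,W_-(H_L,H)\},\qquad \rho_{\mathrm{eff},\lambda}=W_-(H_{\mathrm{eff},\lambda},H_L)\,\rho_i\,W_-(H_L,H_{\mathrm{eff},\lambda}).$$ **Hypotheses.** Assume that $\int_{\mathbb R}|\langle f,e^{\mathrm itH}g\rangle|\,\mathrm dt<\infty$ for all compactly supported $f,g\in\mathcal H$. Let $\lambda_0=\frac1{12\|\nu\|_1M}$ ($=\infty$ if $\nu=0$), where $\|\nu\|_1=\sum_{j,k}|\nu_{jk}|$ and $M=\max_{j,n}\int_0^\infty|\langle\zeta_j,e^{\mathrm isH}\zeta_n\rangle|\,\mathrm ds$. Suppose that there is a real number $\lambda_1$ with $0<\lambda_1\le\lambda_0$ such that $H_{\mathrm{eff},\lambda}$ has purely absolutely continuous spectrum for all $0\le\lambda<\lambda_1$. **Conclusion.** The wave operators $W_-(H,H_L)$ and $W_-(H_L,H)$ and, for $0\le\lambda<\lambda_1$, the wave operators $W_-(H_{\mathrm{eff},\lambda},H_L)$ and $W_-(H_L,H_{\mathrm{eff},\lambda})$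 and the solution $\rho_\lambda(t)$ exist. For all compactly supported $f,g\in\mathcal H$, with $O_c=|f\rangle\langle g|$, the limit $\omega_\lambda(O_c)=\lim_{t\to\infty}\operatorname{Tr}(\rho_\lambda(t)\,O_c)$ exists for $0\le\lambda<\lambda_1$, and $$\omega_\lambda(O_c)=\operatorname{Tr}(\rho_{\mathrm{eff},\lambda}\,O_c)+\mathcal O(\lambda^2),$$ that is, there is a constant $C$, independent of $\lambda$, with $|\omega_\lambda(O_c)-\operatorname{Tr}(\rho_{\mathrm{eff},\lambda}O_c)|\le C\lambda^2$ for all $0\le\lambda<\lambda_1$. -/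

import Mathlib

open Filter Topology MeasureTheory
open scoped ENNReal InnerProductSpace

noncomputable section

namespace HartreeNESS

/-! ### Bounded operators: unitary group, spectral theory, wave operators -/

section Operators

variable {E : Type*} [NormedAddCommGroup E] [InnerProductSpace ℂ E] [CompleteSpace E]

/-- The unitary group `t ↦ exp (i t A)` of a bounded self-adjoint operator `A`. -/
def expI (A : E →L[ℂ] E) (t : ℝ) : E →L[ℂ] E :=
  NormedSpace.exp ((Complex.I * (t : ℂ)) • A)

/-- `m` is the (scalar) spectral measure of the self-adjoint operator `A` at the vector `ψ`:
the finite Borel measure on `ℝ` with `⟨ψ, g(A) ψ⟩ = ∫ g dm` for all bounded continuous `g`. -/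
def IsSpectralMeasure (A : E →L[ℂ] E) (ψ : E) (m : Measure ℝ) : Prop :=
  IsFiniteMeasure m ∧
    ∀ g : BoundedContinuousFunction ℝ ℝ,
      ⟪ψ, cfc (fun x : ℝ => g x) A ψ⟫_ℂ = ((∫ x, g x ∂m : ℝ) : ℂ)

/-- The vectors whose spectral measure is absolutely continuous with respect to Lebesgue measure. -/
def acVectors (A : E →L[ℂ] E) : Set E :=
  {ψ | ∃ m : Measure ℝ, IsSpectralMeasure A ψ m ∧ m ≪ volume}

/-- The absolutely continuous subspace of a self-adjoint operator.  For self-adjoint `A` the set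
`acVectors A` is itself a closed subspace, so that passing to the closed linear span
does not enlarge it; this merely packages it as a closed `Submodule`. -/
def acSubspace (A : E →L[ℂ] E) : Submodule ℂ E :=
  (Submodule.span ℂ (acVectors A)).topologicalClosure

instance (A : E →L[ℂ] E) : CompleteSpace (acSubspace A) :=
  inferInstanceAs (CompleteSpace (Submodule.span ℂ (acVectors A)).topologicalClosure)

/-- The orthogonal projection onto the absolutely continuous subspace of `A`. -/
def acProj (A : E →L[ℂ] E) : E →L[ℂ] E :=
  (acSubspace A).starProjection

/-- `A` has purely absolutely continuous spectrum. -/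
def IsPurelyAC (A : E →L[ℂ] E) : Prop :=
  acSubspace A = ⊤

/-- `W` is the wave operator
`W₋(A, B) = s-lim_{t → +∞} exp (-i t A) exp (i t B) P_ac(B)`. -/
def IsWaveOp (A B W : E →L[ℂ] E) : Prop :=
  ∀ ψ : E, Tendsto (fun t : ℝ => expI A (-t) (expI B t (acProj B ψ))) atTop (𝓝 (W ψ))

open Classical in
/-- The wave operator `W₋(A, B)`, with the value `0` if the strong limit does not exist. -/
def waveOp (A B : E →L[ℂ] E) : E →L[ℂ] E :=
  if h : ∃ W, IsWaveOp A B W then h.choose else 0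

/-- The wave operator `W₋(A, B)` exists, that is, the strong limit defining it exists. -/
def WaveOpExists (A B : E →L[ℂ] E) : Prop :=
  IsWaveOp A B (waveOp A B)

/-- The spectral projection `χ_{(-∞, μ]}(A)` of a bounded self-adjoint operator `A`: the orthogonal
projection onto the kernel of the positive part `(A - μ)₊`. -/
def spectralProjLE (A : E →L[ℂ] E) (μ : ℝ) : E →L[ℂ] E :=
  ((cfc (fun x : ℝ => max (x - μ) 0) A : E →L[ℂ] E).ker).starProjection

/-- The Fermi--Dirac operator `(exp (β (A - μ)) + 1)⁻¹` for `β < ∞`, and `χ_{(-∞, μ]}(A)` for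
`β = ∞`. -/
def fermiDirac (β : ℝ≥0∞) (μ : ℝ) (A : E →L[ℂ] E) : E →L[ℂ] E :=
  if β = ∞ then spectralProjLE A μ
  else cfc (fun x : ℝ => 1 / (Real.exp (β.toReal * (x - μ)) + 1)) A

/-- The rank-one operator `|x⟩⟨y|`. -/
def ketbra (x y : E) : E →L[ℂ] E := InnerProductSpace.rankOne ℂ x y

/-- The Hartree potential
`V_λ{γ} = λ ∑_j (∑_k ν_jk ⟨ζ_k, γ ζ_k⟩) |ζ_j⟩⟨ζ_j|`. -/
def hartree {N : ℕ} (ν : Matrix (Fin N) (Fin N) ℝ) (ζ : Fin N → E) (lam : ℝ) (γ : E →L[ℂ] E) :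
    E →L[ℂ] E :=
  (lam : ℂ) • ∑ j, (∑ k, (ν j k : ℂ) * ⟪ζ k, γ (ζ k)⟫_ℂ) • ketbra (ζ j) (ζ j)

end Operators

/-! ### The one-particle space -/

/-- The Hilbert space `ℓ²(ℕ)` of a semi-infinite lead. -/
abbrev Lead : Type := lp (fun _ : ℕ => ℂ) 2

/-- The Hilbert space `ℂ^N` of the small sample. -/
abbrev Sample (N : ℕ) : Type := EuclideanSpace ℂ (Fin N)

/-- The Hilbert space `ℓ²(ℕ) ⊕ ℓ²(ℕ) ⊕ ℂ^N` (the two leads are indexed by `Fin 2`). -/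
abbrev Hilb (N : ℕ) : Type := WithLp 2 (PiLp 2 (fun _ : Fin 2 => Lead) × Sample N)

theorem memℓp_shift (ψ : Lead) : Memℓp (fun n : ℕ => ψ (n + 1)) 2 := by
  have h := lp.memℓp ψ
  rw [memℓp_gen_iff (by norm_num)] at h ⊢
  exact (summable_nat_add_iff 1).2 h

/-- The shift `(ψ(n))_n ↦ (ψ(n+1))_n` on `ℓ²(ℕ)`, as a linear map. -/
def shiftₗ : Lead →ₗ[ℂ] Lead where
  toFun ψ := ⟨fun n => ψ (n + 1), memℓp_shift ψ⟩
  map_add' _ _ := rfl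
  map_smul' _ _ := rfl

theorem norm_shiftₗ_le (ψ : Lead) : ‖shiftₗ ψ‖ ≤ 1 * ‖ψ‖ := by
  rw [one_mul]
  have h2 : (0 : ℝ) < (2 : ℝ≥0∞).toReal := by norm_num
  have h := lp.memℓp ψ
  rw [memℓp_gen_iff h2] at h
  refine lp.norm_le_of_tsum_le h2 (norm_nonneg _) ?_
  rw [lp.norm_rpow_eq_tsum h2 ψ, h.tsum_eq_zero_add]
  exact le_add_of_nonneg_left (by positivity)

/-- The shift `(ψ(n))_n ↦ (ψ(n+1))_n` on `ℓ²(ℕ)`. -/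
def shift : Lead →L[ℂ] Lead := shiftₗ.mkContinuous 1 norm_shiftₗ_le

/-- The Dirichlet Laplacian with hopping constant `t_c`, as the sum of the shift and its adjoint;
see `dirichletLaplacian_succ` and `dirichletLaplacian_zero` for its matrix elements. -/
def dirichletLaplacian (tc : ℝ) : Lead →L[ℂ] Lead :=
  (tc : ℂ) • (shift + ContinuousLinearMap.adjoint shift)

theorem shift_apply (ψ : Lead) (n : ℕ) : shift ψ n = ψ (n + 1) := rfl

theorem adjoint_shift_apply (ψ : Lead) (n : ℕ) :
    ContinuousLinearMap.adjoint shift ψ n = ⟪shift (lp.single 2 n (1 : ℂ)), ψ⟫_ℂ := by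
  rw [← ContinuousLinearMap.adjoint_inner_right, lp.inner_single_left]
  simp

theorem dirichletLaplacian_succ (tc : ℝ) (ψ : Lead) (n : ℕ) :
    dirichletLaplacian tc ψ (n + 1) = (tc : ℂ) * (ψ (n + 2) + ψ n) := by
  have h : shift (lp.single 2 (n + 1) (1 : ℂ)) = (lp.single 2 n (1 : ℂ) : Lead) := by
    ext m
    rw [shift_apply, lp.single_apply, lp.single_apply]
    simp [Pi.single_apply]
  change (tc : ℂ) * (shift ψ (n + 1) + ContinuousLinearMap.adjoint shift ψ (n + 1)) = _
  rw [adjoint_shift_apply, h, lp.inner_single_left, shift_apply]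
  simp

theorem dirichletLaplacian_zero (tc : ℝ) (ψ : Lead) :
    dirichletLaplacian tc ψ 0 = (tc : ℂ) * ψ 1 := by
  have h : shift (lp.single 2 0 (1 : ℂ)) = (0 : Lead) := by
    ext m
    rw [shift_apply, lp.single_apply]
    simp
  change (tc : ℂ) * (shift ψ 0 + ContinuousLinearMap.adjoint shift ψ 0) = _
  rw [adjoint_shift_apply, h, shift_apply]
  simp

/-- The embedding of the `j`-th lead into the full space. -/
def ofLead {N : ℕ} (j : Fin 2) : Lead →L[ℂ] Hilb N :=
  ((WithLp.prodContinuousLinearEquiv 2 ℂ (PiLp 2 (fun _ : Fin 2 => Lead)) (Sample N)).symm :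
      _ →L[ℂ] Hilb N) ∘L
    ContinuousLinearMap.inl ℂ (PiLp 2 (fun _ : Fin 2 => Lead)) (Sample N) ∘L
    ((PiLp.continuousLinearEquiv 2 ℂ (fun _ : Fin 2 => Lead)).symm :
      _ →L[ℂ] PiLp 2 (fun _ : Fin 2 => Lead)) ∘L
    ContinuousLinearMap.single ℂ (fun _ : Fin 2 => Lead) j

/-- The embedding of the sample into the full space. -/
def ofSample {N : ℕ} : Sample N →L[ℂ] Hilb N :=
  ((WithLp.prodContinuousLinearEquiv 2 ℂ (PiLp 2 (fun _ : Fin 2 => Lead)) (Sample N)).symm :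
      _ →L[ℂ] Hilb N) ∘L
    ContinuousLinearMap.inr ℂ (PiLp 2 (fun _ : Fin 2 => Lead)) (Sample N)

/-- The component of `ψ` in the `j`-th lead. -/
def leadPart {N : ℕ} (ψ : Hilb N) (j : Fin 2) : Lead := ψ.fst j

/-- The basis vector `ζ_k` of the sample `ℂ^N`. -/
def sampleBasis {N : ℕ} (k : Fin N) : Sample N := EuclideanSpace.single k 1

/-- The basis vector `ζ_k` of the sample, seen in the full space. -/
def zeta {N : ℕ} (k : Fin N) : Hilb N := ofSample (sampleBasis k)

/-- `ψ` has compact support: all but finitely many of its lead coordinates vanish. -/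
def HasCompactSupp {N : ℕ} (ψ : Hilb N) : Prop :=
  ∀ j, (Function.support (fun n => leadPart ψ j n)).Finite

/-- The block-diagonal operator `A 0 ⊕ A 1 ⊕ B`. -/
def directSum {N : ℕ} (A : Fin 2 → Lead →L[ℂ] Lead) (B : Sample N →L[ℂ] Sample N) :
    Hilb N →L[ℂ] Hilb N :=
  ∑ j, ofLead j ∘L A j ∘L ContinuousLinearMap.adjoint (ofLead j) +
    ofSample ∘L B ∘L ContinuousLinearMap.adjoint ofSample

/-- The standard orthonormal basis of the full space. -/
def siteVec {N : ℕ} : (Fin 2 × ℕ) ⊕ Fin N → Hilb N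
  | .inl p => ofLead p.1 (lp.single 2 p.2 (1 : ℂ))
  | .inr k => zeta k

/-- The trace of a trace class operator, computed in the standard orthonormal basis. -/
def tr {N : ℕ} (A : Hilb N →L[ℂ] Hilb N) : ℂ :=
  ∑' i, ⟪siteVec i, A (siteVec i)⟫_ℂ

theorem inner_ofLead {N : ℕ} (j : Fin 2) (x : Lead) (ψ : Hilb N) :
    ⟪ofLead j x, ψ⟫_ℂ = ⟪x, leadPart ψ j⟫_ℂ := by
  rw [WithLp.prod_inner_apply, PiLp.inner_apply, Finset.sum_eq_single j]
  · simp [ofLead, leadPart]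
  · intro b _ hb
    simp [ofLead, hb]
  · simp

theorem inner_ofSample {N : ℕ} (x : Sample N) (ψ : Hilb N) :
    ⟪ofSample x, ψ⟫_ℂ = ⟪x, ψ.snd⟫_ℂ := by
  rw [WithLp.prod_inner_apply]
  simp [ofSample]

theorem hasSum_inner_siteVec {N : ℕ} (φ ψ : Hilb N) :
    HasSum (fun i => ⟪φ, siteVec i⟫_ℂ * ⟪siteVec i, ψ⟫_ℂ) ⟪φ, ψ⟫_ℂ := by
  have h1 : ∀ j n, ⟪φ, siteVec (.inl (j, n))⟫_ℂ * ⟪siteVec (.inl (j, n)), ψ⟫_ℂ =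
      ⟪leadPart φ j n, leadPart ψ j n⟫_ℂ := by
    intro j n
    rw [← inner_conj_symm φ]
    simp only [siteVec, inner_ofLead, lp.inner_single_left]
    simp [mul_comm]
  have h2 : ∀ k, ⟪φ, siteVec (.inr k)⟫_ℂ * ⟪siteVec (.inr k), ψ⟫_ℂ =
      ⟪φ.snd k, ψ.snd k⟫_ℂ := by
    intro k
    rw [← inner_conj_symm φ]
    simp only [siteVec, zeta, sampleBasis, inner_ofSample, EuclideanSpace.inner_single_left]
    simp [mul_comm]
  have h3 : ∀ j : Fin 2, HasSum (fun i : (Fin 2 × ℕ) ⊕ Fin N => Sum.elim (fun p : Fin 2 × ℕ =>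
      if p.1 = j then ⟪leadPart φ j p.2, leadPart ψ j p.2⟫_ℂ else 0) (fun _ => 0) i)
      ⟪leadPart φ j, leadPart ψ j⟫_ℂ := by
    intro j
    have hinj : Function.Injective (fun n : ℕ => (Sum.inl (j, n) : (Fin 2 × ℕ) ⊕ Fin N)) := by
      intro a b hab
      simpa using hab
    refine (hinj.hasSum_iff ?_).1 ?_
    · rintro (⟨i, n⟩ | k) hx
      · by_cases hij : i = j
        · exact absurd ⟨n, by rw [hij]⟩ hx
        · simp [hij]
      · rfl
    · simp only [Function.comp_def, Sum.elim_inl, if_true]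
      exact lp.hasSum_inner (leadPart φ j) (leadPart ψ j)
  have h4 : HasSum (fun i : (Fin 2 × ℕ) ⊕ Fin N =>
      Sum.elim (fun _ => 0) (fun k => ⟪φ.snd k, ψ.snd k⟫_ℂ) i) ⟪φ.snd, ψ.snd⟫_ℂ := by
    refine (Sum.inr_injective.hasSum_iff ?_).1 ?_
    · rintro (p | k) hx
      · rfl
      · exact absurd ⟨k, rfl⟩ hx
    · rw [PiLp.inner_apply]
      exact hasSum_fintype _
  rw [WithLp.prod_inner_apply, PiLp.inner_apply]
  refine ((hasSum_sum fun j _ => h3 j).add h4).congr_fun ?_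
  rintro (⟨i, n⟩ | k)
  · rw [h1]
    simp
  · rw [h2]
    simp

/-- The trace of `A |f⟩⟨g|` is `⟨g, A f⟩`. -/
theorem tr_mul_ketbra {N : ℕ} (A : Hilb N →L[ℂ] Hilb N) (f g : Hilb N) :
    tr (A * ketbra f g) = ⟪g, A f⟫_ℂ := by
  rw [← (hasSum_inner_siteVec g (A f)).tsum_eq]
  refine tsum_congr fun i => ?_
  simp [ketbra]

/-! ### The model -/

/-- The data of the model: hopping constant `t_c > 0`, linear sample Hamiltonian `h_s`, interaction
coefficients `ν_jk`, coupling vectors `L_j` (compactly supported in lead `j`) and `S_j` (in the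
sample), coupling strength `τ > 0`, inverse temperatures `0 < β_j ≤ ∞` and chemical
potentials `μ_j` of the leads, inverse temperature `0 < β_s < ∞` and mean particle
number `0 < n_s < N` of the sample. -/
structure Model (N : ℕ) where
  tc : ℝ
  tc_pos : 0 < tc
  hs : Sample N →L[ℂ] Sample N
  hs_selfAdjoint : IsSelfAdjoint hs
  ν : Matrix (Fin N) (Fin N) ℝ
  L : Fin 2 → Lead
  L_supp : ∀ j, (Function.support (fun n => L j n)).Finite
  S : Fin 2 → Sample N
  τ : ℝ
  τ_pos : 0 < τ
  β : Fin 2 → ℝ≥0∞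
  β_pos : ∀ j, 0 < β j
  μ : Fin 2 → ℝ
  βs : ℝ
  βs_pos : 0 < βs
  ns : ℝ
  ns_pos : 0 < ns
  ns_lt : ns < N

namespace Model

variable {N : ℕ} (P : Model N)

/-- The lead Hamiltonian `H_L = h_1 + h_2` (it vanishes on the sample). -/
def HL : Hilb N →L[ℂ] Hilb N :=
  directSum (fun _ => dirichletLaplacian P.tc) 0

/-- The tunneling Hamiltonian `h_τ = τ ∑_j (|S_j⟩⟨L_j| + |L_j⟩⟨S_j|)`. -/
def hτ : Hilb N →L[ℂ] Hilb N :=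
  (P.τ : ℂ) • ∑ j, (ketbra (ofSample (P.S j)) (ofLead j (P.L j)) +
    ketbra (ofLead j (P.L j)) (ofSample (P.S j)))

/-- The linear coupled Hamiltonian `H = h_1 + h_2 + h_s + h_τ`. -/
def H : Hilb N →L[ℂ] Hilb N :=
  directSum (fun _ => dirichletLaplacian P.tc) P.hs + P.hτ

/-- The Hartree potential of the sample Hilbert space. -/
def sampleV (lam : ℝ) (γ : Sample N →L[ℂ] Sample N) : Sample N →L[ℂ] Sample N :=
  hartree P.ν sampleBasis lam γ

/-- The Hartree potential of the full Hilbert space. -/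
def V (lam : ℝ) (γ : Hilb N →L[ℂ] Hilb N) : Hilb N →L[ℂ] Hilb N :=
  hartree P.ν zeta lam γ

/-- `ρs` is a self-consistent equilibrium density matrix of the sample:
`ρs = (exp (β_s (h_s + V_λ{ρs} - x)) + 1)⁻¹`, where the chemical potential `x` is
such that the mean number of particles is `n_s`. -/
def IsSampleEquilibrium (lam : ℝ) (ρs : Sample N →L[ℂ] Sample N) : Prop :=
  ρs.IsPositive ∧
    ∃ x : ℝ, ρs = fermiDirac (ENNReal.ofReal P.βs) x (P.hs + P.sampleV lam ρs) ∧
      LinearMap.trace ℂ (Sample N) (ρs : Sample N →ₗ[ℂ] Sample N) = (P.ns : ℂ)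

/-- The partitioned initial state
`ρ_i = f_1(h_1) ⊕ f_2(h_2) ⊕ ρs` with Fermi--Dirac distributions `f_j`. -/
def ρi (ρs : Sample N →L[ℂ] Sample N) : Hilb N →L[ℂ] Hilb N :=
  directSum (fun j => fermiDirac (P.β j) (P.μ j) (dirichletLaplacian P.tc)) ρs

/-- `ρ` solves the nonlinear Liouville equation
`i ρ'(t) = [H + V_λ{ρ(t)}, ρ(t)]`, `t > 0`, `ρ(0) = ρ_i`, in operator norm
(only the values `ρ t` with `t ≥ 0` matter). -/
def IsLiouvilleSolution (lam : ℝ) (ρs : Sample N →L[ℂ] Sample N)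
    (ρ : ℝ → Hilb N →L[ℂ] Hilb N) : Prop :=
  ρ 0 = P.ρi ρs ∧ ContinuousOn ρ (Set.Ici 0) ∧
    ∀ t : ℝ, 0 < t → ∃ ρ' : Hilb N →L[ℂ] Hilb N, HasDerivAt ρ ρ' t ∧
      Complex.I • ρ' = (P.H + P.V lam (ρ t)) * ρ t - ρ t * (P.H + P.V lam (ρ t))

/-- The dispersive assumption: `t ↦ ⟨f, exp (i t H) g⟩` is integrable on `ℝ` for all compactly
supported `f`, `g`. -/
def Dispersive : Prop :=
  ∀ f g : Hilb N, HasCompactSupp f → HasCompactSupp g →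
    Integrable (fun t : ℝ => ⟪f, expI P.H t g⟫_ℂ) volume

/-- `M = max_{j,n} ∫_0^∞ |⟨ζ_j, exp (i s H) ζ_n⟩| ds`. -/
def M : ℝ≥0∞ :=
  ⨆ (j : Fin N) (n : Fin N), ∫⁻ s in Set.Ioi (0 : ℝ), ‖⟪zeta j, expI P.H s (zeta n)⟫_ℂ‖ₑ

/-- `λ_0 = 1 / (12 ‖ν‖_1 M)` with `‖ν‖_1 = ∑_{j,k} |ν_jk|` (so that `λ_0 = ∞` if `ν = 0`). -/
def lambda0 : ℝ≥0∞ :=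
  (12 * ENNReal.ofReal (∑ j, ∑ k, |P.ν j k|) * P.M)⁻¹

/-- The effective Hamiltonian
`H_eff = H + V_λ{W₋(H, H_L) ρ_i W₋(H_L, H)}`. -/
def Heff (lam : ℝ) (ρs : Sample N →L[ℂ] Sample N) : Hilb N →L[ℂ] Hilb N :=
  P.H + P.V lam (waveOp P.H P.HL * P.ρi ρs * waveOp P.HL P.H)

/-- The non-interacting steady state of the effective Hamiltonian,
`ρ_eff = W₋(H_eff, H_L) ρ_i W₋(H_L, H_eff)`. -/
def ρeff (lam : ℝ) (ρs : Sample N →L[ℂ] Sample N) : Hilb N →L[ℂ] Hilb N :=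
  waveOp (P.Heff lam ρs) P.HL * P.ρi ρs * waveOp P.HL (P.Heff lam ρs)

end Model

/-- The value `ω(O) = lim_{t → ∞} Tr(ρ(t) O)` of the steady state. -/
def steadyState {N : ℕ} (ρ : ℝ → Hilb N →L[ℂ] Hilb N) (O : Hilb N →L[ℂ] Hilb N) : ℂ :=
  limUnder atTop (fun t : ℝ => tr (ρ t * O))

end HartreeNESS

end

set_option linter.unusedSectionVars false

namespace HartreeNESS

/-! ### The unitary group of a bounded self-adjoint operator -/

section UnitaryGroup

variable {E F : Type*} [NormedAddCommGroup E] [InnerProductSpace ℂ E] [CompleteSpace E]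
  [NormedAddCommGroup F] [InnerProductSpace ℂ F] [CompleteSpace F]

/-! Since `tr (A * ketbra f g)` is `⟪g, A f⟫`, everything concerns matrix elements between compactly
supported vectors. The Liouville equation is solved by ρ(t) = U(t) ρ_i U(t)*, where U has the
generator H + V_λ{ρ(t)}. Because ρ_i commutes with H_L, ⟨g, ρ(t) f⟩ = ⟨b_g(t), ρ_i b_f(t)⟩ with
b_f(t) = e^{-itH_L} U(t)* f, so it suffices that b_f(t) converges.

Duhamel's formula (`duhamel_rotated`) writes b_f(t) as e^{-itH_L} e^{itH} f plus i times a sum over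
k of retarded convolutions with kernel ⟨ζ_k, e^{isH} f⟩ and source w_k b_{ζ_k}, where w_k is the
Hartree potential at site k. The free term converges by Cook's method and the dispersive assumption,
which also makes the kernels integrable. For f = ζ_j the system is closed. The densities are
quadratic in the b's, so the source has Lipschitz constant 3κ_k, where κ_k is of order λ. For λ <
λ_0 the late-time oscillation of the b_{ζ_j} is therefore halved again and again
(`exists_tendsto_of_retarded_equation`). The limits X f solve a stationary equation X f = W f + i
∑_k (smeared v_k X ζ_k), with W = W₋(H_L, H) and v_k built from X itself (`exists_asymptotics`,
`liouville_asymptotics`).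

The same argument with a constant potential treats H_eff (`effective_asymptotics`). Its limits Y =
W₋(H_L, H_eff) solve the same equation, except that the potential is built from W. Both X and Y
differ from W by O(λ). Each source already carries a factor λ, so the sources differ by O(λ²), and
hence so do X f and Y f (`norm_asymptotics_sub_le`).

Two facts on wave operators connect this with the definitions. First, W₋(·, H_L) exists by Cook's
method, applied to a dense set of lead vectors whose free evolution decays like t⁻² at each site
(`integrableOn_expI_edgeDamping`). Second, for purely absolutely continuous A, W₋(A, B) and W₋(B, A)
are adjoint to each other in matrix elements (`inner_waveOp_conj`), which expresses H_eff and ρ_eff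
through W and Y. Pure absolute continuity of H is the hypothesis on H_eff at λ = 0. -/

theorem expI_zero (A : E →L[ℂ] E) : expI A 0 = 1 := by
  simp [expI]

theorem commute_expI_of_commute {A C : E →L[ℂ] E} (h : Commute C A) (t : ℝ) :
    Commute C (expI A t) :=
  (h.smul_right _).exp_right

theorem commute_expI (A : E →L[ℂ] E) (t : ℝ) : Commute A (expI A t) :=
  commute_expI_of_commute (Commute.refl A) t

theorem expI_add (A : E →L[ℂ] E) (s t : ℝ) : expI A (s + t) = expI A s * expI A t := by
  unfold expI
  let _ : NormedAlgebra ℚ (E →L[ℂ] E) := NormedAlgebra.restrictScalars ℚ ℂ (E →L[ℂ] E)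
  rw [← NormedSpace.exp_add_of_commute]
  · congr 1
    rw [← add_smul]
    push_cast
    ring_nf
  · exact ((Commute.refl A).smul_left _).smul_right _

theorem expI_mul_expI_neg (A : E →L[ℂ] E) (t : ℝ) : expI A t * expI A (-t) = 1 := by
  rw [← expI_add, add_neg_cancel, expI_zero]

theorem expI_neg_mul_expI (A : E →L[ℂ] E) (t : ℝ) : expI A (-t) * expI A t = 1 := by
  rw [← expI_add, neg_add_cancel, expI_zero]

theorem hasDerivAt_expI (A : E →L[ℂ] E) (t : ℝ) :
    HasDerivAt (expI A) (Complex.I • (expI A t * A)) t := by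
  have h := (hasDerivAt_exp_smul_const (𝕂 := ℂ) (Complex.I • A) (t : ℂ)).scomp t
    (Complex.ofRealCLM.hasDerivAt)
  convert! h using 1
  · funext s
    simp only [expI, Function.comp, smul_smul, mul_comm]
  · simp [expI, smul_smul, mul_comm]

theorem continuous_expI (A : E →L[ℂ] E) : Continuous (expI A) :=
  continuous_iff_continuousAt.2 fun t => (hasDerivAt_expI A t).continuousAt

theorem star_expI {A : E →L[ℂ] E} (hA : IsSelfAdjoint A) (t : ℝ) :
    star (expI A t) = expI A (-t) := by
  unfold expI
  rw [NormedSpace.star_exp, star_smul, hA.star_eq]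
  simp

theorem inner_expI_left {A : E →L[ℂ] E} (hA : IsSelfAdjoint A) (t : ℝ) (x y : E) :
    ⟪expI A t x, y⟫_ℂ = ⟪x, expI A (-t) y⟫_ℂ := by
  rw [← star_expI hA, ContinuousLinearMap.star_eq_adjoint, ContinuousLinearMap.adjoint_inner_right]

theorem expI_neg_apply_expI (A : E →L[ℂ] E) (t : ℝ) (x : E) : expI A (-t) (expI A t x) = x := by
  change (expI A (-t) * expI A t) x = x
  rw [expI_neg_mul_expI]; rfl

theorem expI_apply_expI_neg (A : E →L[ℂ] E) (t : ℝ) (x : E) : expI A t (expI A (-t) x) = x := by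
  change (expI A t * expI A (-t)) x = x
  rw [expI_mul_expI_neg]; rfl

theorem norm_expI_apply {A : E →L[ℂ] E} (hA : IsSelfAdjoint A) (t : ℝ) (x : E) :
    ‖expI A t x‖ = ‖x‖ := by
  have h : ⟪expI A t x, expI A t x⟫_ℂ = ⟪x, x⟫_ℂ := by
    rw [inner_expI_left hA, expI_neg_apply_expI]
  rw [inner_self_eq_norm_sq_to_K, inner_self_eq_norm_sq_to_K] at h
  have h' : ‖expI A t x‖ ^ 2 = ‖x‖ ^ 2 := by exact_mod_cast h
  exact (sq_eq_sq₀ (norm_nonneg _) (norm_nonneg _)).1 h'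

theorem norm_expI_le {A : E →L[ℂ] E} (hA : IsSelfAdjoint A) (t : ℝ) : ‖expI A t‖ ≤ 1 :=
  ContinuousLinearMap.opNorm_le_bound _ zero_le_one fun x => by
    rw [norm_expI_apply hA, one_mul]

theorem inner_expI_expI {A : E →L[ℂ] E} (hA : IsSelfAdjoint A) (t : ℝ) (x y : E) :
    ⟪expI A t x, expI A t y⟫_ℂ = ⟪x, y⟫_ℂ := by
  rw [inner_expI_left hA, expI_neg_apply_expI]

theorem isBoundedBilinearMap_clm_apply :
    IsBoundedBilinearMap ℝ (fun p : (E →L[ℂ] F) × E => p.1 p.2) where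
  add_left _ _ _ := rfl
  smul_left _ _ _ := rfl
  add_right _ _ _ := map_add _ _ _
  smul_right c T x := by simp
  bound := ⟨1, one_pos, fun T x => by simpa using T.le_opNorm x⟩

theorem hasDerivAt_clm_apply {Z : ℝ → E →L[ℂ] F} {Z' : E →L[ℂ] F} {u : ℝ → E} {u' : E} {t : ℝ}
    (hZ : HasDerivAt Z Z' t) (hu : HasDerivAt u u' t) :
    HasDerivAt (fun s => Z s (u s)) (Z' (u t) + Z t u') t := by
  have h := (isBoundedBilinearMap_clm_apply.hasFDerivAt (Z t, u t)).comp_hasDerivAt t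
    (hZ.prodMk hu)
  convert! h using 1
  simp [IsBoundedBilinearMap.deriv_apply, add_comm]

theorem hasDerivAt_expI_apply (A : E →L[ℂ] E) (x : E) (t : ℝ) :
    HasDerivAt (fun s => expI A s x) (Complex.I • A (expI A t x)) t := by
  have h := hasDerivAt_clm_apply (hasDerivAt_expI A t) (hasDerivAt_const t x)
  rw [← (commute_expI A t).eq] at h
  simpa using h

theorem hasDerivAt_expI_neg (A : E →L[ℂ] E) (t : ℝ) :
    HasDerivAt (fun s => expI A (-s)) (-(Complex.I • (expI A (-t) * A))) t := by
  have h := (hasDerivAt_expI A (-t)).scomp t (hasDerivAt_neg t)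
  rwa [neg_one_smul] at h

/-- The curve e^{-isA} J e^{isB} x has zero derivative, hence keeps its value J x at s = 0. -/
theorem expI_apply_of_intertwine {A : E →L[ℂ] E} {B : F →L[ℂ] F} {J : F →L[ℂ] E}
    (h : ∀ x, A (J x) = J (B x)) (t : ℝ) (x : F) : expI A t (J x) = J (expI B t x) := by
  have hd : ∀ s : ℝ, HasDerivAt (fun s => expI A (-s) (J (expI B s x))) 0 s := by
    intro s
    have h2 : HasDerivAt (fun s => J (expI B s x)) (J (Complex.I • B (expI B s x))) s :=
      (J.restrictScalars ℝ).hasFDerivAt.comp_hasDerivAt s (hasDerivAt_expI_apply B x s)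
    have h3 := hasDerivAt_clm_apply (hasDerivAt_expI_neg A s) h2
    simpa [h] using h3
  have hc := is_const_of_deriv_eq_zero (fun s => (hd s).differentiableAt)
    (fun s => (hd s).deriv) t 0
  simp only [neg_zero, expI_zero, one_apply_eq_self] at hc
  rw [← hc, expI_apply_expI_neg]

end UnitaryGroup

/-! ### Strong limits of contractions -/

section StrongLimits

variable {E F : Type*} [NormedAddCommGroup E] [InnerProductSpace ℂ E] [CompleteSpace E]
  [NormedAddCommGroup F] [InnerProductSpace ℂ F] [CompleteSpace F]

/-- The subspace of vectors on which a family of operators converges at `+∞`. -/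
def convergenceSubmodule (T : ℝ → E →L[ℂ] F) : Submodule ℂ E where
  carrier := {x | ∃ l, Tendsto (fun t => T t x) atTop (𝓝 l)}
  add_mem' := by
    rintro x y ⟨l, hl⟩ ⟨m, hm⟩
    exact ⟨l + m, by simpa using hl.add hm⟩
  zero_mem' := ⟨0, by simp⟩
  smul_mem' := by
    rintro c x ⟨l, hl⟩
    exact ⟨c • l, by simpa using hl.const_smul c⟩

theorem isClosed_convergenceSubmodule {T : ℝ → E →L[ℂ] F} (hT : ∀ t, ‖T t‖ ≤ 1) :
    IsClosed (convergenceSubmodule T : Set E) := by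
  refine isClosed_of_closure_subset fun x hx => ?_
  change ∃ l, Tendsto (fun t => T t x) atTop (𝓝 l)
  refine cauchy_map_iff_exists_tendsto.1 ?_
  change CauchySeq fun t => T t x
  rw [Metric.cauchySeq_iff]
  intro ε hε
  obtain ⟨y, ⟨l, hl⟩, hxy⟩ := Metric.mem_closure_iff.1 hx (ε / 3) (by positivity)
  obtain ⟨N, hN⟩ := (Metric.cauchySeq_iff.1 hl.cauchySeq) (ε / 3) (by positivity)
  have hb : ∀ t, dist (T t x) (T t y) < ε / 3 := fun t => by
    rw [dist_eq_norm, ← map_sub]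
    refine lt_of_le_of_lt ((T t).le_of_opNorm_le (hT t) _) ?_
    rwa [one_mul, ← dist_eq_norm]
  refine ⟨N, fun m hm n hn => ?_⟩
  calc dist (T m x) (T n x) ≤ dist (T m x) (T m y) + dist (T m y) (T n y) + dist (T n y) (T n x) :=
        dist_triangle4 _ _ _ _
    _ < ε / 3 + ε / 3 + ε / 3 := by
        have := hb n
        rw [dist_comm] at this
        gcongr
        exacts [hb m, hN m hm n hn]
    _ = ε := by ring

theorem exists_tendsto_of_span_dense {T : ℝ → E →L[ℂ] F} (hT : ∀ t, ‖T t‖ ≤ 1) {s : Set E}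
    (hs : ∀ x ∈ s, ∃ l, Tendsto (fun t => T t x) atTop (𝓝 l)) {x : E}
    (hx : x ∈ (Submodule.span ℂ s).topologicalClosure) :
    ∃ l, Tendsto (fun t => T t x) atTop (𝓝 l) :=
  Submodule.topologicalClosure_minimal (t := convergenceSubmodule T) _ (Submodule.span_le.2 hs)
    (isClosed_convergenceSubmodule hT) hx

/-- By Banach–Steinhaus a pointwise limit of bounded operators is itself bounded, so no bound on the
limit has to be supplied. -/
theorem waveOpExists_of_tendsto {A B : E →L[ℂ] E}
    (h : ∀ x, ∃ l, Tendsto (fun t : ℝ => expI A (-t) (expI B t (acProj B x))) atTop (𝓝 l)) :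
    WaveOpExists A B := by
  choose W hW using h
  have hT : Tendsto (fun (t : ℝ) x => (expI A (-t) * expI B t * acProj B) x) atTop (𝓝 W) :=
    tendsto_pi_nhds.2 hW
  have hex : ∃ W, IsWaveOp A B W := ⟨continuousLinearMapOfTendsto _ hT, hW⟩
  unfold WaveOpExists waveOp
  rw [dif_pos hex]
  exact hex.choose_spec

theorem acProj_of_isPurelyAC {A : E →L[ℂ] E} (h : IsPurelyAC A) (x : E) : acProj A x = x := by
  have h' : x ∈ acSubspace A := by rw [IsPurelyAC] at h; rw [h]; trivial
  exact Submodule.starProjection_eq_self_iff.2 h'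

end StrongLimits

/-! ### Polynomial approximation in the functional calculus -/

section FunctionalCalculus

variable {E : Type*} [NormedAddCommGroup E] [InnerProductSpace ℂ E] [CompleteSpace E]

theorem aeval_comp_of_intertwine {A B W : E →L[ℂ] E} (h : A * W = W * B) (p : Polynomial ℝ) :
    Polynomial.aeval A p * W = W * Polynomial.aeval B p := by
  have hpow : ∀ n : ℕ, A ^ n * W = W * B ^ n := fun n => by
    induction n with
    | zero => simp
    | succ n ih => rw [pow_succ, mul_assoc, h, ← mul_assoc, ih, mul_assoc, ← pow_succ]
  induction p using Polynomial.induction_on' with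
  | add p q hp hq => simp only [map_add, add_mul, mul_add, hp, hq]
  | monomial n a => simp [Polynomial.aeval_monomial, Algebra.algebraMap_eq_smul_one, hpow]

/-- Polynomials in A and B are intertwined algebraically. Weierstrass approximation on one interval
[-R, R] containing both spectra carries this over to continuous functions. -/
theorem cfc_comp_of_intertwine {A B W : E →L[ℂ] E} (hA : IsSelfAdjoint A) (hB : IsSelfAdjoint B)
    (h : A * W = W * B) {g : ℝ → ℝ} (hg : Continuous g) : cfc g A * W = W * cfc g B := by
  set R := max ‖A‖ ‖B‖
  have hspec : ∀ T : E →L[ℂ] E, ‖T‖ ≤ R → spectrum ℝ T ⊆ Set.Icc (-R) R := by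
    intro T hT x hx
    have h1 := spectrum.norm_le_norm_mul_of_mem hx
    have h2 : ‖(1 : E →L[ℂ] E)‖ ≤ 1 := ContinuousLinearMap.norm_id_le
    have h3 : ‖x‖ ≤ R := h1.trans ((mul_le_of_le_one_right (norm_nonneg _) h2).trans hT)
    exact abs_le.1 h3
  have happ : ∀ (T : E →L[ℂ] E), IsSelfAdjoint T → ‖T‖ ≤ R → ∀ ε > 0, ∀ p : Polynomial ℝ,
      (∀ x ∈ Set.Icc (-R) R, |p.eval x - g x| < ε) → ‖cfc g T - Polynomial.aeval T p‖ ≤ ε := by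
    intro T hT hTR ε hε p hp
    rw [← cfc_polynomial p T hT, ← cfc_sub g p.eval T]
    refine norm_cfc_le hε.le fun x hx => ?_
    rw [Real.norm_eq_abs, abs_sub_comm]
    exact (hp x (hspec T hTR hx)).le
  refine eq_of_norm_sub_le_zero (le_of_forall_pos_le_add fun ε hε => ?_)
  obtain ⟨p, hp⟩ := exists_polynomial_near_of_continuousOn (-R) R g hg.continuousOn
    (ε / (2 * (‖W‖ + 1))) (by positivity)
  have e1 := happ A hA (le_max_left _ _) _ (by positivity) p hp
  have e2 := happ B hB (le_max_right _ _) _ (by positivity) p hp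
  have e3 : cfc g A * W - W * cfc g B =
      (cfc g A - Polynomial.aeval A p) * W - W * (cfc g B - Polynomial.aeval B p) := by
    rw [sub_mul, mul_sub, aeval_comp_of_intertwine h p]
    abel
  rw [e3, zero_add]
  calc _ ≤ ε / (2 * (‖W‖ + 1)) * ‖W‖ + ‖W‖ * (ε / (2 * (‖W‖ + 1))) := by
        refine (norm_sub_le _ _).trans (add_le_add ((norm_mul_le _ _).trans ?_)
          ((norm_mul_le _ _).trans ?_)) <;> gcongr
    _ = ε * (‖W‖ / (‖W‖ + 1)) := by field_simp; ring
    _ ≤ ε * 1 := by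
        gcongr
        rw [div_le_one (by positivity)]
        linarith
    _ = ε := mul_one _

end FunctionalCalculus

/-! ### Propagation estimates for the Dirichlet Laplacian -/

section DirichletLaplacian

theorem isSelfAdjoint_dirichletLaplacian (tc : ℝ) : IsSelfAdjoint (dirichletLaplacian tc) := by
  unfold dirichletLaplacian
  rw [← ContinuousLinearMap.star_eq_adjoint]
  refine IsSelfAdjoint.smul ?_ (IsSelfAdjoint.add_star_self _)
  simp [IsSelfAdjoint]

theorem inner_leadSingle (n : ℕ) (ψ : Lead) :
    ⟪(lp.single 2 n (1 : ℂ) : Lead), ψ⟫_ℂ = ψ n := by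
  rw [lp.inner_single_left]
  simp

/-- The coordinates of `x` are the sine coefficients of `φ`. -/
def HasSineCoeffs (x : Lead) (φ : ℝ → ℂ) : Prop :=
  ∀ m : ℕ, x m = (2 / Real.pi : ℂ) *
    ∫ θ in (0 : ℝ)..Real.pi, φ θ * (Real.sin ((m + 1) * θ) : ℂ)

theorem integral_cos_int_mul (k : ℤ) :
    ∫ θ in (0 : ℝ)..Real.pi, Real.cos (k * θ) = if k = 0 then Real.pi else 0 := by
  split_ifs with h
  · simp [h]
  · have hk : (k : ℝ) ≠ 0 := by exact_mod_cast h
    rw [intervalIntegral.integral_comp_mul_left _ hk]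
    simp [Real.sin_int_mul_pi]

theorem hasSineCoeffs_single (n : ℕ) :
    HasSineCoeffs (lp.single 2 n (1 : ℂ)) (fun θ => (Real.sin ((n + 1) * θ) : ℂ)) := by
  intro m
  have h1 : ∀ θ : ℝ, (Real.sin ((n + 1) * θ) : ℂ) * (Real.sin ((m + 1) * θ) : ℂ) =
      (((Real.cos (((n : ℤ) - m : ℤ) * θ) - Real.cos (((n : ℤ) + m + 2 : ℤ) * θ)) / 2 : ℝ) : ℂ) := by
    intro θ
    rw [← Complex.ofReal_mul]
    congr 1
    have e1 : (((n : ℤ) - m : ℤ) : ℝ) * θ = (n + 1) * θ - (m + 1) * θ := by push_cast; ring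
    have e2 : (((n : ℤ) + m + 2 : ℤ) : ℝ) * θ = (n + 1) * θ + (m + 1) * θ := by push_cast; ring
    rw [e1, e2, Real.cos_sub, Real.cos_add]
    ring
  simp_rw [h1]
  rw [intervalIntegral.integral_ofReal, intervalIntegral.integral_div,
    intervalIntegral.integral_sub (Continuous.intervalIntegrable (by fun_prop) _ _)
      (Continuous.intervalIntegrable (by fun_prop) _ _), integral_cos_int_mul,
    -- Only the difference frequency n - m can vanish; the sum frequency n + m + 2 is always
    -- positive.
    integral_cos_int_mul, if_neg (show ¬ ((n : ℤ) + m + 2 = 0) by omega), lp.single_apply]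
  have hpi : (Real.pi : ℂ) ≠ 0 := by exact_mod_cast Real.pi_ne_zero
  by_cases hmn : m = n
  · subst hmn
    simp [hpi]
  · have : ¬ ((n : ℤ) - m = 0) := by omega
    simp [this, hmn]

theorem HasSineCoeffs.smul {x : Lead} {φ : ℝ → ℂ} (h : HasSineCoeffs x φ) (c : ℂ) :
    HasSineCoeffs (c • x) (fun θ => c * φ θ) := by
  intro m
  change c * x m = _
  rw [h m]
  simp_rw [mul_assoc, intervalIntegral.integral_const_mul]
  ring

theorem HasSineCoeffs.sub {x y : Lead} {φ χ : ℝ → ℂ} (hx : HasSineCoeffs x φ)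
    (hy : HasSineCoeffs y χ) (hφ : Continuous φ) (hχ : Continuous χ) :
    HasSineCoeffs (x - y) (fun θ => φ θ - χ θ) := by
  intro m
  change x m - y m = _
  simp_rw [hx m, hy m, sub_mul]
  rw [intervalIntegral.integral_sub (Continuous.intervalIntegrable (by fun_prop) _ _)
    (Continuous.intervalIntegrable (by fun_prop) _ _)]
  ring

/-- The sine transform diagonalises the Laplacian, by 2 cos θ sin((m+1)θ) = sin((m+2)θ) + sin(mθ).
The Dirichlet condition at m = 0 is built in, since sin(0·θ) = 0. -/
theorem HasSineCoeffs.dirichletLaplacian {x : Lead} {φ : ℝ → ℂ} (h : HasSineCoeffs x φ)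
    (hφ : Continuous φ) (tc : ℝ) :
    HasSineCoeffs (dirichletLaplacian tc x) (fun θ => (2 * tc * Real.cos θ : ℝ) * φ θ) := by
  have hs : ∀ m : ℝ, ∀ θ : ℝ, ((2 * tc * Real.cos θ : ℝ) : ℂ) * φ θ * (Real.sin ((m + 1) * θ) : ℂ) =
      tc * (φ θ * (Real.sin ((m + 1 + 1) * θ) : ℂ) + φ θ * (Real.sin (m * θ) : ℂ)) := by
    intro m θ
    have : 2 * Real.cos θ * Real.sin ((m + 1) * θ) =
        Real.sin ((m + 1 + 1) * θ) + Real.sin (m * θ) := by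
      have e1 : (m + 1 + 1) * θ = (m + 1) * θ + θ := by ring
      have e2 : m * θ = (m + 1) * θ - θ := by ring
      rw [e1, e2, Real.sin_add, Real.sin_sub]
      ring
    have h2 := congrArg (fun r : ℝ => (r : ℂ)) this
    push_cast at h2 ⊢
    linear_combination (tc * φ θ) * h2
  intro m
  simp_rw [hs m]
  rw [intervalIntegral.integral_const_mul,
    intervalIntegral.integral_add (Continuous.intervalIntegrable (by fun_prop) _ _)
      (Continuous.intervalIntegrable (by fun_prop) _ _)]
  cases m with
  | zero =>
    rw [dirichletLaplacian_zero, h 1]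
    simp
    ring
  | succ m =>
    rw [dirichletLaplacian_succ, h (m + 2), h m]
    push_cast
    ring_nf

/-- The exponential series is integrated term by term. Only coordinates are needed later, so
unitarity of the sine transform plays no role. -/
theorem HasSineCoeffs.expI {x : Lead} {φ : ℝ → ℂ} (h : HasSineCoeffs x φ)
    (hφ : Continuous φ) (tc t : ℝ) :
    HasSineCoeffs (expI (HartreeNESS.dirichletLaplacian tc) t x)
      (fun θ => Complex.exp (Complex.I * (2 * tc * t * Real.cos θ : ℝ)) * φ θ) := by
  set A := HartreeNESS.dirichletLaplacian tc
  have hpow : ∀ k : ℕ, HasSineCoeffs ((A ^ k) x) (fun θ => ((2 * tc * Real.cos θ : ℝ) : ℂ) ^ k * φ θ) := by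
    intro k
    induction k with
    | zero => simpa using h
    | succ k ih =>
      rw [pow_succ']
      have e : (fun θ : ℝ => ((2 * tc * Real.cos θ : ℝ) : ℂ) ^ (k + 1) * φ θ) = fun θ =>
          (2 * tc * Real.cos θ : ℝ) * (((2 * tc * Real.cos θ : ℝ) : ℂ) ^ k * φ θ) := by
        funext θ
        ring
      rw [e]
      exact ih.dirichletLaplacian (by fun_prop) tc
  intro m
  have h1 : HasSum (fun k : ℕ => ((k.factorial : ℂ)⁻¹ * (Complex.I * t) ^ k) * ((A ^ k) x) m)
      (HartreeNESS.expI A t x m) := by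
    have e := NormedSpace.exp_series_hasSum_exp' (𝕂 := ℂ) ((Complex.I * (t : ℂ)) • A)
    have e2 := ((innerSL ℂ (lp.single 2 m (1 : ℂ) : Lead)).comp
      (ContinuousLinearMap.apply ℂ Lead x)).hasSum e
    convert! e2 using 1
    · funext k
      simp only [ContinuousLinearMap.comp_apply, ContinuousLinearMap.apply_apply,
        innerSL_apply_apply, inner_leadSingle, smul_pow, smul_smul]
      rfl
    · simp only [ContinuousLinearMap.comp_apply, ContinuousLinearMap.apply_apply,
        innerSL_apply_apply, inner_leadSingle]
      rfl
  have h2 : HasSum (fun k : ℕ => ∫ θ in (0 : ℝ)..Real.pi,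
      ((k.factorial : ℂ)⁻¹ * (Complex.I * (2 * tc * t * Real.cos θ : ℝ)) ^ k) *
        (φ θ * (Real.sin ((m + 1) * θ) : ℂ)))
      (∫ θ in (0 : ℝ)..Real.pi, Complex.exp (Complex.I * (2 * tc * t * Real.cos θ : ℝ)) *
        (φ θ * (Real.sin ((m + 1) * θ) : ℂ))) := by
    refine intervalIntegral.hasSum_integral_of_dominated_convergence
      (fun k θ => ((k.factorial : ℝ)⁻¹ * |2 * tc * t| ^ k) * ‖φ θ‖) ?_ ?_ ?_ ?_ ?_
    · intro k
      exact (Continuous.aestronglyMeasurable (by fun_prop))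
    · intro k
      filter_upwards with θ _
      rw [norm_mul, norm_mul, norm_inv, norm_pow, norm_mul, norm_mul]
      have hs : ‖(Real.sin ((m + 1) * θ) : ℂ)‖ ≤ 1 := by
        rw [Complex.norm_real]; exact Real.abs_sin_le_one _
      have hc : ‖((2 * tc * t * Real.cos θ : ℝ) : ℂ)‖ ≤ |2 * tc * t| := by
        rw [Complex.norm_real, norm_mul]
        exact mul_le_of_le_one_right (norm_nonneg _) (Real.abs_cos_le_one _)
      simp only [Complex.norm_I, one_mul, Complex.norm_natCast]
      gcongr
      exact mul_le_of_le_one_right (norm_nonneg _) hs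
    · filter_upwards with θ _
      refine Summable.mul_right _ ?_
      have := Real.summable_pow_div_factorial |2 * tc * t|
      simpa [div_eq_inv_mul] using this
    · exact Continuous.intervalIntegrable (by
        simp_rw [tsum_mul_right]
        exact continuous_const.mul hφ.norm) _ _
    · filter_upwards with θ _
      refine HasSum.mul_right _ ?_
      have := NormedSpace.exp_series_hasSum_exp' (𝕂 := ℂ) (Complex.I * (2 * tc * t * Real.cos θ : ℝ))
      rw [← Complex.exp_eq_exp_ℂ] at this
      simpa using this
  have h3 := h2.mul_left (2 / Real.pi : ℂ)
  have h4 : HartreeNESS.expI A t x m = (2 / Real.pi : ℂ) *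
      (∫ θ in (0 : ℝ)..Real.pi, Complex.exp (Complex.I * (2 * tc * t * Real.cos θ : ℝ)) *
        (φ θ * (Real.sin ((m + 1) * θ) : ℂ))) := by
    refine h1.unique ?_
    convert! h3 using 1
    funext k
    rw [hpow k m, mul_left_comm, ← intervalIntegral.integral_const_mul]
    congr 2
    funext θ
    push_cast
    ring
  rw [h4]
  simp_rw [mul_assoc]

/-- Integration by parts against the phase `exp (i a cos θ)`. -/
theorem integral_phase_mul_sin (a : ℝ) {G G' : ℝ → ℝ} (hG : ∀ θ, HasDerivAt G (G' θ) θ)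
    (hG' : Continuous G') (h0 : G 0 = 0) (hpi : G Real.pi = 0) :
    (a : ℂ) * ∫ θ in (0 : ℝ)..Real.pi,
        Complex.exp (Complex.I * (a * Real.cos θ : ℝ)) * (Real.sin θ * G θ : ℝ) =
      -Complex.I * ∫ θ in (0 : ℝ)..Real.pi,
        Complex.exp (Complex.I * (a * Real.cos θ : ℝ)) * (G' θ : ℂ) := by
  have he : ∀ θ : ℝ, HasDerivAt (fun θ : ℝ => Complex.exp (Complex.I * (a * Real.cos θ : ℝ)))
      (Complex.exp (Complex.I * (a * Real.cos θ : ℝ)) *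
        (Complex.I * (a * (-Real.sin θ) : ℝ))) θ := fun θ =>
    ((((Real.hasDerivAt_cos θ).const_mul a).ofReal_comp).const_mul Complex.I).cexp
  have hGc : Continuous G := continuous_iff_continuousAt.2 fun θ => (hG θ).continuousAt
  have h := intervalIntegral.integral_mul_deriv_eq_deriv_mul (a := 0) (b := Real.pi)
    (u := fun θ => (G θ : ℂ)) (u' := fun θ => (G' θ : ℂ))
    (fun θ _ => (hG θ).ofReal_comp) (fun θ _ => he θ)
    (Continuous.intervalIntegrable (by fun_prop) _ _)
    (Continuous.intervalIntegrable (by fun_prop) _ _)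
  simp only [h0, hpi, Complex.ofReal_zero, zero_mul, sub_zero, zero_sub] at h
  have e1 : ∀ θ : ℝ, (G θ : ℂ) * (Complex.exp (Complex.I * (a * Real.cos θ : ℝ)) *
      (Complex.I * (a * (-Real.sin θ) : ℝ))) = (-Complex.I * a) *
        (Complex.exp (Complex.I * (a * Real.cos θ : ℝ)) * (Real.sin θ * G θ : ℝ)) := by
    intro θ
    push_cast
    ring
  simp_rw [e1, mul_comm (G' _ : ℂ)] at h
  rw [intervalIntegral.integral_const_mul] at h
  linear_combination Complex.I * h + (a * ∫ θ in (0 : ℝ)..Real.pi,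
        Complex.exp (Complex.I * (a * Real.cos θ : ℝ)) * (Real.sin θ * G θ : ℝ)) * Complex.I_sq

/-- Each integration by parts spends one factor sin θ on the derivative of the phase and gains a
factor 1/a. With the weight sin⁴ the boundary terms vanish both times, so the degenerate phase at θ
= 0 and θ = π needs no stationary-phase analysis. -/
theorem exists_sq_mul_norm_integral_phase_le {p p' p'' : ℝ → ℝ} (hp : ∀ θ, HasDerivAt p (p' θ) θ)
    (hp' : ∀ θ, HasDerivAt p' (p'' θ) θ) (hp'' : Continuous p'') :
    ∃ C : ℝ, ∀ a : ℝ, a ^ 2 * ‖∫ θ in (0 : ℝ)..Real.pi,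
      Complex.exp (Complex.I * (a * Real.cos θ : ℝ)) * (Real.sin θ ^ 4 * p θ : ℝ)‖ ≤ C := by
  have hpc : Continuous p := continuous_iff_continuousAt.2 fun θ => (hp θ).continuousAt
  have hpc' : Continuous p' := continuous_iff_continuousAt.2 fun θ => (hp' θ).continuousAt
  -- `G2` is the derivative of sin³ · p divided by sin θ, and `G3` is the derivative of `G2`.
  set G2 : ℝ → ℝ := fun θ => 3 * (Real.sin θ * Real.cos θ) * p θ + Real.sin θ ^ 2 * p' θ
  set G3 : ℝ → ℝ := fun θ => 3 * (Real.cos θ * Real.cos θ + Real.sin θ * -Real.sin θ) * p θ +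
    3 * (Real.sin θ * Real.cos θ) * p' θ + (2 * Real.sin θ * Real.cos θ * p' θ +
    Real.sin θ ^ 2 * p'' θ)
  have hG1 : ∀ θ, HasDerivAt (fun θ => Real.sin θ ^ 3 * p θ) (Real.sin θ * G2 θ) θ := fun θ => by
    convert! ((Real.hasDerivAt_sin θ).pow 3).mul (hp θ) using 1
    simp [G2]
    ring
  have hG2 : ∀ θ, HasDerivAt G2 (G3 θ) θ := fun θ => by
    convert! ((((Real.hasDerivAt_sin θ).mul (Real.hasDerivAt_cos θ)).const_mul 3).mul (hp θ)).add
      (((Real.hasDerivAt_sin θ).pow 2).mul (hp' θ)) using 1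
    simp [G3]
  have hG2c : Continuous G2 := by fun_prop
  have hG3c : Continuous G3 := by fun_prop
  refine ⟨∫ θ in (0 : ℝ)..Real.pi, |G3 θ|, fun a => ?_⟩
  have i1 := integral_phase_mul_sin a hG1 (by fun_prop) (by simp) (by simp)
  have i2 := integral_phase_mul_sin a hG2 hG3c (by simp [G2]) (by simp [G2])
  have e1 : ∀ θ : ℝ, (Real.sin θ * (Real.sin θ ^ 3 * p θ) : ℝ) = Real.sin θ ^ 4 * p θ := fun θ => by
    ring
  simp_rw [e1] at i1
  have i3 : (a : ℂ) ^ 2 * ∫ θ in (0 : ℝ)..Real.pi,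
      Complex.exp (Complex.I * (a * Real.cos θ : ℝ)) * (Real.sin θ ^ 4 * p θ : ℝ) =
      -∫ θ in (0 : ℝ)..Real.pi, Complex.exp (Complex.I * (a * Real.cos θ : ℝ)) * (G3 θ : ℂ) := by
    rw [pow_two, mul_assoc, i1, mul_left_comm, i2, ← mul_assoc]
    simp
  have i4 := congrArg norm i3
  rw [norm_mul, norm_pow, Complex.norm_real, Real.norm_eq_abs, sq_abs, norm_neg] at i4
  rw [i4]
  refine (intervalIntegral.norm_integral_le_integral_norm Real.pi_pos.le).trans_eq ?_
  congr 1
  funext θ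
  rw [norm_mul, mul_comm Complex.I, Complex.norm_exp_ofReal_mul_I, one_mul, Complex.norm_real,
    Real.norm_eq_abs]

theorem integrableOn_Ioi_of_sq_mul_norm_le {f : ℝ → ℂ} (hf : Continuous f) {C : ℝ}
    (h : ∀ t, t ^ 2 * ‖f t‖ ≤ C) : IntegrableOn f (Set.Ioi 0) := by
  have h1 : IntegrableOn f (Set.Ioc 0 1) := hf.integrableOn_Ioc
  have h2 : IntegrableOn f (Set.Ioi 1) := by
    have hd : IntegrableOn (fun t : ℝ => C * t ^ (-2 : ℝ)) (Set.Ioi 1) :=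
      (integrableOn_Ioi_rpow_of_lt (by norm_num) one_pos).const_mul C
    refine hd.mono' hf.aestronglyMeasurable ?_
    refine (ae_restrict_iff' measurableSet_Ioi).2 (Eventually.of_forall fun t ht => ?_)
    have ht0 : (0 : ℝ) < t := lt_trans one_pos ht
    rw [Real.rpow_neg ht0.le, Real.rpow_two, ← div_eq_mul_inv, le_div_iff₀ (by positivity), mul_comm]
    exact h t
  rw [← Set.Ioc_union_Ioi_eq_Ioi (zero_le_one' ℝ)]
  exact h1.union h2

/-- The operator `4 t_c² - h²`, which damps the two spectral edges of the Dirichlet Laplacian. -/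
noncomputable def edgeDamping (tc : ℝ) : Lead →L[ℂ] Lead :=
  ((2 * tc : ℂ) ^ 2) • 1 - dirichletLaplacian tc * dirichletLaplacian tc

theorem HasSineCoeffs.edgeDamping {x : Lead} {φ : ℝ → ℂ} (h : HasSineCoeffs x φ)
    (hφ : Continuous φ) (tc : ℝ) :
    HasSineCoeffs (edgeDamping tc x) (fun θ => ((2 * tc * Real.sin θ) ^ 2 : ℝ) * φ θ) := by
  have h1 := (h.smul ((2 * tc : ℂ) ^ 2)).sub
    ((h.dirichletLaplacian hφ tc).dirichletLaplacian (by fun_prop) tc) (by fun_prop) (by fun_prop)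
  have e : (fun θ => ((2 * tc * Real.sin θ) ^ 2 : ℝ) * φ θ) = fun θ => (2 * tc : ℂ) ^ 2 * φ θ -
      (2 * tc * Real.cos θ : ℝ) * ((2 * tc * Real.cos θ : ℝ) * φ θ) := by
    funext θ
    have hs := congrArg (fun r : ℝ => (r : ℂ)) (Real.sin_sq_add_cos_sq θ)
    push_cast at hs ⊢
    linear_combination ((2 * tc) ^ 2 * φ θ) * hs
  rw [e]
  exact h1

/-- Damping twice puts (2 t_c sin θ)⁴ into the sine coefficients, just enough for two integrations
by parts and so for t⁻² decay. -/
theorem integrableOn_expI_edgeDamping {tc : ℝ} (htc : 0 < tc) (m n : ℕ) :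
    IntegrableOn (fun t : ℝ => (expI (dirichletLaplacian tc) t
      (edgeDamping tc (edgeDamping tc (lp.single 2 n (1 : ℂ))))) m) (Set.Ioi 0) := by
  have hc := (((hasSineCoeffs_single n).edgeDamping (by fun_prop) tc).edgeDamping (by fun_prop) tc)
  set p : ℝ → ℝ := fun θ => Real.sin ((n + 1) * θ) * Real.sin ((m + 1) * θ)
  have hp : ContDiff ℝ 2 p := by fun_prop
  have hp1 : ContDiff ℝ 1 (deriv p) := ((contDiff_succ_iff_deriv (n := 1)).1 hp).2.2
  obtain ⟨C, hC⟩ := exists_sq_mul_norm_integral_phase_le (p := p) (p' := deriv p)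
    (p'' := deriv (deriv p)) (fun θ => (hp.differentiable (by norm_num) θ).hasDerivAt)
    (fun θ => (hp1.differentiable (by norm_num) θ).hasDerivAt) (hp1.continuous_deriv le_rfl)
  -- The constant is (2/π)(2 t_c)⁴ / (2 t_c)²: the normalisation of the transform, the damping
  -- factors, and the square of a = 2 t_c t.
  refine integrableOn_Ioi_of_sq_mul_norm_le (C := 8 * tc ^ 2 / Real.pi * C) ?_ fun t => ?_
  · have hcont : Continuous fun t : ℝ => expI (dirichletLaplacian tc) t
        (edgeDamping tc (edgeDamping tc (lp.single 2 n (1 : ℂ)))) :=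
      continuous_iff_continuousAt.2 fun t => (hasDerivAt_expI_apply _ _ t).continuousAt
    simp_rw [← inner_leadSingle m]
    exact continuous_const.inner hcont
  · rw [hc.expI (by fun_prop) tc t m]
    have e : ∀ θ : ℝ, Complex.exp (Complex.I * (2 * tc * t * Real.cos θ : ℝ)) *
        (((2 * tc * Real.sin θ) ^ 2 : ℝ) * (((2 * tc * Real.sin θ) ^ 2 : ℝ) *
          (Real.sin ((n + 1) * θ) : ℂ))) * (Real.sin ((m + 1) * θ) : ℂ) =
        (2 * tc : ℂ) ^ 4 * (Complex.exp (Complex.I * (2 * tc * t * Real.cos θ : ℝ)) *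
          (Real.sin θ ^ 4 * p θ : ℝ)) := by
      intro θ
      simp only [p]
      push_cast
      ring
    simp_rw [e]
    rw [intervalIntegral.integral_const_mul]
    have hC' := hC (2 * tc * t)
    rw [norm_mul, norm_mul, norm_div, norm_pow]
    have n1 : ‖(2 * tc : ℂ)‖ = 2 * tc := by
      rw [norm_mul, Complex.norm_real, Real.norm_of_nonneg htc.le]
      simp
    rw [n1, Complex.norm_real, Real.norm_of_nonneg Real.pi_pos.le, Complex.norm_ofNat]
    calc _ = 8 * tc ^ 2 / Real.pi * ((2 * tc * t) ^ 2 * ‖∫ θ in (0 : ℝ)..Real.pi,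
          Complex.exp (Complex.I * (2 * tc * t * Real.cos θ : ℝ)) *
            (Real.sin θ ^ 4 * p θ : ℝ)‖) := by ring
      _ ≤ _ := by gcongr

/-- At a band edge the recurrence has the double root σ, so ψ(n) = σⁿ (n+1) ψ(0). This is unbounded
unless ψ(0) = 0. -/
theorem eq_zero_of_dirichletLaplacian_eq {tc : ℝ} (htc : tc ≠ 0) {σ : ℂ} (hσ : σ * σ = 1)
    {ψ : Lead} (h : dirichletLaplacian tc ψ = (2 * tc * σ) • ψ) : ψ = 0 := by
  have htc' : (tc : ℂ) ≠ 0 := by exact_mod_cast htc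
  have hn : ∀ n : ℕ, (tc : ℂ) ≠ 0 → dirichletLaplacian tc ψ n = 2 * tc * σ * ψ n := fun n _ => by
    rw [h]; rfl
  have h1 : ψ 1 = 2 * σ * ψ 0 := by
    have := hn 0 htc'
    rw [dirichletLaplacian_zero] at this
    exact mul_left_cancel₀ htc' (by rw [this]; ring)
  have h2 : ∀ n, ψ (n + 2) = 2 * σ * ψ (n + 1) - ψ n := fun n => by
    have := hn (n + 1) htc'
    rw [dirichletLaplacian_succ] at this
    exact mul_left_cancel₀ htc' (by linear_combination this)
  have h3 : ∀ n : ℕ, ψ n = σ ^ n * (n + 1) * ψ 0 ∧ ψ (n + 1) = σ ^ (n + 1) * (n + 2) * ψ 0 := by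
    intro n
    induction n with
    | zero => exact ⟨by simp, by rw [h1]; push_cast; ring⟩
    | succ n ih =>
      refine ⟨by rw [ih.2]; push_cast; ring, ?_⟩
      rw [h2, ih.1, ih.2]
      push_cast
      linear_combination ((n + 1) * σ ^ n * ψ 0) * hσ
  have hσn : ‖σ‖ = 1 := by
    have := congrArg norm hσ
    rw [norm_mul, norm_one] at this
    nlinarith [norm_nonneg σ]
  have h4 : ∀ n : ℕ, (n : ℝ) * ‖ψ 0‖ ≤ ‖ψ‖ := fun n => by
    have h5 := lp.norm_apply_le_norm (by norm_num) ψ n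
    rw [(h3 n).1, norm_mul, norm_mul, norm_pow, hσn, one_pow, one_mul] at h5
    refine le_trans (mul_le_mul_of_nonneg_right ?_ (norm_nonneg _)) h5
    have : ‖(n + 1 : ℂ)‖ = n + 1 := by
      rw [← Nat.cast_succ, Complex.norm_natCast]; simp
    linarith
  have h0 : ψ 0 = 0 := by
    by_contra hne
    have hpos : 0 < ‖ψ 0‖ := norm_pos_iff.2 hne
    obtain ⟨n, hn⟩ := exists_nat_gt (‖ψ‖ / ‖ψ 0‖)
    rw [div_lt_iff₀ hpos] at hn
    exact absurd (h4 n) (not_le.2 hn)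
  ext n
  rw [(h3 n).1, h0]
  simp

theorem isSelfAdjoint_edgeDamping (tc : ℝ) : IsSelfAdjoint (edgeDamping tc) := by
  unfold edgeDamping
  refine IsSelfAdjoint.sub (IsSelfAdjoint.smul ?_ (IsSelfAdjoint.one _)) ?_
  · simp [IsSelfAdjoint]
  · have := isSelfAdjoint_dirichletLaplacian tc
    rw [IsSelfAdjoint, star_mul, this.star_eq]

/-- From D²ψ = 4 t_c² ψ the vector Dψ - 2 t_c ψ is an eigenvector at the lower edge -2 t_c, hence
zero; then ψ is one at the upper edge. -/
theorem eq_zero_of_edgeDamping_eq_zero {tc : ℝ} (htc : tc ≠ 0) {ψ : Lead}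
    (h : edgeDamping tc ψ = 0) : ψ = 0 := by
  set D := dirichletLaplacian tc
  have h1 : (2 * tc : ℂ) ^ 2 • ψ = D (D ψ) := by
    have : (2 * tc : ℂ) ^ 2 • ψ - D (D ψ) = 0 := h
    exact sub_eq_zero.1 this
  have h2 : D ψ - (2 * tc : ℂ) • ψ = 0 := by
    refine eq_zero_of_dirichletLaplacian_eq htc (σ := -1) (by norm_num) ?_
    rw [map_sub, map_smul, ← h1, smul_sub, smul_smul]
    module
  refine eq_zero_of_dirichletLaplacian_eq htc (σ := 1) (by norm_num) ?_
  rw [mul_one]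
  exact sub_eq_zero.1 h2

/-- The damping is self-adjoint, so a vector orthogonal to the family is annihilated by its square;
injectivity finishes the proof. -/
theorem dense_span_edgeDamping {tc : ℝ} (htc : tc ≠ 0) :
    (Submodule.span ℂ (Set.range fun n : ℕ =>
      edgeDamping tc (edgeDamping tc (lp.single 2 n (1 : ℂ))))).topologicalClosure = ⊤ := by
  rw [Submodule.topologicalClosure_eq_top_iff, Submodule.eq_bot_iff]
  intro ψ hψ
  have hR : ∀ x y : Lead, ⟪edgeDamping tc x, y⟫_ℂ = ⟪x, edgeDamping tc y⟫_ℂ := fun x y =>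
    (isSelfAdjoint_edgeDamping tc).isSymmetric x y
  have h1 : edgeDamping tc (edgeDamping tc ψ) = 0 := by
    ext n
    rw [← inner_leadSingle, ← hR, ← hR]
    exact (Submodule.mem_orthogonal _ _).1 hψ _ (Submodule.subset_span ⟨n, rfl⟩)
  exact eq_zero_of_edgeDamping_eq_zero htc (eq_zero_of_edgeDamping_eq_zero htc h1)

end DirichletLaplacian

/-! ### Cook's method -/

section Cook

variable {E F : Type*} [NormedAddCommGroup E] [InnerProductSpace ℂ E] [CompleteSpace E]
  [NormedAddCommGroup F] [InnerProductSpace ℂ F] [CompleteSpace F]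

theorem hasDerivAt_expI_neg_comp_expI (A : E →L[ℂ] E) (B : F →L[ℂ] F) (J : F →L[ℂ] E) (x : F)
    (t : ℝ) :
    HasDerivAt (fun t => expI A (-t) (J (expI B t x)))
      (-(Complex.I • expI A (-t) (A (J (expI B t x)) - J (B (expI B t x))))) t := by
  have h2 : HasDerivAt (fun s => J (expI B s x)) (J (Complex.I • B (expI B t x))) t :=
    (J.restrictScalars ℝ).hasFDerivAt.comp_hasDerivAt t (hasDerivAt_expI_apply B x t)
  convert! hasDerivAt_clm_apply (hasDerivAt_expI_neg A t) h2 using 1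
  simp [sub_eq_add_neg, add_comm]

theorem inner_self_eq_ofReal (x : E) : ⟪x, x⟫_ℂ = ((‖x‖ ^ 2 : ℝ) : ℂ) := by
  rw [inner_self_eq_norm_sq_to_K]
  simp

theorem continuous_expI_apply (A : E →L[ℂ] E) (x : E) : Continuous fun t => expI A t x :=
  (continuous_expI A).clm_apply continuous_const

/-- Cook's criterion. By unitarity of e^{-itA} the derivative of the curve has the norm of (AJ - JB)
e^{itB} x, and a curve with integrable derivative converges. The identification J allows the two
dynamics to live on different spaces. -/
theorem exists_tendsto_of_integrableOn {A : E →L[ℂ] E} (hA : IsSelfAdjoint A) (B : F →L[ℂ] F)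
    (J : F →L[ℂ] E) (x : F)
    (h : IntegrableOn (fun t => A (J (expI B t x)) - J (B (expI B t x))) (Set.Ioi 0)) :
    ∃ l, Tendsto (fun t => expI A (-t) (J (expI B t x))) atTop (𝓝 l) := by
  refine ⟨_, tendsto_limUnder_of_hasDerivAt_of_integrableOn_Ioi (a := 0)
    (fun t _ => hasDerivAt_expI_neg_comp_expI A B J x t) ?_⟩
  refine Integrable.mono h ?_ ?_
  · refine Continuous.aestronglyMeasurable ?_
    have hB := continuous_expI_apply B x
    have hA' : Continuous fun t => expI A (-t) := (continuous_expI A).comp continuous_neg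
    exact ((hA'.clm_apply (by fun_prop)).const_smul _).neg
  · filter_upwards with t
    rw [norm_neg, norm_smul, norm_expI_apply hA, Complex.norm_I, one_mul]

/-- Absolutely continuous vectors are orthogonal to the kernel. -/
theorem inner_eq_zero_of_mem_acVectors {A : E →L[ℂ] E} (hA : IsSelfAdjoint A) {v ψ : E}
    (hv : A v = 0) (hψ : ψ ∈ acVectors A) : ⟪v, ψ⟫_ℂ = 0 := by
  obtain ⟨m, ⟨hfin, hm⟩, hac⟩ := hψ
  -- These functions tend pointwise to the indicator of {0}. Each s_n(A) fixes v, because (1 + nA²)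
  -- v = v, whereas ‖s_n(A) ψ‖² tends to m({0}) = 0.
  set s : ℕ → ℝ → ℝ := fun n x => (1 + n * x ^ 2)⁻¹
  have hpos : ∀ (n : ℕ) (x : ℝ), 0 < 1 + n * x ^ 2 := fun n x => by positivity
  have hsc : ∀ n, Continuous (s n) := fun n => by
    refine Continuous.inv₀ (by fun_prop) fun x => (hpos n x).ne'
  have hs1 : ∀ n x, |s n x| ≤ 1 := fun n x => by
    rw [abs_of_pos (inv_pos.2 (hpos n x))]
    exact inv_le_one_of_one_le₀ (by have : (0 : ℝ) ≤ n * x ^ 2 := by positivity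
                                    linarith)
  have hsv : ∀ n, cfc (s n) A v = v := fun n => by
    have e1 : cfc (s n) A * cfc (fun x : ℝ => 1 + n * x ^ 2) A = 1 := by
      rw [← cfc_mul _ _ A (hsc n).continuousOn (by fun_prop)]
      have : (fun x => s n x * (1 + n * x ^ 2)) = fun _ => (1 : ℝ) := by
        funext x
        exact inv_mul_cancel₀ (hpos n x).ne'
      rw [this, cfc_const_one ℝ A]
    have e2 : cfc (fun x : ℝ => 1 + n * x ^ 2) A v = v := by
      rw [cfc_const_add 1 (fun x : ℝ => n * x ^ 2) A, cfc_const_mul (n : ℝ) (fun x : ℝ => x ^ 2) A,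
        cfc_pow_id A 2]
      simp [pow_two, hv]
    have e3 := congrArg (fun T => T v) e1
    simpa [e2] using e3
  have hsa : ∀ n, IsSelfAdjoint (cfc (s n) A) := fun n => cfc_predicate _ _
  have hnorm : ∀ n, ‖cfc (s n) A ψ‖ ^ 2 = ∫ x, s n x ^ 2 ∂m := fun n => by
    have hb := hm (BoundedContinuousFunction.ofNormedAddCommGroup (fun x => s n x ^ 2)
      ((hsc n).pow 2) 1 fun x => by
        rw [norm_pow, Real.norm_eq_abs]
        exact pow_le_one₀ (abs_nonneg _) (hs1 n x))
    simp only [BoundedContinuousFunction.coe_ofNormedAddCommGroup] at hb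
    have e1 : cfc (fun x => s n x ^ 2) A = cfc (s n) A * cfc (s n) A := by
      rw [← cfc_mul _ _ A (hsc n).continuousOn (hsc n).continuousOn]
      simp_rw [pow_two]
    have e2 : ⟪ψ, cfc (s n) A (cfc (s n) A ψ)⟫_ℂ = ⟪cfc (s n) A ψ, cfc (s n) A ψ⟫_ℂ :=
      ((hsa n).isSymmetric _ _).symm
    rw [e1] at hb
    change ⟪ψ, cfc (s n) A (cfc (s n) A ψ)⟫_ℂ = _ at hb
    rw [e2, inner_self_eq_ofReal] at hb
    exact Complex.ofReal_injective hb
  have hlim : Tendsto (fun n => ∫ x, s n x ^ 2 ∂m) atTop (𝓝 (∫ _, (0 : ℝ) ∂m)) := by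
    refine tendsto_integral_of_dominated_convergence (fun _ => 1) (fun n =>
      ((hsc n).pow 2).aestronglyMeasurable) (integrable_const _) (fun n => ?_) ?_
    · filter_upwards with x
      rw [norm_pow, Real.norm_eq_abs]
      exact pow_le_one₀ (abs_nonneg _) (hs1 n x)
    · have h0 : ∀ᵐ x ∂m, x ≠ 0 := hac (Measure.ae_ne volume (0 : ℝ))
      filter_upwards [h0] with x hx
      have h1 : Tendsto (fun n : ℕ => 1 + (n : ℝ) * x ^ 2) atTop atTop :=
        tendsto_atTop_add_const_left _ _
          (tendsto_natCast_atTop_atTop.atTop_mul_const (by positivity))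
      simpa only [Pi.inv_apply, ne_eq, OfNat.ofNat_ne_zero, not_false_eq_true, zero_pow] using
        h1.inv_tendsto_atTop.pow 2
  rw [integral_zero] at hlim
  have hle : ∀ n, ‖⟪v, ψ⟫_ℂ‖ ≤ ‖v‖ * Real.sqrt (∫ x, s n x ^ 2 ∂m) := fun n => by
    rw [← hnorm n, Real.sqrt_sq (norm_nonneg _)]
    conv_lhs => rw [← hsv n]
    have e2 : ⟪cfc (s n) A v, ψ⟫_ℂ = ⟪v, cfc (s n) A ψ⟫_ℂ := (hsa n).isSymmetric _ _
    rw [e2]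
    exact norm_inner_le_norm _ _
  have hlim2 := (hlim.sqrt).const_mul ‖v‖
  rw [Real.sqrt_zero, mul_zero] at hlim2
  exact norm_le_zero_iff.1 (ge_of_tendsto' hlim2 hle)

theorem inner_eq_zero_of_mem_acSubspace {A : E →L[ℂ] E} (hA : IsSelfAdjoint A) {v ψ : E}
    (hv : A v = 0) (hψ : ψ ∈ acSubspace A) : ⟪v, ψ⟫_ℂ = 0 := by
  have h : acSubspace A ≤ (innerSL ℂ v).ker :=
    Submodule.topologicalClosure_minimal _
      (Submodule.span_le.2 fun x hx => by
        simpa using inner_eq_zero_of_mem_acVectors hA hv hx)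
      (innerSL ℂ v).isClosed_ker
  simpa using h hψ

end Cook

/-! ### Elementary properties of the model -/

section Space

variable {N : ℕ}

theorem inner_zeta (k : Fin N) (ψ : Hilb N) : ⟪zeta k, ψ⟫_ℂ = ψ.snd k := by
  rw [zeta, inner_ofSample, sampleBasis, EuclideanSpace.inner_single_left]
  simp

theorem adjoint_ofLead_apply (j : Fin 2) (ψ : Hilb N) :
    ContinuousLinearMap.adjoint (ofLead j) ψ = leadPart ψ j :=
  ext_inner_left ℂ fun x => by rw [ContinuousLinearMap.adjoint_inner_right, inner_ofLead]

theorem adjoint_ofSample_apply (ψ : Hilb N) :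
    ContinuousLinearMap.adjoint ofSample ψ = ψ.snd :=
  ext_inner_left ℂ fun x => by rw [ContinuousLinearMap.adjoint_inner_right, inner_ofSample]

theorem leadPart_ofLead_self (j : Fin 2) (x : Lead) : leadPart (ofLead (N := N) j x) j = x := by
  simp [ofLead, leadPart]

theorem leadPart_ofLead_of_ne {i j : Fin 2} (h : i ≠ j) (x : Lead) :
    leadPart (ofLead (N := N) j x) i = 0 := by
  simp [ofLead, leadPart, h]

theorem leadPart_ofSample (j : Fin 2) (x : Sample N) : leadPart (ofSample x) j = 0 := by
  simp [ofSample, leadPart]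

theorem snd_ofLead (j : Fin 2) (x : Lead) : (ofLead (N := N) j x).snd = 0 := by
  simp [ofLead]

theorem snd_ofSample (x : Sample N) : (ofSample x).snd = x := by
  simp [ofSample]

theorem directSum_apply (A : Fin 2 → Lead →L[ℂ] Lead) (B : Sample N →L[ℂ] Sample N) (ψ : Hilb N) :
    directSum A B ψ = ∑ j, ofLead j (A j (leadPart ψ j)) + ofSample (B ψ.snd) := by
  simp [directSum, adjoint_ofLead_apply, adjoint_ofSample_apply]

theorem directSum_ofLead (A : Fin 2 → Lead →L[ℂ] Lead) (B : Sample N →L[ℂ] Sample N) (j : Fin 2)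
    (x : Lead) : directSum A B (ofLead j x) = ofLead j (A j x) := by
  rw [directSum_apply, snd_ofLead, map_zero, map_zero, add_zero, Finset.sum_eq_single j]
  · rw [leadPart_ofLead_self]
  · intro i _ hi
    rw [leadPart_ofLead_of_ne hi, map_zero, map_zero]
  · simp

theorem directSum_ofSample (A : Fin 2 → Lead →L[ℂ] Lead) (B : Sample N →L[ℂ] Sample N)
    (x : Sample N) : directSum A B (ofSample x) = ofSample (B x) := by
  simp [directSum_apply, snd_ofSample, leadPart_ofSample]

theorem sum_ofLead_add_ofSample (ψ : Hilb N) :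
    ∑ j, ofLead j (leadPart ψ j) + ofSample ψ.snd = ψ := by
  refine ext_inner_right ℂ fun φ => ?_
  rw [inner_add_left, sum_inner, inner_ofSample, WithLp.prod_inner_apply, PiLp.inner_apply]
  simp_rw [inner_ofLead]
  rfl

theorem inner_eq_sum (φ ψ : Hilb N) :
    ⟪φ, ψ⟫_ℂ = ∑ j, ⟪leadPart φ j, leadPart ψ j⟫_ℂ + ⟪φ.snd, ψ.snd⟫_ℂ := by
  rw [WithLp.prod_inner_apply, PiLp.inner_apply]
  rfl

theorem leadPart_directSum (A : Fin 2 → Lead →L[ℂ] Lead) (B : Sample N →L[ℂ] Sample N)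
    (ψ : Hilb N) (j : Fin 2) : leadPart (directSum A B ψ) j = A j (leadPart ψ j) :=
  ext_inner_left ℂ fun x => by
    rw [← inner_ofLead, directSum_apply, inner_add_right, inner_sum, Finset.sum_eq_single j]
    · rw [inner_ofLead, inner_ofLead, leadPart_ofLead_self, leadPart_ofSample, inner_zero_right,
        add_zero]
    · intro i _ hi
      rw [inner_ofLead, leadPart_ofLead_of_ne hi.symm, inner_zero_right]
    · simp

theorem snd_directSum (A : Fin 2 → Lead →L[ℂ] Lead) (B : Sample N →L[ℂ] Sample N)
    (ψ : Hilb N) : (directSum A B ψ).snd = B ψ.snd :=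
  ext_inner_left ℂ fun x => by
    rw [← inner_ofSample, directSum_apply, inner_add_right, inner_sum, Finset.sum_eq_zero]
    · rw [inner_ofSample, snd_ofSample, zero_add]
    · intro i _
      rw [inner_ofSample, snd_ofLead, inner_zero_right]

theorem isSelfAdjoint_directSum {A : Fin 2 → Lead →L[ℂ] Lead} {B : Sample N →L[ℂ] Sample N}
    (hA : ∀ j, IsSelfAdjoint (A j)) (hB : IsSelfAdjoint B) : IsSelfAdjoint (directSum A B) := by
  rw [ContinuousLinearMap.isSelfAdjoint_iff_isSymmetric]
  intro x y
  change ⟪directSum A B x, y⟫_ℂ = ⟪x, directSum A B y⟫_ℂ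
  simp_rw [inner_eq_sum, leadPart_directSum, snd_directSum]
  congr 1
  · exact Finset.sum_congr rfl fun j _ => (hA j).isSymmetric _ _
  · exact hB.isSymmetric _ _

theorem norm_sq_eq_sum (ψ : Hilb N) : ‖ψ‖ ^ 2 = ∑ j, ‖leadPart ψ j‖ ^ 2 + ‖ψ.snd‖ ^ 2 := by
  have h := inner_eq_sum ψ ψ
  simp_rw [inner_self_eq_ofReal] at h
  exact_mod_cast h

theorem norm_directSum_le {A : Fin 2 → Lead →L[ℂ] Lead} {B : Sample N →L[ℂ] Sample N}
    (hA : ∀ j, ‖A j‖ ≤ 1) (hB : ‖B‖ ≤ 1) : ‖directSum A B‖ ≤ 1 := by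
  refine ContinuousLinearMap.opNorm_le_bound _ zero_le_one fun ψ => ?_
  rw [one_mul]
  refine le_of_sq_le_sq ?_ (norm_nonneg _)
  rw [norm_sq_eq_sum, norm_sq_eq_sum ψ]
  simp_rw [leadPart_directSum, snd_directSum]
  gcongr with j
  · simpa using (A j).le_of_opNorm_le (hA j) (leadPart ψ j)
  · simpa using B.le_of_opNorm_le hB ψ.snd

theorem directSum_mul (A A' : Fin 2 → Lead →L[ℂ] Lead) (B B' : Sample N →L[ℂ] Sample N) :
    directSum A B * directSum A' B' = directSum (fun j => A j * A' j) (B * B') := by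
  ext1 ψ
  change directSum A B (directSum A' B' ψ) = _
  simp [directSum_apply _ _ ψ, directSum_ofLead, directSum_ofSample]

theorem norm_ofLead_le (j : Fin 2) : ‖(ofLead j : Lead →L[ℂ] Hilb N)‖ ≤ 1 := by
  refine ContinuousLinearMap.opNorm_le_bound _ zero_le_one fun y => ?_
  have h : ⟪ofLead (N := N) j y, ofLead j y⟫_ℂ = ⟪y, y⟫_ℂ := by
    rw [inner_ofLead, leadPart_ofLead_self]
  rw [inner_self_eq_ofReal, inner_self_eq_ofReal] at h
  rw [one_mul]
  exact le_of_sq_le_sq (Complex.ofReal_injective h).le (norm_nonneg _)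

theorem hasCompactSupp_ofSample (x : Sample N) : HasCompactSupp (ofSample x) := fun j => by
  rw [leadPart_ofSample]
  simp

theorem hasCompactSupp_zeta (k : Fin N) : HasCompactSupp (zeta k) := hasCompactSupp_ofSample _

theorem hasCompactSupp_ofLead (j : Fin 2) {x : Lead} (hx : (Function.support fun n => x n).Finite) :
    HasCompactSupp (ofLead (N := N) j x) := fun i => by
  by_cases h : i = j
  · subst h
    rwa [leadPart_ofLead_self]
  · rw [leadPart_ofLead_of_ne h]
    simp

theorem hasCompactSupp_siteVec (i : (Fin 2 × ℕ) ⊕ Fin N) : HasCompactSupp (siteVec i) := by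
  rcases i with ⟨j, n⟩ | k
  · refine hasCompactSupp_ofLead j ((Set.finite_singleton n).subset fun m hm => ?_)
    by_contra hne
    have hne' : m ≠ n := hne
    exact hm (by simp [lp.single_apply, hne'])
  · exact hasCompactSupp_zeta k

theorem dense_span_siteVec :
    (Submodule.span ℂ (Set.range (siteVec (N := N)))).topologicalClosure = ⊤ := by
  rw [Submodule.topologicalClosure_eq_top_iff, Submodule.eq_bot_iff]
  intro ψ hψ
  have h := hasSum_inner_siteVec ψ ψ
  have h0 : ∀ i, ⟪siteVec i, ψ⟫_ℂ = 0 := fun i =>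
    (Submodule.mem_orthogonal _ _).1 hψ _ (Submodule.subset_span ⟨i, rfl⟩)
  simp_rw [h0, mul_zero] at h
  exact inner_self_eq_zero.1 (h.unique hasSum_zero)

theorem norm_zeta (k : Fin N) : ‖zeta k‖ = 1 := by
  have h : ⟪zeta k, zeta k⟫_ℂ = 1 := by
    rw [inner_zeta, zeta, snd_ofSample]
    simp [sampleBasis]
  rw [inner_self_eq_ofReal] at h
  have h' : ‖zeta k‖ ^ 2 = 1 := by exact_mod_cast h
  exact (pow_eq_one_iff_of_nonneg (norm_nonneg _) two_ne_zero).1 h'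

theorem ketbra_apply {E : Type*} [NormedAddCommGroup E] [InnerProductSpace ℂ E] [CompleteSpace E]
    (x y z : E) : ketbra x y z = ⟪y, z⟫_ℂ • x := by
  simp [ketbra]

/-- The diagonal sample potential with entries `w`. -/
noncomputable def samplePotential (w : Fin N → ℂ) : Hilb N →L[ℂ] Hilb N :=
  ∑ k, w k • ketbra (zeta k) (zeta k)

theorem samplePotential_apply (w : Fin N → ℂ) (ψ : Hilb N) :
    samplePotential w ψ = ∑ k, (w k * ⟪zeta k, ψ⟫_ℂ) • zeta k := by
  simp [samplePotential, ketbra_apply, smul_smul]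

theorem samplePotential_ofLead (w : Fin N → ℂ) (j : Fin 2) (x : Lead) :
    samplePotential w (ofLead j x) = 0 := by
  simp_rw [samplePotential_apply, inner_zeta, snd_ofLead]
  simp

theorem isSelfAdjoint_samplePotential {w : Fin N → ℂ} (hw : ∀ k, (starRingEnd ℂ) (w k) = w k) :
    IsSelfAdjoint (samplePotential w) := by
  rw [ContinuousLinearMap.isSelfAdjoint_iff_isSymmetric]
  intro x y
  change ⟪samplePotential w x, y⟫_ℂ = ⟪x, samplePotential w y⟫_ℂ
  simp_rw [samplePotential_apply, sum_inner, inner_sum, inner_smul_left, inner_smul_right, map_mul,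
    hw, inner_conj_symm]
  exact Finset.sum_congr rfl fun k _ => by ring

end Space

namespace Model

variable {N : ℕ} (P : Model N)

theorem isSelfAdjoint_HL : IsSelfAdjoint P.HL :=
  isSelfAdjoint_directSum (fun _ => isSelfAdjoint_dirichletLaplacian _) (IsSelfAdjoint.zero (Sample N →L[ℂ] Sample N))

theorem hτ_apply (ψ : Hilb N) : P.hτ ψ = (P.τ : ℂ) • ∑ j,
    (⟪ofLead j (P.L j), ψ⟫_ℂ • ofSample (P.S j) + ⟪ofSample (P.S j), ψ⟫_ℂ • ofLead j (P.L j)) := by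
  simp only [hτ, smul_apply, sum_apply, add_apply, ketbra_apply]

theorem isSelfAdjoint_hτ : IsSelfAdjoint P.hτ := by
  rw [ContinuousLinearMap.isSelfAdjoint_iff_isSymmetric]
  intro x y
  change ⟪P.hτ x, y⟫_ℂ = ⟪x, P.hτ y⟫_ℂ
  simp_rw [hτ_apply, inner_smul_left, inner_smul_right, sum_inner, inner_sum, inner_add_left,
    inner_add_right, inner_smul_left, inner_smul_right, inner_conj_symm, Complex.conj_ofReal]
  congr 1
  exact Finset.sum_congr rfl fun k _ => by ring

theorem isSelfAdjoint_H : IsSelfAdjoint P.H := by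
  unfold H
  exact IsSelfAdjoint.add (R := Hilb N →L[ℂ] Hilb N)
    (isSelfAdjoint_directSum (fun _ => isSelfAdjoint_dirichletLaplacian _) P.hs_selfAdjoint)
    P.isSelfAdjoint_hτ

theorem isSelfAdjoint_H_add_samplePotential {w : Fin N → ℂ}
    (hw : ∀ k, (starRingEnd ℂ) (w k) = w k) : IsSelfAdjoint (P.H + samplePotential w) :=
  IsSelfAdjoint.add (R := Hilb N →L[ℂ] Hilb N) P.isSelfAdjoint_H (isSelfAdjoint_samplePotential hw)

theorem HL_ofLead (j : Fin 2) (x : Lead) :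
    P.HL (ofLead j x) = ofLead j (dirichletLaplacian P.tc x) :=
  directSum_ofLead _ _ _ _

theorem HL_zeta (k : Fin N) : P.HL (zeta k) = 0 := by
  rw [zeta, HL, directSum_ofSample]
  simp

theorem H_ofLead (j : Fin 2) (x : Lead) :
    P.H (ofLead j x) = ofLead j (dirichletLaplacian P.tc x) +
      ((P.τ : ℂ) * ⟪P.L j, x⟫_ℂ) • ofSample (P.S j) := by
  change directSum _ _ (ofLead j x) + P.hτ (ofLead j x) = _
  rw [directSum_ofLead, hτ_apply, Finset.sum_eq_single j]
  · rw [inner_ofLead, inner_ofSample, leadPart_ofLead_self, snd_ofLead, inner_zero_right, zero_smul,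
      add_zero, smul_smul]
  · intro i _ hi
    rw [inner_ofLead, inner_ofSample, leadPart_ofLead_of_ne hi, snd_ofLead, inner_zero_right,
      inner_zero_right, zero_smul, zero_smul, add_zero]
  · simp

/-- The perturbation has finite rank, and every coefficient is an inner product with a compactly
supported vector. Along e^{itH} these coefficients are exactly what the dispersive assumption
controls. -/
theorem H_sub_HL_apply (ψ : Hilb N) : P.H ψ - P.HL ψ =
    ∑ k, ⟪zeta k, ψ⟫_ℂ • ofSample (P.hs (sampleBasis k)) + (P.τ : ℂ) • ∑ j,
    (⟪ofLead j (P.L j), ψ⟫_ℂ • ofSample (P.S j) + ⟪ofSample (P.S j), ψ⟫_ℂ • ofLead j (P.L j)) := by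
  have h1 : P.H ψ = directSum (fun _ => dirichletLaplacian P.tc) P.hs ψ + P.hτ ψ := rfl
  have h2 : ψ.snd = ∑ k, ψ.snd k • sampleBasis k := by
    ext i
    simp [sampleBasis, Pi.single_apply]
  rw [h1, hτ_apply, HL, directSum_apply, directSum_apply]
  simp_rw [inner_zeta]
  conv_lhs => rw [h2]
  simp only [map_sum, map_smul, zero_apply, map_zero, smul_zero, Finset.sum_const_zero, add_zero]
  abel

/-- Under the dispersive assumption, `e^{-itH_L} e^{itH}` converges strongly. -/
theorem exists_tendsto_of_dispersive (hP : P.Dispersive) (x : Hilb N) :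
    ∃ l, Tendsto (fun t => expI P.HL (-t) (expI P.H t x)) atTop (𝓝 l) := by
  refine exists_tendsto_of_span_dense (T := fun t => expI P.HL (-t) * expI P.H t)
    (s := Set.range siteVec) (fun t => ?_) ?_ (by rw [dense_span_siteVec]; trivial)
  · refine (norm_mul_le _ _).trans (mul_le_one₀ (norm_expI_le P.isSelfAdjoint_HL _) (norm_nonneg _)
      (norm_expI_le P.isSelfAdjoint_H _))
  · rintro _ ⟨i, rfl⟩
    refine exists_tendsto_of_integrableOn P.isSelfAdjoint_HL P.H 1 (siteVec i) ?_
    have hint : ∀ f, HasCompactSupp f → Integrable fun t => ⟪f, expI P.H t (siteVec i)⟫_ℂ :=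
      fun f hf => hP f _ hf (hasCompactSupp_siteVec i)
    have h : Integrable fun t => P.H (expI P.H t (siteVec i)) - P.HL (expI P.H t (siteVec i)) := by
      simp_rw [H_sub_HL_apply]
      refine Integrable.add (integrable_finsetSum _ fun k _ =>
        (hint _ (hasCompactSupp_zeta k)).smul_const _) (Integrable.smul (P.τ : ℂ)
          (integrable_finsetSum _ fun j _ => Integrable.add ?_ ?_))
      · exact (hint _ (hasCompactSupp_ofLead j (P.L_supp j))).smul_const _
      · exact (hint _ (hasCompactSupp_ofSample _)).smul_const _
    refine (h.neg.integrableOn (s := Set.Ioi 0)).congr_fun (fun t _ => ?_) measurableSet_Ioi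
    exact neg_sub _ _

theorem expI_HL_ofLead (t : ℝ) (j : Fin 2) (x : Lead) :
    expI P.HL t (ofLead j x) = ofLead j (expI (dirichletLaplacian P.tc) t x) :=
  expI_apply_of_intertwine (fun x => P.HL_ofLead j x) t x

/-- A sample potential vanishes on the leads, so the Cook integrand contains only the tunneling
term, which sees the finitely many sites in the support of L_j. The decay of the damped site vectors
then suffices, and no dispersive assumption on H enters. -/
theorem exists_tendsto_expI_ofLead {w : Fin N → ℂ} (hw : ∀ k, (starRingEnd ℂ) (w k) = w k)
    (j : Fin 2) (x : Lead) :
    ∃ l, Tendsto (fun t => expI (P.H + samplePotential w) (-t) (expI P.HL t (ofLead j x)))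
      atTop (𝓝 l) := by
  have hA : IsSelfAdjoint (P.H + samplePotential w) :=
    P.isSelfAdjoint_H_add_samplePotential hw
  simp_rw [expI_HL_ofLead]
  have hJ := norm_ofLead_le (N := N) j
  refine exists_tendsto_of_span_dense (T := fun t => expI (P.H + samplePotential w) (-t) ∘L
    ofLead j ∘L expI (dirichletLaplacian P.tc) t) (s := Set.range fun n : ℕ =>
      edgeDamping P.tc (edgeDamping P.tc (lp.single 2 n (1 : ℂ)))) (fun t => ?_) ?_
      (by rw [dense_span_edgeDamping P.tc_pos.ne']; trivial)
  · refine (ContinuousLinearMap.opNorm_comp_le _ _).trans (mul_le_one₀ (norm_expI_le hA _)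
      (norm_nonneg _) ?_)
    exact (ContinuousLinearMap.opNorm_comp_le _ _).trans (mul_le_one₀ hJ (norm_nonneg _)
      (norm_expI_le (isSelfAdjoint_dirichletLaplacian _) _))
  · rintro _ ⟨n, rfl⟩
    refine exists_tendsto_of_integrableOn hA (dirichletLaplacian P.tc) (ofLead j) _ ?_
    have e : ∀ y : Lead, (P.H + samplePotential w) (ofLead j y) -
        ofLead j (dirichletLaplacian P.tc y) =
          ((P.τ : ℂ) * ∑ m ∈ (P.L_supp j).toFinset, (starRingEnd ℂ) (P.L j m) * y m) •
            ofSample (P.S j) := by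
      intro y
      change P.H (ofLead j y) + samplePotential w (ofLead j y) - _ = _
      have h1 : ⟪P.L j, y⟫_ℂ = ∑ m ∈ (P.L_supp j).toFinset, (starRingEnd ℂ) (P.L j m) * y m := by
        have hz : ∀ m ∉ (P.L_supp j).toFinset, (⟪P.L j m, y m⟫_ℂ : ℂ) = 0 := fun m hm => by
          have : P.L j m = 0 := by simpa using hm
          rw [this, inner_zero_left]
        rw [(lp.hasSum_inner (P.L j) y).unique (hasSum_sum_of_ne_finset_zero hz)]
        exact Finset.sum_congr rfl fun m _ => by simp [mul_comm]
      rw [H_ofLead, samplePotential_ofLead, ← h1]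
      abel
    simp_rw [e]
    refine Integrable.smul_const ?_ _
    refine Integrable.const_mul (integrable_finsetSum _ fun m _ => Integrable.const_mul ?_ _) _
    exact integrableOn_expI_edgeDamping P.tc_pos m n

/-- H_L annihilates the sample, and absolutely continuous vectors are orthogonal to the kernel. -/
theorem mem_leads_of_mem_acSubspace {ψ : Hilb N} (h : ψ ∈ acSubspace P.HL) :
    ∑ j, ofLead j (leadPart ψ j) = ψ := by
  have h0 : ψ.snd = 0 := by
    ext k
    rw [← inner_zeta]
    exact inner_eq_zero_of_mem_acSubspace P.isSelfAdjoint_HL (P.HL_zeta k) h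
  simpa [h0] using sum_ofLead_add_ofSample ψ

theorem waveOpExists_HL {w : Fin N → ℂ} (hw : ∀ k, (starRingEnd ℂ) (w k) = w k) :
    WaveOpExists (P.H + samplePotential w) P.HL := by
  refine waveOpExists_of_tendsto fun x => ?_
  have hx : acProj P.HL x ∈ acSubspace P.HL := Submodule.starProjection_apply_mem _ _
  rw [← P.mem_leads_of_mem_acSubspace hx]
  choose l hl using fun j : Fin 2 => P.exists_tendsto_expI_ofLead hw j (leadPart (acProj P.HL x) j)
  refine ⟨∑ j, l j, ?_⟩
  simp_rw [map_sum]
  exact tendsto_finsetSum _ fun j _ => hl j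

end Model

/-! ### Duhamel formula and retarded convolutions -/

section Duhamel

variable {E : Type*} [NormedAddCommGroup E] [InnerProductSpace ℂ E] [CompleteSpace E]
  {ι : Type*} [Fintype ι]

/-- Differentiate s ↦ Z(t-s) e^{isA} f. The potential stands to the right of Z, so f enters only
through the scalars ⟨ζ_k, e^{isA} f⟩ and the unknown only through Z(t-s) ζ_k; for f among the ζ_k
the system closes. -/
theorem duhamel {A : E →L[ℂ] E} {ζ : ι → E} {w : ι → ℝ → ℂ} (hw : ∀ k, Continuous (w k))
    {Z : ℝ → E →L[ℂ] E} (hZ0 : Z 0 = 1)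
    (hZ : ∀ t, HasDerivAt Z
      (Complex.I • (Z t * (A + ∑ k, w k t • ketbra (ζ k) (ζ k)))) t) (f : E) (t : ℝ) :
    Z t f = expI A t f + Complex.I • ∑ k, ∫ s in (0 : ℝ)..t,
      ⟪ζ k, expI A s f⟫_ℂ • w k (t - s) • Z (t - s) (ζ k) := by
  have hZc : Continuous Z := continuous_iff_continuousAt.2 fun t => (hZ t).continuousAt
  have hd : ∀ s : ℝ, HasDerivAt (fun s => Z (t - s) (expI A s f))
      (-(Complex.I • ∑ k, ⟪ζ k, expI A s f⟫_ℂ • w k (t - s) • Z (t - s) (ζ k))) s := by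
    intro s
    have h1 : HasDerivAt (fun s : ℝ => t - s) (-1) s := by
      simpa using (hasDerivAt_id s).const_sub t
    have h2 := (hZ (t - s)).scomp s h1
    have h3 := hasDerivAt_clm_apply h2 (hasDerivAt_expI_apply A f s)
    convert! h3 using 1
    simp only [Function.comp, neg_smul, one_smul, neg_apply, smul_apply,
      mul_apply_eq_comp, add_apply, sum_apply, ketbra_apply, map_add, map_sum, map_smul,
      smul_add]
    simp only [smul_comm (w _ _)]
    abel
  have hcA := continuous_expI_apply A f
  have hint : ∀ k, Continuous fun s : ℝ =>
      ⟪ζ k, expI A s f⟫_ℂ • w k (t - s) • Z (t - s) (ζ k) := fun k => by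
    have h1 := hw k
    have h2 : Continuous fun s : ℝ => Z (t - s) (ζ k) :=
      (hZc.comp (continuous_const.sub continuous_id)).clm_apply continuous_const
    exact (continuous_const.inner hcA).smul ((h1.comp (continuous_const.sub continuous_id)).smul h2)
  have hftc := intervalIntegral.integral_eq_sub_of_hasDerivAt (a := 0) (b := t)
    (fun s _ => hd s)
    (Continuous.intervalIntegrable (by
      exact ((continuous_finsetSum _ fun k _ => hint k).const_smul _).neg) _ _)
  rw [intervalIntegral.integral_neg, intervalIntegral.integral_smul,
    intervalIntegral.integral_finsetSum (fun k _ => (hint k).intervalIntegrable _ _)] at hftc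
  simp only [sub_self, hZ0, sub_zero, expI_zero, one_apply_eq_self] at hftc
  rw [eq_sub_iff_add_eq] at hftc
  rw [← hftc]
  abel

/-- Splitting e^{-itB} = e^{-isB} e^{-i(t-s)B} expresses the memory term through the rotated
quantity at the earlier time t - s. -/
theorem duhamel_rotated {A B : E →L[ℂ] E} {ζ : ι → E} {w : ι → ℝ → ℂ}
    (hw : ∀ k, Continuous (w k)) {Z : ℝ → E →L[ℂ] E} (hZ0 : Z 0 = 1)
    (hZ : ∀ t, HasDerivAt Z
      (Complex.I • (Z t * (A + ∑ k, w k t • ketbra (ζ k) (ζ k)))) t) (f : E) (t : ℝ) :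
    expI B (-t) (Z t f) = expI B (-t) (expI A t f) + Complex.I • ∑ k, ∫ s in (0 : ℝ)..t,
      ⟪ζ k, expI A s f⟫_ℂ • expI B (-s)
        (w k (t - s) • expI B (-(t - s)) (Z (t - s) (ζ k))) := by
  have hZc : Continuous Z := continuous_iff_continuousAt.2 fun t => (hZ t).continuousAt
  have hcA := continuous_expI_apply A f
  have hint : ∀ k, Continuous fun s : ℝ =>
      ⟪ζ k, expI A s f⟫_ℂ • w k (t - s) • Z (t - s) (ζ k) := fun k => by
    have h1 := hw k
    have h2 : Continuous fun s : ℝ => Z (t - s) (ζ k) :=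
      (hZc.comp (continuous_const.sub continuous_id)).clm_apply continuous_const
    exact (continuous_const.inner hcA).smul ((h1.comp (continuous_const.sub continuous_id)).smul h2)
  conv_lhs => rw [duhamel hw hZ0 hZ f t]
  rw [map_add, map_smul, map_sum]
  congr 2
  refine Finset.sum_congr rfl fun k _ => ?_
  rw [← ContinuousLinearMap.intervalIntegral_comp_comm _ ((hint k).intervalIntegrable _ _)]
  congr 1
  funext s
  have e : expI B (-t) = expI B (-s) * expI B (-(t - s)) := by
    rw [← expI_add]
    congr 1
    ring
  rw [e]
  simp only [mul_apply_eq_comp, map_smul]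

/-- Dominated convergence, with the integrand extended by zero beyond s = t and dominated by κ|c|.
-/
theorem tendsto_retarded_convolution {G : ℝ → E →L[ℂ] E} (hG : Continuous G)
    (hG1 : ∀ s x, ‖G s x‖ = ‖x‖) {c : ℝ → ℂ} (hc : Continuous c)
    (hci : IntegrableOn c (Set.Ioi 0)) {y : ℝ → E} (hy : Continuous y) {κ : ℝ}
    (hκ : ∀ t, 0 ≤ t → ‖y t‖ ≤ κ) {l : E} (hl : Tendsto y atTop (𝓝 l)) :
    Tendsto (fun t : ℝ => ∫ s in (0 : ℝ)..t, c s • G s (y (t - s))) atTop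
      (𝓝 (∫ s in Set.Ioi (0 : ℝ), c s • G s l)) := by
  have hcont : ∀ t : ℝ, Continuous fun s : ℝ => c s • G s (y (t - s)) := fun t =>
    hc.smul (hG.clm_apply (hy.comp (continuous_const.sub continuous_id)))
  have h : Tendsto (fun t : ℝ => ∫ s in Set.Ioi (0 : ℝ),
      (Set.Ioc 0 t).indicator (fun s => c s • G s (y (t - s))) s) atTop
      (𝓝 (∫ s in Set.Ioi (0 : ℝ), c s • G s l)) := by
    refine tendsto_integral_filter_of_dominated_convergence (fun s => ‖c s‖ * κ) ?_ ?_ ?_ ?_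
    · exact Eventually.of_forall fun t =>
        (hcont t).aestronglyMeasurable.indicator measurableSet_Ioc
    · refine Eventually.of_forall fun t => Eventually.of_forall fun s => ?_
      rw [Set.indicator_apply]
      split_ifs with hs
      · rw [norm_smul, hG1]
        exact mul_le_mul_of_nonneg_left (hκ _ (sub_nonneg.2 hs.2)) (norm_nonneg _)
      · rw [norm_zero]
        exact mul_nonneg (norm_nonneg _) ((norm_nonneg _).trans (hκ 0 le_rfl))
    · exact hci.norm.mul_const κ
    · refine (ae_restrict_iff' measurableSet_Ioi).2 (Eventually.of_forall fun s hs => ?_)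
      have h1 : Tendsto (fun t : ℝ => c s • G s (y (t - s))) atTop (𝓝 (c s • G s l)) :=
        (((G s).continuous.tendsto _).comp
          (hl.comp (tendsto_atTop_add_const_right _ (-s) tendsto_id))).const_smul _
      refine h1.congr' ?_
      filter_upwards [eventually_ge_atTop s] with t ht
      rw [Set.indicator_of_mem (show s ∈ Set.Ioc 0 t from ⟨hs, ht⟩)]
  refine h.congr' ?_
  filter_upwards [eventually_ge_atTop 0] with t ht
  rw [intervalIntegral.integral_of_le ht, setIntegral_indicator measurableSet_Ioc]
  congr 2
  exact Set.inter_eq_right.2 fun s hs => hs.1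

theorem norm_integral_retarded_le {G : ℝ → E →L[ℂ] E} (hG1 : ∀ s x, ‖G s x‖ = ‖x‖) {c : ℝ → ℂ}
    (hci : IntegrableOn c (Set.Ioi 0)) {z : ℝ → E} {κ a b : ℝ} (ha : 0 ≤ a) (hab : a ≤ b)
    (hκ0 : 0 ≤ κ) (hz : ∀ s ∈ Set.Ioc a b, ‖z s‖ ≤ κ) :
    ‖∫ s in a..b, c s • G s (z s)‖ ≤ κ * ∫ s in Set.Ioi a, ‖c s‖ := by
  have hci' : IntegrableOn (fun s => ‖c s‖) (Set.Ioi a) :=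
    (hci.mono_set (Set.Ioi_subset_Ioi ha)).norm
  rw [intervalIntegral.integral_of_le hab, ← integral_const_mul]
  calc ‖∫ s in Set.Ioc a b, c s • G s (z s)‖ ≤ ∫ s in Set.Ioc a b, κ * ‖c s‖ := by
        refine norm_integral_le_of_norm_le ((hci'.mono_set Set.Ioc_subset_Ioi_self).const_mul κ) ?_
        refine (ae_restrict_iff' measurableSet_Ioc).2 (Eventually.of_forall fun s hs => ?_)
        rw [norm_smul, hG1, mul_comm]
        exact mul_le_mul_of_nonneg_right (hz s hs) (norm_nonneg _)
    _ ≤ ∫ s in Set.Ioi a, κ * ‖c s‖ := by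
        refine setIntegral_mono_set (hci'.const_mul κ) ?_ Set.Ioc_subset_Ioi_self.eventuallyLE
        exact Eventually.of_forall fun s => mul_nonneg hκ0 (norm_nonneg _)

theorem tendsto_integral_norm_Ioi {c : ℝ → ℂ} (hci : IntegrableOn c (Set.Ioi 0)) :
    Tendsto (fun S : ℝ => ∫ s in Set.Ioi S, ‖c s‖) atTop (𝓝 0) := by
  have h1 := intervalIntegral_tendsto_integral_Ioi 0 hci.norm tendsto_id
  have h2 : Tendsto (fun S : ℝ => (∫ s in Set.Ioi (0 : ℝ), ‖c s‖) - ∫ s in (0 : ℝ)..S, ‖c s‖) atTop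
      (𝓝 0) := by
    simpa using h1.const_sub (∫ s in Set.Ioi (0 : ℝ), ‖c s‖)
  refine h2.congr' ?_
  filter_upwards [eventually_ge_atTop 0] with S hS
  rw [intervalIntegral.integral_of_le hS, ← Set.Ioc_union_Ioi_eq_Ioi hS, setIntegral_union
    (Set.Ioc_disjoint_Ioi le_rfl) measurableSet_Ioi
    (hci.mono_set Set.Ioc_subset_Ioi_self).norm (hci.mono_set (Set.Ioi_subset_Ioi hS)).norm]
  ring

/-- Late-time oscillations of a retarded convolution are controlled by those of its source. -/
theorem eventually_oscillation_le {G : ℝ → E →L[ℂ] E} (hG : Continuous G)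
    (hG1 : ∀ s x, ‖G s x‖ = ‖x‖) {c : ℝ → ℂ} (hc : Continuous c)
    (hci : IntegrableOn c (Set.Ioi 0)) {y : ℝ → E} (hy : Continuous y) {κ : ℝ}
    (hκ : ∀ t, 0 ≤ t → ‖y t‖ ≤ κ) {ε : ℝ} (hε : 0 < ε) :
    ∀ᶠ S : ℝ in atTop, ∀ T η : ℝ, 0 ≤ T → 0 ≤ η → (∀ t ≥ T, ∀ t' ≥ T, ‖y t - y t'‖ ≤ η) →
      ∀ t ≥ T + S, ∀ t' ≥ T + S, ‖(∫ s in (0 : ℝ)..t, c s • G s (y (t - s))) -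
        ∫ s in (0 : ℝ)..t', c s • G s (y (t' - s))‖ ≤
          η * (∫ s in Set.Ioi (0 : ℝ), ‖c s‖) + ε := by
  have hκ0 : 0 ≤ κ := (norm_nonneg _).trans (hκ 0 le_rfl)
  -- The factor 2 accounts for one tail beyond S at time t and another at time t'.
  have htail : Tendsto (fun S : ℝ => 2 * (κ * ∫ s in Set.Ioi S, ‖c s‖)) atTop (𝓝 0) := by
    simpa using ((tendsto_integral_norm_Ioi hci).const_mul κ).const_mul 2
  filter_upwards [htail.eventually (ge_mem_nhds hε), eventually_ge_atTop 0] with S hS hS0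
  intro T η hT hη hosc t ht t' ht'
  have hcont : ∀ t : ℝ, Continuous fun s : ℝ => c s • G s (y (t - s)) := fun t =>
    hc.smul (hG.clm_apply (hy.comp (continuous_const.sub continuous_id)))
  -- For s ≤ S the retarded times t - s and t' - s are still at least T, so the source oscillates
  -- there by at most η; beyond S the kernel is small.
  have hsplit : ∀ t : ℝ, (∫ s in (0 : ℝ)..t, c s • G s (y (t - s))) =
      (∫ s in (0 : ℝ)..S, c s • G s (y (t - s))) + ∫ s in S..t, c s • G s (y (t - s)) := fun t =>
    (intervalIntegral.integral_add_adjacent_intervals ((hcont t).intervalIntegrable _ _)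
      ((hcont t).intervalIntegrable _ _)).symm
  have htl : ∀ t ≥ T + S, ‖∫ s in S..t, c s • G s (y (t - s))‖ ≤ κ * ∫ s in Set.Ioi S, ‖c s‖ :=
    fun t ht => norm_integral_retarded_le hG1 hci hS0 (by linarith) hκ0 fun s hs =>
      hκ _ (sub_nonneg.2 hs.2)
  have hmain : ‖(∫ s in (0 : ℝ)..S, c s • G s (y (t - s))) -
      ∫ s in (0 : ℝ)..S, c s • G s (y (t' - s))‖ ≤ η * ∫ s in Set.Ioi (0 : ℝ), ‖c s‖ := by
    rw [← intervalIntegral.integral_sub ((hcont t).intervalIntegrable _ _)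
      ((hcont t').intervalIntegrable _ _)]
    simp_rw [← smul_sub, ← map_sub]
    refine norm_integral_retarded_le (z := fun s => y (t - s) - y (t' - s)) hG1 hci le_rfl hS0 hη
      fun s hs => hosc _ ?_ _ ?_ <;> linarith [hs.2]
  rw [hsplit t, hsplit t', add_sub_add_comm]
  refine (norm_add_le _ _).trans (add_le_add hmain ((norm_sub_le _ _).trans ?_))
  linarith [htl t ht, htl t' ht']

/-- A family which solves a retarded integral equation with a small source converges. -/
theorem exists_tendsto_of_retarded_equation {G : ℝ → E →L[ℂ] E} (hG : Continuous G)
    (hG1 : ∀ s x, ‖G s x‖ = ‖x‖) {c : ι → ι → ℝ → ℂ} (hc : ∀ k j, Continuous (c k j))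
    (hci : ∀ k j, IntegrableOn (c k j) (Set.Ioi 0)) {m : ℝ}
    (hm : ∀ k j, ∫ s in Set.Ioi (0 : ℝ), ‖c k j s‖ ≤ m) {b b0 y : ι → ℝ → E}
    (hy : ∀ k, Continuous (y k)) {κ : ι → ℝ} (hκ : ∀ k t, 0 ≤ t → ‖y k t‖ ≤ κ k)
    (hb0 : ∀ j, ∃ l, Tendsto (b0 j) atTop (𝓝 l)) (hb1 : ∀ j t, 0 ≤ t → ‖b j t‖ ≤ 1)
    (hb : ∀ j t, b j t = b0 j t + Complex.I • ∑ k, ∫ s in (0 : ℝ)..t,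
      c k j s • G s (y k (t - s)))
    (hosc : ∀ k, ∀ δ t t' : ℝ, 0 ≤ t → 0 ≤ t' → (∀ l, ‖b l t - b l t'‖ ≤ δ) →
      ‖y k t - y k t'‖ ≤ 3 * κ k * δ)
    (hsmall : 12 * ((∑ k, κ k) * m) ≤ 1) (j : ι) : ∃ l, Tendsto (b j) atTop (𝓝 l) := by
  have hκ0 : ∀ k, 0 ≤ κ k := fun k => (norm_nonneg _).trans (hκ k 0 le_rfl)
  -- One pass halves the oscillation: δ/8 from the convergent term `b0`, at most 3(∑κ)m·δ ≤ δ/4 from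
  -- the source, and δ/8 from the kernel tails.
  have step : ∀ δ > 0, (∃ T ≥ 0, ∀ t ≥ T, ∀ t' ≥ T, ∀ j, ‖b j t - b j t'‖ ≤ δ) →
      ∃ T ≥ 0, ∀ t ≥ T, ∀ t' ≥ T, ∀ j, ‖b j t - b j t'‖ ≤ δ / 2 := by
    rintro δ hδ ⟨T, hT0, hT⟩
    -- Chosen so that the tail errors, summed over all k, stay below δ/8.
    set ε := δ / (8 * (Fintype.card ι + 1))
    have hε : 0 < ε := by positivity
    have hS := eventually_all.2 fun k => eventually_all.2 fun j =>
      eventually_oscillation_le hG hG1 (hc k j) (hci k j) (hy k) (hκ k) hε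
    have hb0' : ∀ᶠ T0 : ℝ in atTop, ∀ j, ∀ t ≥ T0, ∀ t' ≥ T0, ‖b0 j t - b0 j t'‖ ≤ δ / 8 := by
      refine eventually_all.2 fun j => ?_
      obtain ⟨l, hl⟩ := hb0 j
      obtain ⟨T0, hT0⟩ := Metric.cauchySeq_iff.1 hl.cauchySeq (δ / 8) (by positivity)
      filter_upwards [eventually_ge_atTop T0] with T1 hT1 t ht t' ht'
      rw [← dist_eq_norm]
      exact (hT0 t (hT1.trans ht) t' (hT1.trans ht')).le
    obtain ⟨S, hS, hS0, hSb⟩ := (hS.and ((eventually_ge_atTop 0).and hb0')).exists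
    refine ⟨T + S, by linarith, fun t ht t' ht' j => ?_⟩
    rw [hb j t, hb j t', add_sub_add_comm, ← smul_sub, ← Finset.sum_sub_distrib]
    have hk : ∀ k, ‖(∫ s in (0 : ℝ)..t, c k j s • G s (y k (t - s))) -
        ∫ s in (0 : ℝ)..t', c k j s • G s (y k (t' - s))‖ ≤ 3 * κ k * δ * m + ε := by
      intro k
      have h0 : 0 ≤ 3 * κ k * δ := mul_nonneg (mul_nonneg (by norm_num) (hκ0 k)) hδ.le
      refine (hS k j T (3 * κ k * δ) hT0 h0 (fun t ht t' ht' =>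
        hosc k δ t t' (hT0.trans ht) (hT0.trans ht') (hT t ht t' ht')) t ht t' ht').trans ?_
      gcongr
      exact hm k j
    have hsum : ‖∑ k, ((∫ s in (0 : ℝ)..t, c k j s • G s (y k (t - s))) -
        ∫ s in (0 : ℝ)..t', c k j s • G s (y k (t' - s)))‖ ≤ δ / 4 + δ / 8 := by
      refine (norm_sum_le_of_le _ fun k _ => hk k).trans ?_
      rw [Finset.sum_add_distrib, Finset.sum_const, Finset.card_univ, nsmul_eq_mul,
        ← Finset.sum_mul, ← Finset.sum_mul, ← Finset.mul_sum]
      refine add_le_add (by nlinarith) ?_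
      simp only [ε]
      rw [mul_div_assoc', div_le_div_iff₀ (by positivity) (by norm_num)]
      nlinarith
    calc _ ≤ δ / 8 + (δ / 4 + δ / 8) := by
          refine (norm_add_le _ _).trans (add_le_add (hSb j t (by linarith) t' (by linarith)) ?_)
          rwa [norm_smul, Complex.norm_I, one_mul]
      _ = δ / 2 := by ring
  have hall : ∀ n : ℕ, ∃ T ≥ 0, ∀ t ≥ T, ∀ t' ≥ T, ∀ j, ‖b j t - b j t'‖ ≤ 2 * (1 / 2) ^ n := by
    intro n
    induction n with
    | zero =>
      refine ⟨0, le_rfl, fun t ht t' ht' j => (norm_sub_le _ _).trans ?_⟩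
      linarith [hb1 j t ht, hb1 j t' ht']
    | succ n ih =>
      have := step _ (by positivity) ih
      rwa [pow_succ, ← mul_assoc, mul_one_div]
  refine cauchySeq_tendsto_of_complete (Metric.cauchySeq_iff.2 fun ε hε => ?_)
  obtain ⟨n, hn⟩ := exists_pow_lt_of_lt_one (half_pos hε) (one_half_lt_one (α := ℝ))
  obtain ⟨T, _, hT⟩ := hall n
  refine ⟨T, fun t ht t' ht' => ?_⟩
  rw [dist_eq_norm]
  exact (hT t ht t' ht' j).trans_lt (by linarith)

end Duhamel

/-! ### Global solutions of the nonlinear Liouville equation -/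

section GlobalODE

variable {X : Type*} [NormedAddCommGroup X] [NormedSpace ℝ X]

/-- A field bounded by L cannot leave the ball of radius L(n+1) on [-(n+1), n+1], so Picard–Lindelöf
applies on every such interval. The solutions agree by uniqueness and are glued. -/
theorem exists_global_solution [CompleteSpace X] {F : X → X} {K L : NNReal} (hF : LipschitzWith K F)
    (hL : ∀ x, ‖F x‖ ≤ L) (x0 : X) :
    ∃ α : ℝ → X, α 0 = x0 ∧ ∀ t, HasDerivAt α (F (α t)) t := by
  have hloc : ∀ n : ℕ, ∃ α : ℝ → X, α 0 = x0 ∧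
      ∀ t ∈ Set.Ioo (-(n + 1 : ℝ)) (n + 1), HasDerivAt α (F (α t)) t := by
    intro n
    have hn : (0 : ℝ) ≤ n + 1 := by positivity
    have hPL : IsPicardLindelof (fun _ => F) (tmin := -(n + 1 : ℝ)) (tmax := n + 1)
        ⟨0, by constructor <;> linarith⟩ x0 (L * (n + 1)) 0 L K := by
      refine IsPicardLindelof.of_time_independent (fun x _ => hL x) hF.lipschitzOnWith ?_
      simp
    obtain ⟨α, h0, hα⟩ := hPL.exists_eq_forall_mem_Icc_hasDerivWithinAt₀
    exact ⟨α, h0, fun t ht => (hα t (Set.Ioo_subset_Icc_self ht)).hasDerivAt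
      (Icc_mem_nhds ht.1 ht.2)⟩
  choose a ha0 ha using hloc
  have hmono : ∀ m n : ℕ, m ≤ n → Set.EqOn (a m) (a n) (Set.Ioo (-(m + 1 : ℝ)) (m + 1)) := by
    intro m n hmn
    have hmn' : (m : ℝ) ≤ n := by exact_mod_cast hmn
    have hm : (0 : ℝ) < m + 1 := by positivity
    refine ODE_solution_unique_of_mem_Ioo (v := fun _ => F) (s := fun _ => Set.univ) (t₀ := 0)
      (fun _ _ => hF.lipschitzOnWith) ⟨by linarith, hm⟩ (fun t ht => ⟨ha m t ht, trivial⟩)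
      (fun t ht => ⟨ha n t ⟨by linarith [ht.1], by linarith [ht.2]⟩, trivial⟩) ?_
    rw [ha0, ha0]
  have hmem : ∀ t : ℝ, t ∈ Set.Ioo (-((⌊|t|⌋₊ : ℝ) + 1)) (⌊|t|⌋₊ + 1) := fun t =>
    abs_lt.1 (Nat.lt_floor_add_one |t|)
  refine ⟨fun t => a ⌊|t|⌋₊ t, ha0 _, fun t => ?_⟩
  -- One more than the floor, so that a single solution represents the glued curve on a whole
  -- neighbourhood of t even where the floor jumps.
  set n := ⌊|t|⌋₊ + 1
  have hnt : ∀ s : ℝ, |s| < n + 1 → a ⌊|s|⌋₊ s = a n s := fun s hs => by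
    refine hmono _ _ ?_ (hmem s)
    have : ⌊|s|⌋₊ < n + 1 := (Nat.floor_lt (abs_nonneg _)).2 (by exact_mod_cast hs)
    omega
  have ht : |t| < n + 1 := by
    have := Nat.lt_floor_add_one |t|
    simp only [n]
    push_cast
    linarith
  have hev : (fun s => a ⌊|s|⌋₊ s) =ᶠ[𝓝 t] a n := by
    filter_upwards [(continuous_abs.tendsto t).eventually (gt_mem_nhds ht)] with s hs
    exact hnt s hs
  change HasDerivAt (fun s => a ⌊|s|⌋₊ s) (F (a ⌊|t|⌋₊ t)) t
  rw [hnt t ht]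
  exact (ha n t (abs_lt.1 ht)).congr_of_eventuallyEq hev

/-- The radial retraction onto the closed unit ball. -/
noncomputable def radialRetraction (x : X) : X := (max 1 ‖x‖)⁻¹ • x

theorem norm_radialRetraction_le (x : X) : ‖radialRetraction x‖ ≤ 1 := by
  have h : 0 < max 1 ‖x‖ := lt_max_of_lt_left one_pos
  rw [radialRetraction, norm_smul, norm_inv, Real.norm_of_nonneg h.le, inv_mul_le_iff₀ h, mul_one]
  exact le_max_right _ _

theorem norm_radialRetraction_sub_le (x y : X) :
    ‖radialRetraction x - radialRetraction y‖ ≤ 2 * ‖x - y‖ := by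
  have ha : 0 < max 1 ‖x‖ := lt_max_of_lt_left one_pos
  have hb : 0 < max 1 ‖y‖ := lt_max_of_lt_left one_pos
  have e : radialRetraction x - radialRetraction y =
      (max 1 ‖x‖)⁻¹ • ((x - y) + (max 1 ‖y‖ - max 1 ‖x‖) • radialRetraction y) := by
    have h1 : (max 1 ‖y‖) • radialRetraction y = y := by
      rw [radialRetraction, smul_smul, mul_inv_cancel₀ hb.ne', one_smul]
    rw [sub_smul, h1, sub_add_sub_cancel, smul_sub, smul_smul, inv_mul_cancel₀ ha.ne', one_smul]
    rfl
  have h2 : |max 1 ‖y‖ - max 1 ‖x‖| ≤ ‖x - y‖ := by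
    refine (abs_max_sub_max_le_max _ _ _ _).trans ?_
    rw [sub_self, abs_zero, max_eq_right (abs_nonneg _), abs_sub_comm]
    exact abs_norm_sub_norm_le _ _
  have hinv : (max 1 ‖x‖)⁻¹ ≤ 1 := inv_le_one_of_one_le₀ (le_max_left _ _)
  rw [e, norm_smul, norm_inv, Real.norm_of_nonneg ha.le]
  calc _ ≤ 1 * (‖x - y‖ + ‖x - y‖ * 1) := by
        refine mul_le_mul hinv ((norm_add_le _ _).trans (add_le_add le_rfl ?_)) (norm_nonneg _)
          zero_le_one
        rw [norm_smul, Real.norm_eq_abs]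
        exact mul_le_mul h2 (norm_radialRetraction_le y) (norm_nonneg _) (norm_nonneg _)
    _ = 2 * ‖x - y‖ := by ring

theorem radialRetraction_of_norm_le {x : X} (h : ‖x‖ ≤ 1) : radialRetraction x = x := by
  simp [radialRetraction, max_eq_left h]

end GlobalODE

/-! ### The unitary propagator and uniqueness for the Liouville equation. -/

section Liouville

variable {E : Type*} [NormedAddCommGroup E] [InnerProductSpace ℂ E] [CompleteSpace E]
  {H ρ0 : E →L[ℂ] E} {V : (E →L[ℂ] E) → (E →L[ℂ] E)} {C : ℝ}

theorem norm_I_smul (a : E →L[ℂ] E) : ‖Complex.I • a‖ = ‖a‖ := by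
  rw [norm_smul, Complex.norm_I, one_mul]

theorem I_smul_I_smul (a : E →L[ℂ] E) : Complex.I • Complex.I • a = -a := by
  rw [smul_smul, Complex.I_mul_I, neg_one_smul]

theorem hasDerivAt_star {U : ℝ → E →L[ℂ] E} {U' : E →L[ℂ] E} {t : ℝ} (h : HasDerivAt U U' t) :
    HasDerivAt (fun s => star (U s)) (star U') t :=
  h.star

theorem hasDerivAt_mul {A B : ℝ → E →L[ℂ] E} {A' B' : E →L[ℂ] E} {t : ℝ} (hA : HasDerivAt A A' t)
    (hB : HasDerivAt B B' t) : HasDerivAt (fun s => A s * B s) (A' * B t + A t * B') t :=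
  hA.mul hB

/-- The field is cubic in U, hence not globally Lipschitz; composing it with the radial retraction
makes it bounded and Lipschitz. The truncated generator is still self-adjoint, so U*U is constant
and ‖U‖ ≤ 1. The truncation is therefore never active. -/
theorem exists_propagator (hH : IsSelfAdjoint H) (hρ0 : IsSelfAdjoint ρ0) (hC : 0 ≤ C)
    (hVsub : ∀ a b, V (a - b) = V a - V b) (hVle : ∀ a, ‖V a‖ ≤ C * ‖a‖)
    (hVsa : ∀ a, IsSelfAdjoint a → IsSelfAdjoint (V a)) :
    ∃ U : ℝ → E →L[ℂ] E, U 0 = 1 ∧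
      (∀ t, HasDerivAt U (-(Complex.I • ((H + V (U t * ρ0 * star (U t))) * U t))) t) ∧
      ∀ t, ‖U t‖ ≤ 1 := by
  set F0 : (E →L[ℂ] E) → (E →L[ℂ] E) := fun X =>
    -(Complex.I • ((H + V (X * ρ0 * star X)) * X))
  have hconj : ∀ A B : E →L[ℂ] E, ‖A‖ ≤ 1 → ‖A * ρ0 * star B‖ ≤ ‖ρ0‖ * ‖B‖ := fun A B hA => by
    rw [← norm_star B]
    refine (norm_mul_le _ _).trans (mul_le_mul_of_nonneg_right ((norm_mul_le _ _).trans ?_)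
      (norm_nonneg _))
    exact mul_le_of_le_one_left (norm_nonneg _) hA
  have hconj' : ∀ A B : E →L[ℂ] E, ‖B‖ ≤ 1 → ‖A * ρ0 * star B‖ ≤ ‖ρ0‖ * ‖A‖ := fun A B hB => by
    rw [← norm_star B] at hB
    refine (norm_mul_le _ _).trans ((mul_le_of_le_one_right (norm_nonneg _) hB).trans ?_)
    rw [mul_comm]
    exact norm_mul_le _ _
  have hK : ∀ X : E →L[ℂ] E, ‖X‖ ≤ 1 → ‖H + V (X * ρ0 * star X)‖ ≤ ‖H‖ + C * ‖ρ0‖ := fun X hX => by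
    refine (norm_add_le _ _).trans (add_le_add le_rfl ((hVle _).trans ?_))
    exact mul_le_mul_of_nonneg_left ((hconj X X hX).trans
      (mul_le_of_le_one_right (norm_nonneg _) hX)) hC
  have hF0b : ∀ X : E →L[ℂ] E, ‖X‖ ≤ 1 → ‖F0 X‖ ≤ ‖H‖ + C * ‖ρ0‖ := fun X hX => by
    rw [norm_neg, norm_I_smul]
    exact (norm_mul_le _ _).trans ((mul_le_of_le_one_right (norm_nonneg _) hX).trans (hK X hX))
  have hF0l : ∀ X Y : E →L[ℂ] E, ‖X‖ ≤ 1 → ‖Y‖ ≤ 1 →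
      ‖F0 X - F0 Y‖ ≤ (‖H‖ + 3 * (C * ‖ρ0‖)) * ‖X - Y‖ := fun X Y hX hY => by
    have e : F0 X - F0 Y = -(Complex.I • ((H + V (X * ρ0 * star X)) * (X - Y) +
        V ((X - Y) * ρ0 * star X - Y * ρ0 * (star (Y - X))) * Y)) := by
      have e1 : (X - Y) * ρ0 * star X - Y * ρ0 * (star (Y - X)) =
          X * ρ0 * star X - Y * ρ0 * star Y := by
        rw [star_sub]
        noncomm_ring
      rw [e1, hVsub]
      simp only [F0]
      rw [← neg_sub, ← sub_eq_zero]
      simp only [← smul_neg, ← smul_sub]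
      rw [smul_eq_zero]
      right
      noncomm_ring
    rw [e, norm_neg, norm_I_smul]
    have h1 : ‖(X - Y) * ρ0 * star X - Y * ρ0 * (star (Y - X))‖ ≤ 2 * (‖ρ0‖ * ‖X - Y‖) := by
      refine (norm_sub_le _ _).trans ?_
      have h2 := hconj' (X - Y) X hX
      have h3 := hconj Y (Y - X) hY
      rw [norm_sub_rev] at h3
      linarith
    calc _ ≤ (‖H‖ + C * ‖ρ0‖) * ‖X - Y‖ + C * (2 * (‖ρ0‖ * ‖X - Y‖)) := by
          refine (norm_add_le _ _).trans (add_le_add ((norm_mul_le _ _).trans ?_)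
            ((norm_mul_le _ _).trans ((mul_le_of_le_one_right (norm_nonneg _) hY).trans
              ((hVle _).trans ?_))))
          · exact mul_le_mul_of_nonneg_right (hK X hX) (norm_nonneg _)
          · exact mul_le_mul_of_nonneg_left h1 hC
      _ = _ := by ring
  have hK0 : 0 ≤ ‖H‖ + 3 * (C * ‖ρ0‖) := by positivity
  have hFl : LipschitzWith (Real.toNNReal ((‖H‖ + 3 * (C * ‖ρ0‖)) * 2))
      (fun X => F0 (radialRetraction X)) := by
    refine LipschitzWith.of_dist_le_mul fun X Y => ?_
    rw [dist_eq_norm, dist_eq_norm, Real.coe_toNNReal _ (by positivity), mul_assoc]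
    exact (hF0l _ _ (norm_radialRetraction_le X) (norm_radialRetraction_le Y)).trans
      (mul_le_mul_of_nonneg_left (norm_radialRetraction_sub_le X Y) hK0)
  obtain ⟨U, hU0, hU⟩ := exists_global_solution hFl (L := Real.toNNReal (‖H‖ + C * ‖ρ0‖))
    (fun X => by
      rw [Real.coe_toNNReal _ (by positivity)]
      exact hF0b _ (norm_radialRetraction_le X)) 1
  have hd : ∀ t, HasDerivAt (fun s => star (U s) * U s) 0 t := fun t => by
    convert! hasDerivAt_mul (hasDerivAt_star (hU t)) (hU t) using 1
    -- The retraction only multiplies U by a real scalar, which commutes with everything and cancels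
    -- in the derivative of U*U.
    set c : ℝ := (max 1 ‖U t‖)⁻¹
    have hc : radialRetraction (U t) = c • U t := rfl
    set K := H + V (radialRetraction (U t) * ρ0 * star (radialRetraction (U t)))
    have hKsa : star K = K := by
      refine IsSelfAdjoint.add (R := E →L[ℂ] E) hH (hVsa _ ?_)
      exact hρ0.conjugate _
    have e : F0 (radialRetraction (U t)) = -(Complex.I • (K * (c • U t))) := by
      rw [← hc]
    rw [e]
    simp only [star_neg, star_smul, star_mul, hKsa, mul_smul_comm, smul_mul_assoc, mul_neg,
      mul_assoc, Complex.star_def, Complex.conj_I, neg_smul, star_trivial, neg_neg]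
    abel
  have hUU : ∀ t, star (U t) * U t = 1 := fun t => by
    have h0 := is_const_of_deriv_eq_zero (fun s => (hd s).differentiableAt)
      (fun s => (hd s).deriv) t 0
    simpa [hU0] using h0
  have hUn : ∀ t, ‖U t‖ ≤ 1 := fun t => by
    have h1 := CStarRing.norm_star_mul_self (x := U t)
    rw [hUU t] at h1
    have h2 : ‖(1 : E →L[ℂ] E)‖ ≤ 1 := ContinuousLinearMap.norm_id_le
    nlinarith [norm_nonneg (U t)]
  refine ⟨U, hU0, fun t => ?_, hUn⟩
  have := hU t
  rwa [radialRetraction_of_norm_le (hUn t)] at this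

theorem hasDerivAt_conj_propagator {U : ℝ → E →L[ℂ] E} {t : ℝ}
    {K : E →L[ℂ] E} (hK : IsSelfAdjoint K) (hU : HasDerivAt U (-(Complex.I • (K * U t))) t) :
    HasDerivAt (fun s => U s * ρ0 * star (U s))
      (-(Complex.I • (K * (U t * ρ0 * star (U t)) - U t * ρ0 * star (U t) * K))) t := by
  convert! hasDerivAt_mul (hasDerivAt_mul hU (hasDerivAt_const t ρ0)) (hasDerivAt_star hU) using 1
  simp only [star_neg, star_smul, star_mul, hK.star_eq, mul_smul_comm, smul_mul_assoc, neg_mul,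
    mul_assoc, Complex.star_def, Complex.conj_I, neg_smul, neg_neg, mul_zero, add_zero,
    smul_sub]
  abel

/-- The adjoint propagator has its generator on the right, the form required by Duhamel's formula
above. -/
theorem hasDerivAt_star_propagator {U : ℝ → E →L[ℂ] E} {t : ℝ} {K : E →L[ℂ] E}
    (hK : IsSelfAdjoint K) (hU : HasDerivAt U (-(Complex.I • (K * U t))) t) :
    HasDerivAt (fun s => star (U s)) (Complex.I • (star (U t) * K)) t := by
  convert! hasDerivAt_star hU using 1
  simp only [star_neg, star_smul, star_mul, hK.star_eq, Complex.star_def, Complex.conj_I, neg_smul,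
    neg_neg]

theorem inner_conj_apply (U R : E →L[ℂ] E) (f g : E) :
    ⟪g, (U * R * star U) f⟫_ℂ = ⟪star U g, R (star U f)⟫_ℂ := by
  rw [ContinuousLinearMap.star_eq_adjoint, ContinuousLinearMap.adjoint_inner_left]
  rfl

/-- The equation is imposed only for t > 0. Continuity at 0 supplies the right derivative there, as
the uniqueness theorem for differential equations requires. -/
theorem hasDerivWithinAt_zero_of_pos {X : Type*} [NormedAddCommGroup X] [NormedSpace ℝ X]
    {ρ : ℝ → X} {v : X → X} (hv : Continuous v) (hc : ContinuousOn ρ (Set.Ici 0))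
    (hd : ∀ t, 0 < t → HasDerivAt ρ (v (ρ t)) t) : HasDerivWithinAt ρ (v (ρ 0)) (Set.Ici 0) 0 := by
  refine hasDerivWithinAt_Ici_of_tendsto_deriv (s := Set.Ioi 0)
    (fun t ht => (hd t ht).differentiableAt.differentiableWithinAt)
    ((hc 0 Set.self_mem_Ici).mono Set.Ioi_subset_Ici_self) self_mem_nhdsWithin ?_
  have h1 : Tendsto ρ (𝓝[>] 0) (𝓝 (ρ 0)) :=
    (hc 0 Set.self_mem_Ici).mono Set.Ioi_subset_Ici_self
  refine ((hv.tendsto _).comp h1).congr' ?_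
  filter_upwards [self_mem_nhdsWithin] with t ht
  exact (hd t ht).deriv.symm

/-- The field is quadratic, so Lipschitz only on balls; on a compact time interval both solutions
stay in one ball. -/
theorem liouville_unique (hC : 0 ≤ C) (hVsub : ∀ a b, V (a - b) = V a - V b)
    (hVle : ∀ a, ‖V a‖ ≤ C * ‖a‖) {ρ σ : ℝ → E →L[ℂ] E} (h0 : ρ 0 = σ 0)
    (hρc : ContinuousOn ρ (Set.Ici 0)) (hσc : ContinuousOn σ (Set.Ici 0))
    (hρ : ∀ t, 0 < t → HasDerivAt ρ
      (-(Complex.I • ((H + V (ρ t)) * ρ t - ρ t * (H + V (ρ t))))) t)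
    (hσ : ∀ t, 0 < t → HasDerivAt σ
      (-(Complex.I • ((H + V (σ t)) * σ t - σ t * (H + V (σ t))))) t)
    {t : ℝ} (ht : 0 ≤ t) : ρ t = σ t := by
  set v : (E →L[ℂ] E) → (E →L[ℂ] E) := fun a => -(Complex.I • ((H + V a) * a - a * (H + V a)))
  have hVc : Continuous V := by
    refine (LipschitzWith.of_dist_le_mul (K := Real.toNNReal C) fun a b => ?_).continuous
    rw [dist_eq_norm, dist_eq_norm, Real.coe_toNNReal _ hC, ← hVsub]
    exact hVle _
  have hvc : Continuous v := by fun_prop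
  have hcomm : ∀ a b : E →L[ℂ] E, ‖a * b - b * a‖ ≤ 2 * (‖a‖ * ‖b‖) := fun a b => by
    refine (norm_sub_le _ _).trans ?_
    have h1 := norm_mul_le a b
    have h2 := norm_mul_le b a
    linarith
  have hrt : ∀ {τ : ℝ → E →L[ℂ] E}, ContinuousOn τ (Set.Ici 0) →
      (∀ t, 0 < t → HasDerivAt τ (v (τ t)) t) →
      ∀ s, 0 ≤ s → HasDerivWithinAt τ (v (τ s)) (Set.Ici s) s := fun hτc hτ s hs => by
    rcases hs.eq_or_lt with rfl | hs
    · exact hasDerivWithinAt_zero_of_pos hvc hτc hτ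
    · exact (hτ s hs).hasDerivWithinAt
  have hIcc : Set.Icc 0 t ⊆ Set.Ici 0 := fun s hs => hs.1
  obtain ⟨R1, hR1⟩ := isCompact_Icc.exists_bound_of_continuousOn (hρc.mono hIcc)
  obtain ⟨R2, hR2⟩ := isCompact_Icc.exists_bound_of_continuousOn (hσc.mono hIcc)
  set R := max R1 R2
  have hR0 : 0 ≤ R := (norm_nonneg _).trans ((hR1 0 ⟨le_rfl, ht⟩).trans (le_max_left _ _))
  have hlip : LipschitzOnWith (Real.toNNReal (2 * (‖H‖ + C * R) + 2 * (C * R))) v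
      (Metric.closedBall 0 R) := by
    refine LipschitzOnWith.of_dist_le_mul fun a ha b hb => ?_
    rw [mem_closedBall_zero_iff] at ha hb
    rw [dist_eq_norm, dist_eq_norm, Real.coe_toNNReal _ (by positivity)]
    have e : v a - v b = -(Complex.I • (((H + V a) * (a - b) - (a - b) * (H + V a)) +
        (V (a - b) * b - b * V (a - b)))) := by
      rw [hVsub]
      simp only [v]
      rw [← sub_eq_zero]
      simp only [← smul_neg, ← smul_sub]
      rw [smul_eq_zero]
      right
      noncomm_ring
    rw [e, norm_neg, norm_I_smul]
    have h1 : ‖H + V a‖ ≤ ‖H‖ + C * R := (norm_add_le _ _).trans (add_le_add le_rfl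
      ((hVle a).trans (mul_le_mul_of_nonneg_left ha hC)))
    calc _ ≤ 2 * ((‖H‖ + C * R) * ‖a - b‖) + 2 * ((C * ‖a - b‖) * R) := by
          refine (norm_add_le _ _).trans (add_le_add ((hcomm _ _).trans ?_) ((hcomm _ _).trans ?_))
          · gcongr
          · gcongr
            exact hVle _
      _ = _ := by ring
  refine ODE_solution_unique_of_mem_Icc_right (v := fun _ => v)
    (s := fun _ => Metric.closedBall 0 R) (fun _ _ => hlip) (hρc.mono hIcc)
    (fun s hs => hrt hρc hρ s hs.1) (fun s hs => ?_) (hσc.mono hIcc)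
    (fun s hs => hrt hσc hσ s hs.1) (fun s hs => ?_) h0 ⟨ht, le_rfl⟩
  · exact mem_closedBall_zero_iff.2 ((hR1 s ⟨hs.1, hs.2.le⟩).trans (le_max_left _ _))
  · exact mem_closedBall_zero_iff.2 ((hR2 s ⟨hs.1, hs.2.le⟩).trans (le_max_right _ _))

end Liouville

/-! ### Wave operators and the absolutely continuous subspace -/

section WaveOperators

variable {E : Type*} [NormedAddCommGroup E] [InnerProductSpace ℂ E] [CompleteSpace E]
  {A B W : E →L[ℂ] E}

theorem IsWaveOp.tendsto (h : IsWaveOp B A W) (hA : IsPurelyAC A) (x : E) :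
    Tendsto (fun t : ℝ => expI B (-t) (expI A t x)) atTop (𝓝 (W x)) := by
  simpa only [acProj_of_isPurelyAC hA] using h x

theorem IsWaveOp.inner_map_map (h : IsWaveOp B A W) (hA : IsSelfAdjoint A) (hB : IsSelfAdjoint B)
    (hac : IsPurelyAC A) (x y : E) : ⟪W x, W y⟫_ℂ = ⟪x, y⟫_ℂ := by
  refine tendsto_nhds_unique ((h.tendsto hac x).inner (h.tendsto hac y)) ?_
  simp_rw [inner_expI_expI hB, inner_expI_expI hA]
  exact tendsto_const_nhds

/-- A shift of time by s does not change the limit t → ∞. -/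
theorem IsWaveOp.intertwine_expI (h : IsWaveOp B A W) (hac : IsPurelyAC A) (s : ℝ) (x : E) :
    expI B s (W x) = W (expI A s x) := by
  have h1 := ((expI B s).continuous.tendsto _).comp (h.tendsto hac x)
  have h2 := (h.tendsto hac (expI A s x)).comp (tendsto_atTop_add_const_right _ (-s) tendsto_id)
  refine tendsto_nhds_unique h1 (h2.congr fun t => ?_)
  have e1 : expI A (t + -s) * expI A s = expI A t := by rw [← expI_add]; simp
  have e2 : expI B (-(t + -s)) = expI B s * expI B (-t) := by rw [← expI_add]; congr 1; ring
  change expI B (-(t + -s)) ((expI A (t + -s) * expI A s) x) = _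
  rw [e1, e2]
  rfl

theorem IsWaveOp.intertwine (h : IsWaveOp B A W) (hac : IsPurelyAC A) : B * W = W * A := by
  ext1 x
  have h1 := hasDerivAt_expI_apply B (W x) 0
  have h2 : HasDerivAt (fun s => W (expI A s x)) (W (Complex.I • A (expI A 0 x))) 0 :=
    (W.restrictScalars ℝ).hasFDerivAt.comp_hasDerivAt 0 (hasDerivAt_expI_apply A x 0)
  simp_rw [← h.intertwine_expI hac] at h2
  have h3 := h1.unique h2
  simp only [expI_zero, one_apply_eq_self, map_smul] at h3
  exact smul_right_injective _ Complex.I_ne_zero h3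

/-- W is isometric and intertwines the functional calculi, so a spectral measure of A at ψ is also
one of B at Wψ. -/
theorem IsWaveOp.mem_acSubspace (h : IsWaveOp B A W) (hA : IsSelfAdjoint A) (hB : IsSelfAdjoint B)
    (hac : IsPurelyAC A) (x : E) : W x ∈ acSubspace B := by
  have hle : acSubspace A ≤ (acSubspace B).comap (W : E →ₗ[ℂ] E) := by
    refine Submodule.topologicalClosure_minimal _ (Submodule.span_le.2 ?_)
      ((Submodule.isClosed_topologicalClosure _).preimage W.continuous)
    rintro ψ ⟨m, ⟨hfin, hm⟩, hmac⟩
    refine Submodule.le_topologicalClosure _ (Submodule.subset_span ⟨m, ⟨hfin, fun g => ?_⟩, hmac⟩)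
    have e := congrArg (fun T => T ψ)
      (cfc_comp_of_intertwine hB hA (h.intertwine hac) g.continuous)
    change cfc (fun x => g x) B (W ψ) = W (cfc (fun x => g x) A ψ) at e
    rw [← hm g]
    change ⟪W ψ, cfc (fun x => g x) B (W ψ)⟫_ℂ = _
    rw [e, h.inner_map_map hA hB hac]
  have : x ∈ acSubspace A := by rw [show acSubspace A = ⊤ from hac]; trivial
  exact hle this

/-- Matrix elements of `W₋(A, B) R W₋(B, A)` through the adjoint wave operator. -/
theorem inner_waveOp_conj (hA : IsSelfAdjoint A) (hB : IsSelfAdjoint B) (hac : IsPurelyAC A)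
    (h1 : WaveOpExists A B) (h2 : WaveOpExists B A) (R : E →L[ℂ] E) (f g : E) :
    ⟪g, (waveOp A B * R * waveOp B A) f⟫_ℂ = ⟪waveOp B A g, R (waveOp B A f)⟫_ℂ := by
  set φ := R (waveOp B A f)
  -- The projection P_ac(B) in the definition of W₋(A, B) is harmless here, because the range of
  -- W₋(B, A) lies in the absolutely continuous subspace of B.
  have e1 : ⟪waveOp B A g, acProj B φ⟫_ℂ = ⟪waveOp B A g, φ⟫_ℂ := by
    have hmem := IsWaveOp.mem_acSubspace h2 hA hB hac g
    have := Submodule.inner_starProjection_left_eq_right (acSubspace B) (waveOp B A g) φ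
    rw [Submodule.starProjection_eq_self_iff.2 hmem] at this
    exact this.symm
  rw [← e1]
  refine tendsto_nhds_unique (Filter.Tendsto.inner (𝕜 := ℂ) (tendsto_const_nhds (x := g)) (h1 φ)) ?_
  have h3 := (IsWaveOp.tendsto h2 hac g).inner (𝕜 := ℂ) (tendsto_const_nhds (x := acProj B φ))
  refine h3.congr fun t => ?_
  rw [inner_expI_left hB, inner_expI_left hA, neg_neg]

end WaveOperators

/-! ### Fermi--Dirac operators -/

section FermiDirac

variable {E : Type*} [NormedAddCommGroup E] [InnerProductSpace ℂ E] [CompleteSpace E]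

theorem isSelfAdjoint_fermiDirac (β : ℝ≥0∞) (μ : ℝ) (A : E →L[ℂ] E) :
    IsSelfAdjoint (fermiDirac β μ A) := by
  unfold fermiDirac
  split_ifs
  · exact isSelfAdjoint_starProjection _
  · exact cfc_predicate _ _

theorem norm_fermiDirac_le (β : ℝ≥0∞) (μ : ℝ) (A : E →L[ℂ] E) : ‖fermiDirac β μ A‖ ≤ 1 := by
  unfold fermiDirac
  split_ifs
  · exact Submodule.starProjection_norm_le _
  · refine norm_cfc_le zero_le_one fun x _ => ?_
    have := Real.exp_pos (β.toReal * (x - μ))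
    rw [Real.norm_of_nonneg (by positivity), div_le_one (by positivity)]
    linarith

/-- A preserves the kernel and, being self-adjoint, its orthogonal complement. This covers the
zero-temperature Fermi projection. -/
theorem commute_starProjection_ker {A T : E →L[ℂ] E} (hA : IsSelfAdjoint A) (h : Commute A T) :
    Commute T.ker.starProjection A := by
  have hinv : ∀ x ∈ T.ker, A x ∈ T.ker := fun x hx => by
    have e : T (A x) = A (T x) := congrArg (fun S => S x) h.eq.symm
    have hx' : T x = 0 := hx
    change T (A x) = 0
    rw [e, hx', map_zero]
  ext1 x
  change T.ker.starProjection (A x) = A (T.ker.starProjection x)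
  refine Submodule.eq_starProjection_of_mem_of_inner_eq_zero
    (hinv _ (Submodule.starProjection_apply_mem _ _)) fun y hy => ?_
  rw [← map_sub]
  have e : ⟪A (x - T.ker.starProjection x), y⟫_ℂ = ⟪x - T.ker.starProjection x, A y⟫_ℂ :=
    hA.isSymmetric _ _
  rw [e]
  exact Submodule.starProjection_inner_eq_zero _ _ (hinv y hy)

theorem commute_fermiDirac (β : ℝ≥0∞) (μ : ℝ) {A : E →L[ℂ] E} (hA : IsSelfAdjoint A) :
    Commute (fermiDirac β μ A) A := by
  have hc : ∀ f : ℝ → ℝ, Commute (cfc f A) A := fun f => by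
    have := cfc_commute_cfc f (fun x => x) A
    rwa [cfc_id' ℝ A] at this
  unfold fermiDirac
  split_ifs
  · exact commute_starProjection_ker hA (hc _).symm
  · exact hc _

end FermiDirac

namespace Model

variable {N : ℕ} (P : Model N)

/-! ### The initial state and the Hartree potential -/

theorem isSelfAdjoint_ρi {ρs : Sample N →L[ℂ] Sample N} (h : IsSelfAdjoint ρs) :
    IsSelfAdjoint (P.ρi ρs) :=
  isSelfAdjoint_directSum (fun _ => isSelfAdjoint_fermiDirac _ _ _) h

theorem norm_ρi_le {ρs : Sample N →L[ℂ] Sample N} (h : ‖ρs‖ ≤ 1) : ‖P.ρi ρs‖ ≤ 1 :=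
  norm_directSum_le (fun _ => norm_fermiDirac_le _ _ _) h

/-- This permits e^{-itH_L} to be inserted on both sides of the initial state. No condition on ρs
arises, because H_L vanishes on the sample. -/
theorem commute_ρi_HL (ρs : Sample N →L[ℂ] Sample N) : Commute (P.ρi ρs) P.HL := by
  change directSum _ _ * directSum _ _ = directSum _ _ * directSum _ _
  rw [directSum_mul, directSum_mul]
  congr 1
  · funext j
    exact commute_fermiDirac _ _ (isSelfAdjoint_dirichletLaplacian _)
  · simp

/-- The Hartree potential created by the site densities `n`. -/
noncomputable def pot (lam : ℝ) (n : Fin N → ℂ) (j : Fin N) : ℂ :=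
  lam * ∑ k, (P.ν j k : ℂ) * n k

/-- An upper bound for the Hartree potential at site `j`. -/
noncomputable def potBound (lam : ℝ) (j : Fin N) : ℝ := lam * ∑ k, |P.ν j k|

theorem V_eq_samplePotential (lam : ℝ) (γ : Hilb N →L[ℂ] Hilb N) :
    P.V lam γ = samplePotential (P.pot lam fun k => ⟪zeta k, γ (zeta k)⟫_ℂ) := by
  simp only [V, hartree, samplePotential, pot, Finset.smul_sum, smul_smul]

theorem potBound_nonneg {lam : ℝ} (hlam : 0 ≤ lam) (j : Fin N) : 0 ≤ P.potBound lam j :=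
  mul_nonneg hlam (Finset.sum_nonneg fun _ _ => abs_nonneg _)

theorem norm_pot_sub_le {lam : ℝ} (hlam : 0 ≤ lam) {n n' : Fin N → ℂ} {δ : ℝ}
    (h : ∀ k, ‖n k - n' k‖ ≤ δ) (j : Fin N) :
    ‖P.pot lam n j - P.pot lam n' j‖ ≤ P.potBound lam j * δ := by
  unfold pot potBound
  rw [← mul_sub, ← Finset.sum_sub_distrib, norm_mul, Complex.norm_real, Real.norm_of_nonneg hlam,
    mul_assoc]
  refine mul_le_mul_of_nonneg_left ?_ hlam
  rw [Finset.sum_mul]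
  refine norm_sum_le_of_le _ fun k _ => ?_
  rw [← mul_sub, norm_mul, Complex.norm_real, Real.norm_eq_abs]
  exact mul_le_mul_of_nonneg_left (h k) (abs_nonneg _)

theorem pot_zero (lam : ℝ) (j : Fin N) : P.pot lam (fun _ => 0) j = 0 := by
  simp [pot]

theorem norm_pot_le {lam : ℝ} (hlam : 0 ≤ lam) {n : Fin N → ℂ} {δ : ℝ} (h : ∀ k, ‖n k‖ ≤ δ)
    (j : Fin N) : ‖P.pot lam n j‖ ≤ P.potBound lam j * δ := by
  have := P.norm_pot_sub_le hlam (n := n) (n' := fun _ => 0) (δ := δ) (by simpa using h) j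
  rwa [pot_zero, sub_zero] at this

theorem conj_pot (lam : ℝ) {n : Fin N → ℂ} (h : ∀ k, (starRingEnd ℂ) (n k) = n k) (j : Fin N) :
    (starRingEnd ℂ) (P.pot lam n j) = P.pot lam n j := by
  simp [pot, h]

theorem conj_inner_of_isSelfAdjoint {E : Type*} [NormedAddCommGroup E] [InnerProductSpace ℂ E]
    [CompleteSpace E] {R : E →L[ℂ] E} (hR : IsSelfAdjoint R) (x : E) :
    (starRingEnd ℂ) ⟪x, R x⟫_ℂ = ⟪x, R x⟫_ℂ := by
  rw [inner_conj_symm]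
  exact hR.isSymmetric _ _

theorem V_sub (lam : ℝ) (a b : Hilb N →L[ℂ] Hilb N) : P.V lam (a - b) = P.V lam a - P.V lam b := by
  simp only [V, hartree, sub_apply, inner_sub_right, mul_sub, Finset.sum_sub_distrib, sub_smul,
    smul_sub]

theorem isSelfAdjoint_V (lam : ℝ) {γ : Hilb N →L[ℂ] Hilb N} (h : IsSelfAdjoint γ) :
    IsSelfAdjoint (P.V lam γ) := by
  rw [V_eq_samplePotential]
  exact isSelfAdjoint_samplePotential
    (P.conj_pot lam fun k => conj_inner_of_isSelfAdjoint h _)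

theorem norm_inner_zeta_le (γ : Hilb N →L[ℂ] Hilb N) (k : Fin N) :
    ‖⟪zeta k, γ (zeta k)⟫_ℂ‖ ≤ ‖γ‖ := by
  refine (norm_inner_le_norm _ _).trans ?_
  rw [norm_zeta, one_mul]
  simpa [norm_zeta] using γ.le_opNorm (zeta k)

theorem norm_V_le {lam : ℝ} (hlam : 0 ≤ lam) (γ : Hilb N →L[ℂ] Hilb N) :
    ‖P.V lam γ‖ ≤ (∑ j, P.potBound lam j) * ‖γ‖ := by
  rw [V_eq_samplePotential]
  refine ContinuousLinearMap.opNorm_le_bound _ (mul_nonneg (Finset.sum_nonneg fun j _ =>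
    P.potBound_nonneg hlam j) (norm_nonneg _)) fun ψ => ?_
  rw [samplePotential_apply, Finset.sum_mul, Finset.sum_mul]
  refine norm_sum_le_of_le _ fun k _ => ?_
  rw [norm_smul, norm_zeta, mul_one, norm_mul]
  refine mul_le_mul (P.norm_pot_le hlam (norm_inner_zeta_le γ) k) ?_ (norm_nonneg _)
    (mul_nonneg (P.potBound_nonneg hlam k) (norm_nonneg _))
  simpa [norm_zeta] using norm_inner_le_norm (𝕜 := ℂ) (zeta k) ψ

theorem norm_inner_sub_inner_le {E : Type*} [NormedAddCommGroup E] [InnerProductSpace ℂ E]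
    [CompleteSpace E] {R : E →L[ℂ] E} (hR : ‖R‖ ≤ 1) (x y x' y' : E) :
    ‖⟪x, R y⟫_ℂ - ⟪x', R y'⟫_ℂ‖ ≤ ‖x - x'‖ * ‖y‖ + ‖x'‖ * ‖y - y'‖ := by
  have hR' : ∀ z, ‖R z‖ ≤ ‖z‖ := fun z => by simpa using R.le_of_opNorm_le hR z
  have e : ⟪x, R y⟫_ℂ - ⟪x', R y'⟫_ℂ = ⟪x - x', R y⟫_ℂ + ⟪x', R (y - y')⟫_ℂ := by
    rw [inner_sub_left, map_sub, inner_sub_right]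
    ring
  rw [e]
  refine (norm_add_le _ _).trans (add_le_add ((norm_inner_le_norm _ _).trans ?_)
    ((norm_inner_le_norm _ _).trans ?_))
  · exact mul_le_mul_of_nonneg_left (hR' _) (norm_nonneg _)
  · exact mul_le_mul_of_nonneg_left (hR' _) (norm_nonneg _)

theorem norm_density_sub_le {E : Type*} [NormedAddCommGroup E] [InnerProductSpace ℂ E]
    [CompleteSpace E] {R : E →L[ℂ] E} (hR : ‖R‖ ≤ 1) {x y : E} (hx : ‖x‖ ≤ 1) (hy : ‖y‖ ≤ 1) :
    ‖⟪x, R x⟫_ℂ - ⟪y, R y⟫_ℂ‖ ≤ 2 * ‖x - y‖ := by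
  refine (norm_inner_sub_inner_le hR x x y y).trans ?_
  nlinarith [norm_nonneg (x - y)]

theorem norm_density_le {E : Type*} [NormedAddCommGroup E] [InnerProductSpace ℂ E]
    [CompleteSpace E] {R : E →L[ℂ] E} (hR : ‖R‖ ≤ 1) {x : E} (hx : ‖x‖ ≤ 1) :
    ‖⟪x, R x⟫_ℂ‖ ≤ 1 := by
  refine (norm_inner_le_norm _ _).trans (mul_le_one₀ hx (norm_nonneg _) ?_)
  exact (R.le_of_opNorm_le hR x).trans (by rwa [one_mul])

/-! ### Scattering into the sample -/

/-- The amplitude `⟨ζ_k, e^{isH} f⟩`. -/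
noncomputable def amp (k : Fin N) (f : Hilb N) (s : ℝ) : ℂ := ⟪zeta k, expI P.H s f⟫_ℂ

theorem continuous_amp (k : Fin N) (f : Hilb N) : Continuous (P.amp k f) :=
  continuous_const.inner (continuous_expI_apply P.H f)

theorem integrableOn_amp (hP : P.Dispersive) (k : Fin N) {f : Hilb N} (hf : HasCompactSupp f) :
    IntegrableOn (P.amp k f) (Set.Ioi 0) :=
  (hP _ _ (hasCompactSupp_zeta k) hf).integrableOn

/-- `∫_0^∞ |⟨ζ_k, e^{isH} f⟩| ds`. -/
noncomputable def ampNorm (k : Fin N) (f : Hilb N) : ℝ := ∫ s in Set.Ioi (0 : ℝ), ‖P.amp k f s‖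

theorem ampNorm_nonneg (k : Fin N) (f : Hilb N) : 0 ≤ P.ampNorm k f :=
  integral_nonneg fun _ => norm_nonneg _

/-- Finiteness matters because the estimates use `P.M.toReal`, which would be 0 if `M` were
infinite. -/
theorem M_lt_top (hP : P.Dispersive) : P.M < ∞ := by
  have h : ∀ j n : Fin N, ∫⁻ s in Set.Ioi (0 : ℝ), ‖⟪zeta j, expI P.H s (zeta n)⟫_ℂ‖ₑ < ∞ :=
    fun j n => (P.integrableOn_amp hP j (hasCompactSupp_zeta n)).2
  refine lt_of_le_of_lt (iSup_le fun j => iSup_le fun n => ?_)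
    (ENNReal.sum_lt_top.2 fun j _ => ENNReal.sum_lt_top.2 fun n _ => h j n :
      ∑ j, ∑ n, _ < ∞)
  refine le_trans (Finset.single_le_sum (f := fun n => ∫⁻ s in Set.Ioi (0 : ℝ),
    ‖⟪zeta j, expI P.H s (zeta n)⟫_ℂ‖ₑ) (fun _ _ => zero_le) (Finset.mem_univ n)) ?_
  exact Finset.single_le_sum (f := fun j => ∑ n, ∫⁻ s in Set.Ioi (0 : ℝ),
    ‖⟪zeta j, expI P.H s (zeta n)⟫_ℂ‖ₑ) (fun _ _ => zero_le) (Finset.mem_univ j)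

theorem ampNorm_le_M (hP : P.Dispersive) (k j : Fin N) : P.ampNorm k (zeta j) ≤ P.M.toReal := by
  unfold ampNorm
  rw [integral_norm_eq_lintegral_enorm
    (P.continuous_amp k (zeta j)).aestronglyMeasurable.restrict]
  refine ENNReal.toReal_mono (P.M_lt_top hP).ne ?_
  exact le_iSup₂_of_le (f := fun (j n : Fin N) => ∫⁻ s in Set.Ioi (0 : ℝ),
    ‖⟪zeta j, expI P.H s (zeta n)⟫_ℂ‖ₑ) k j le_rfl

/-- The potential bounds sum to λ‖ν‖₁, so λ < λ_0 is turned into the real inequality under which the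
oscillation argument contracts. -/
theorem smallness {lam1 lam : ℝ} (h1 : ENNReal.ofReal lam1 ≤ P.lambda0)
    (hlam : 0 ≤ lam) (hlt : lam < lam1) : 12 * ((∑ j, P.potBound lam j) * P.M.toReal) ≤ 1 := by
  have h2 : ENNReal.ofReal lam ≤ P.lambda0 := (ENNReal.ofReal_le_ofReal hlt.le).trans h1
  have hν : 0 ≤ ∑ j, ∑ k, |P.ν j k| :=
    Finset.sum_nonneg fun _ _ => Finset.sum_nonneg fun _ _ => abs_nonneg _
  rw [lambda0, ENNReal.le_inv_iff_mul_le] at h2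
  have h3 := ENNReal.toReal_mono ENNReal.one_ne_top h2
  rw [ENNReal.toReal_mul, ENNReal.toReal_mul, ENNReal.toReal_mul, ENNReal.toReal_ofReal hlam,
    ENNReal.toReal_ofReal hν, ENNReal.toReal_one] at h3
  have e : ∑ j, P.potBound lam j = lam * ∑ j, ∑ k, |P.ν j k| := by
    simp [potBound, Finset.mul_sum]
  rw [e]
  simp only [ENNReal.toReal_ofNat] at h3
  linarith

/-- The vector `∫_0^∞ ⟨ζ_k, e^{isH} f⟩ e^{-isH_L} v ds`. -/
noncomputable def smear (k : Fin N) (f v : Hilb N) : Hilb N :=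
  ∫ s in Set.Ioi (0 : ℝ), P.amp k f s • expI P.HL (-s) v

theorem continuous_expI_HL_neg : Continuous fun s : ℝ => expI P.HL (-s) :=
  (continuous_expI _).comp continuous_neg

theorem integrableOn_smear (hP : P.Dispersive) (k : Fin N) {f : Hilb N} (hf : HasCompactSupp f)
    (v : Hilb N) : IntegrableOn (fun s => P.amp k f s • expI P.HL (-s) v) (Set.Ioi 0) := by
  refine ((P.integrableOn_amp hP k hf).norm.mul_const ‖v‖).mono' ?_ ?_
  · exact ((P.continuous_amp k f).smul
      (P.continuous_expI_HL_neg.clm_apply continuous_const)).aestronglyMeasurable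
  · refine Eventually.of_forall fun s => ?_
    rw [norm_smul, norm_expI_apply P.isSelfAdjoint_HL]

theorem smear_sub (hP : P.Dispersive) (k : Fin N) {f : Hilb N} (hf : HasCompactSupp f)
    (v v' : Hilb N) : P.smear k f (v - v') = P.smear k f v - P.smear k f v' := by
  unfold smear
  rw [← integral_sub (P.integrableOn_smear hP k hf v) (P.integrableOn_smear hP k hf v')]
  simp_rw [map_sub, smul_sub]

theorem norm_smear_le (hP : P.Dispersive) (k : Fin N) {f : Hilb N} (hf : HasCompactSupp f)
    (v : Hilb N) : ‖P.smear k f v‖ ≤ ‖v‖ * P.ampNorm k f := by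
  unfold smear ampNorm
  rw [← integral_const_mul]
  refine norm_integral_le_of_norm_le ((P.integrableOn_amp hP k hf).norm.const_mul _) ?_
  refine Eventually.of_forall fun s => ?_
  rw [norm_smul, norm_expI_apply P.isSelfAdjoint_HL, mul_comm]

/-- Dynamics generated by `H` plus a small sample potential scatter compactly supported states,
and the asymptotic states solve a stationary equation. -/
theorem exists_asymptotics (hP : P.Dispersive) {W : Hilb N → Hilb N}
    (hW : ∀ f, Tendsto (fun t : ℝ => expI P.HL (-t) (expI P.H t f)) atTop (𝓝 (W f)))
    {Z : ℝ → Hilb N →L[ℂ] Hilb N} {w : Fin N → ℝ → ℂ} {κ : Fin N → ℝ}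
    (hw : ∀ k, Continuous (w k)) (hZ0 : Z 0 = 1)
    (hZ : ∀ t, HasDerivAt Z (Complex.I • (Z t * (P.H + samplePotential fun k => w k t))) t)
    (hZ1 : ∀ t, ‖Z t‖ ≤ 1) (hκ : ∀ k t, ‖w k t‖ ≤ κ k)
    (hosc : ∀ k, ∀ δ t t' : ℝ,
      (∀ l, ‖expI P.HL (-t) (Z t (zeta l)) - expI P.HL (-t') (Z t' (zeta l))‖ ≤ δ) →
        ‖w k t - w k t'‖ ≤ 2 * κ k * δ)
    (hsmall : 12 * ((∑ k, κ k) * P.M.toReal) ≤ 1)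
    (hlim : ∀ X : Fin N → Hilb N,
      (∀ j, Tendsto (fun t : ℝ => expI P.HL (-t) (Z t (zeta j))) atTop (𝓝 (X j))) →
      ∃ v : Fin N → ℂ, ∀ k, Tendsto (w k) atTop (𝓝 (v k))) :
    ∃ (X : Hilb N → Hilb N) (v : Fin N → ℂ), (∀ k, Tendsto (w k) atTop (𝓝 (v k))) ∧
      ∀ f, HasCompactSupp f →
        Tendsto (fun t : ℝ => expI P.HL (-t) (Z t f)) atTop (𝓝 (X f)) ∧ ‖X f‖ ≤ ‖f‖ ∧
        X f = W f + Complex.I • ∑ k, P.smear k f (v k • X (zeta k)) := by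
  set b : Hilb N → ℝ → Hilb N := fun f t => expI P.HL (-t) (Z t f)
  have hκ0 : ∀ k, 0 ≤ κ k := fun k => (norm_nonneg _).trans (hκ k 0)
  have hZc : Continuous Z := continuous_iff_continuousAt.2 fun t => (hZ t).continuousAt
  have hbc : ∀ f, Continuous (b f) := fun f =>
    P.continuous_expI_HL_neg.clm_apply (hZc.clm_apply continuous_const)
  have hG1 : ∀ (s : ℝ) x, ‖expI P.HL (-s) x‖ = ‖x‖ := fun s x =>
    norm_expI_apply P.isSelfAdjoint_HL _ _
  have hbn : ∀ f t, ‖b f t‖ ≤ ‖f‖ := fun f t => by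
    simp only [b]
    rw [hG1]
    simpa using (Z t).le_of_opNorm_le (hZ1 t) f
  have hbz : ∀ k t, ‖b (zeta k) t‖ ≤ 1 := fun k t => (hbn _ t).trans (norm_zeta k).le
  have heq : ∀ f t, b f t = expI P.HL (-t) (expI P.H t f) + Complex.I • ∑ k, ∫ s in (0 : ℝ)..t,
      P.amp k f s • expI P.HL (-s) (w k (t - s) • b (zeta k) (t - s)) := fun f t =>
    duhamel_rotated hw hZ0 hZ f t
  have hyc : ∀ k, Continuous fun t => w k t • b (zeta k) t := fun k => (hw k).smul (hbc _)
  have hyκ : ∀ k t, 0 ≤ t → ‖w k t • b (zeta k) t‖ ≤ κ k := fun k t _ => by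
    rw [norm_smul]
    exact (mul_le_of_le_one_right (norm_nonneg _) (hbz k t)).trans (hκ k t)
  have hconv : ∀ j, ∃ l, Tendsto (b (zeta j)) atTop (𝓝 l) := by
    refine exists_tendsto_of_retarded_equation (b := fun j => b (zeta j))
      (b0 := fun j t => expI P.HL (-t) (expI P.H t (zeta j)))
      (y := fun k t => w k t • b (zeta k) t) (c := fun k j => P.amp k (zeta j))
      P.continuous_expI_HL_neg hG1 (fun k j => P.continuous_amp k _)
      (fun k j => P.integrableOn_amp hP k (hasCompactSupp_zeta j)) (P.ampNorm_le_M hP) hyc hyκ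
      (fun j => ⟨_, hW _⟩) (fun j t _ => hbz j t) (fun j t => heq _ t) ?_ hsmall
    intro k δ t t' _ _ hδ
    -- The constant 3κ_k is 2κ_k from the variation of the potential plus κ_k from that of the
    -- state.
    have e : w k t • b (zeta k) t - w k t' • b (zeta k) t' =
        (w k t - w k t') • b (zeta k) t + w k t' • (b (zeta k) t - b (zeta k) t') := by
      rw [sub_smul, smul_sub]
      abel
    change ‖w k t • b (zeta k) t - w k t' • b (zeta k) t'‖ ≤ _
    rw [e]
    calc _ ≤ 2 * κ k * δ * 1 + κ k * δ := by
          refine (norm_add_le _ _).trans (add_le_add ?_ ?_)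
          · rw [norm_smul]
            exact mul_le_mul (hosc k δ t t' hδ) (hbz k t) (norm_nonneg _)
              ((norm_nonneg _).trans (hosc k δ t t' hδ))
          · rw [norm_smul]
            exact mul_le_mul (hκ k t') (hδ k) (norm_nonneg _) (hκ0 k)
      _ = 3 * κ k * δ := by ring
  choose Xz hXz using hconv
  -- Limits of the potential become available only now: in the nonlinear case they are functions of
  -- the limiting states.
  obtain ⟨v, hv⟩ := hlim Xz hXz
  have hX : ∀ f, HasCompactSupp f →
      Tendsto (b f) atTop (𝓝 (W f + Complex.I • ∑ k, P.smear k f (v k • Xz k))) := by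
    intro f hf
    have h1 : ∀ k, Tendsto (fun t : ℝ => ∫ s in (0 : ℝ)..t,
        P.amp k f s • expI P.HL (-s) (w k (t - s) • b (zeta k) (t - s))) atTop
          (𝓝 (P.smear k f (v k • Xz k))) := fun k =>
      tendsto_retarded_convolution P.continuous_expI_HL_neg hG1 (P.continuous_amp k f)
        (P.integrableOn_amp hP k hf) (hyc k) (hyκ k) ((hv k).smul (hXz k))
    refine ((hW f).add ((tendsto_finsetSum _ fun k _ => h1 k).const_smul Complex.I)).congr
      fun t => (heq f t).symm
  -- The limit formula at f = ζ_j must reproduce `Xz j`; this makes the stationary equation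
  -- self-contained.
  have hXz' : ∀ j, W (zeta j) + Complex.I • ∑ k, P.smear k (zeta j) (v k • Xz k) = Xz j := fun j =>
    tendsto_nhds_unique (hX _ (hasCompactSupp_zeta j)) (hXz j)
  refine ⟨fun f => W f + Complex.I • ∑ k, P.smear k f (v k • Xz k), v, hv, fun f hf =>
    ⟨hX f hf, le_of_tendsto' (hX f hf).norm (hbn f), ?_⟩⟩
  simp_rw [hXz']

/-! ### The effective Hamiltonian and the comparison to second order. -/

theorem Heff_zero (ρs : Sample N →L[ℂ] Sample N) : P.Heff 0 ρs = P.H := by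
  simp [Heff, V, hartree]

theorem Heff_eq (lam : ℝ) (ρs : Sample N →L[ℂ] Sample N) :
    P.Heff lam ρs = P.H + samplePotential (P.pot lam fun k =>
      ⟪zeta k, (waveOp P.H P.HL * P.ρi ρs * waveOp P.HL P.H) (zeta k)⟫_ℂ) := by
  rw [Heff, V_eq_samplePotential]

theorem waveOpExists_HL_H (hP : P.Dispersive) : WaveOpExists P.HL P.H :=
  waveOpExists_of_tendsto fun _ => P.exists_tendsto_of_dispersive hP _

theorem waveOpExists_H_HL : WaveOpExists P.H P.HL := by
  have h := P.waveOpExists_HL (w := fun _ => 0) fun _ => map_zero _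
  simpa [samplePotential] using h

/-- Two asymptotic states built from the same free wave agree to second order in the coupling. -/
theorem norm_asymptotics_sub_le (hP : P.Dispersive) {lam : ℝ} (hlam : 0 ≤ lam)
    {R : Hilb N →L[ℂ] Hilb N} (hR : ‖R‖ ≤ 1) {W X Y : Hilb N → Hilb N}
    (hW1 : ∀ k, ‖W (zeta k)‖ ≤ 1) (hX1 : ∀ k, ‖X (zeta k)‖ ≤ 1) (hY1 : ∀ k, ‖Y (zeta k)‖ ≤ 1)
    (hX : ∀ f, HasCompactSupp f → X f = W f + Complex.I • ∑ k, P.smear k f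
      (P.pot lam (fun l => ⟪X (zeta l), R (X (zeta l))⟫_ℂ) k • X (zeta k)))
    (hY : ∀ f, HasCompactSupp f → Y f = W f + Complex.I • ∑ k, P.smear k f
      (P.pot lam (fun l => ⟪W (zeta l), R (W (zeta l))⟫_ℂ) k • Y (zeta k)))
    {f : Hilb N} (hf : HasCompactSupp f) :
    ‖X f - Y f‖ ≤ 4 * ((∑ k, P.potBound 1 k) * P.M.toReal) *
      (∑ k, P.potBound 1 k * P.ampNorm k f) * lam ^ 2 := by
  have hpb : ∀ k, P.potBound lam k = lam * P.potBound 1 k := fun k => by simp [potBound]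
  set A := (∑ k, P.potBound 1 k) * P.M.toReal
  have hA0 : 0 ≤ A := mul_nonneg (Finset.sum_nonneg fun k _ => P.potBound_nonneg zero_le_one k)
    ENNReal.toReal_nonneg
  -- First order: any solution of a stationary equation whose potential comes from densities at most
  -- 1 differs from W by O(λ) on the sample.
  have hfirst : ∀ {U : Hilb N → Hilb N} {n : Fin N → ℂ}, (∀ k, ‖U (zeta k)‖ ≤ 1) →
      (∀ k, ‖n k‖ ≤ 1) → (∀ f, HasCompactSupp f → U f = W f + Complex.I • ∑ k, P.smear k f
        (P.pot lam n k • U (zeta k))) → ∀ j, ‖U (zeta j) - W (zeta j)‖ ≤ lam * A := by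
    intro U n hU1 hn hU j
    rw [hU _ (hasCompactSupp_zeta j), add_sub_cancel_left, norm_smul, Complex.norm_I, one_mul]
    have hA : lam * A = ∑ k, P.potBound lam k * P.M.toReal := by
      simp only [A, hpb]
      rw [← Finset.sum_mul, ← Finset.mul_sum, mul_assoc]
    rw [hA]
    refine norm_sum_le_of_le _ fun k _ =>
      (P.norm_smear_le hP k (hasCompactSupp_zeta j) _).trans ?_
    refine mul_le_mul ?_ (P.ampNorm_le_M hP k j) (P.ampNorm_nonneg _ _) (P.potBound_nonneg hlam k)
    rw [norm_smul]
    refine (mul_le_of_le_one_right (norm_nonneg _) (hU1 k)).trans ?_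
    simpa using P.norm_pot_le hlam hn k
  have hXW := hfirst hX1 (fun k => norm_density_le hR (hX1 k)) hX
  have hYW := hfirst hY1 (fun k => norm_density_le hR (hW1 k)) hY
  rw [hX f hf, hY f hf, add_sub_add_left_eq_sub, ← smul_sub, norm_smul, Complex.norm_I, one_mul,
    ← Finset.sum_sub_distrib, Finset.mul_sum, Finset.sum_mul]
  refine norm_sum_le_of_le _ fun k _ => ?_
  rw [← P.smear_sub hP k hf]
  refine (P.norm_smear_le hP k hf _).trans ?_
  set wX := P.pot lam (fun l => ⟪X (zeta l), R (X (zeta l))⟫_ℂ) k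
  set wW := P.pot lam (fun l => ⟪W (zeta l), R (W (zeta l))⟫_ℂ) k
  have h1 : ‖wX - wW‖ ≤ P.potBound lam k * (2 * (lam * A)) :=
    P.norm_pot_sub_le hlam (fun l => (norm_density_sub_le hR (hX1 l) (hW1 l)).trans
      (mul_le_mul_of_nonneg_left (hXW l) zero_le_two)) k
  have h2 : ‖wW‖ ≤ P.potBound lam k := by
    simpa only [mul_one] using P.norm_pot_le hlam (fun l => norm_density_le hR (hW1 l)) k
  have h3 : ‖X (zeta k) - Y (zeta k)‖ ≤ 2 * (lam * A) := by
    have e : X (zeta k) - Y (zeta k) = (X (zeta k) - W (zeta k)) - (Y (zeta k) - W (zeta k)) := by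
      abel
    rw [e]
    refine (norm_sub_le _ _).trans ?_
    linarith [hXW k, hYW k]
  -- Second order: each of the two terms is of size λ times an O(λ) difference, and each contributes
  -- 2 to the constant 4.
  have e : wX • X (zeta k) - wW • Y (zeta k) =
      (wX - wW) • X (zeta k) + wW • (X (zeta k) - Y (zeta k)) := by
    rw [sub_smul, smul_sub]
    abel
  have h4 : ‖wX • X (zeta k) - wW • Y (zeta k)‖ ≤ 4 * A * P.potBound 1 k * lam ^ 2 := by
    rw [e]
    calc _ ≤ P.potBound lam k * (2 * (lam * A)) * 1 + P.potBound lam k * (2 * (lam * A)) := by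
          refine (norm_add_le _ _).trans (add_le_add ?_ ?_)
          · rw [norm_smul]
            exact mul_le_mul h1 (hX1 k) (norm_nonneg _) ((norm_nonneg _).trans h1)
          · rw [norm_smul]
            exact mul_le_mul h2 h3 (norm_nonneg _) (P.potBound_nonneg hlam k)
      _ = _ := by
          rw [hpb]
          ring
  refine (mul_le_mul_of_nonneg_right h4 (P.ampNorm_nonneg k f)).trans_eq ?_
  ring

/-- The data at one coupling constant: wave operators of the effective Hamiltonian, and the
asymptotic states which it produces. -/
theorem effective_asymptotics (hP : P.Dispersive) {lam : ℝ} (hlam : 0 ≤ lam)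
    (hsmall : 12 * ((∑ j, P.potBound lam j) * P.M.toReal) ≤ 1) (hacH : IsPurelyAC P.H)
    {ρs : Sample N →L[ℂ] Sample N} (hρs : IsSelfAdjoint ρs) (hρs1 : ‖ρs‖ ≤ 1)
    (hac : IsPurelyAC (P.Heff lam ρs)) :
    WaveOpExists (P.Heff lam ρs) P.HL ∧ WaveOpExists P.HL (P.Heff lam ρs) ∧
      (∀ f, ‖waveOp P.HL (P.Heff lam ρs) f‖ = ‖f‖) ∧
      (∀ f, HasCompactSupp f → waveOp P.HL (P.Heff lam ρs) f = waveOp P.HL P.H f +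
        Complex.I • ∑ k, P.smear k f (P.pot lam (fun l => ⟪waveOp P.HL P.H (zeta l),
          P.ρi ρs (waveOp P.HL P.H (zeta l))⟫_ℂ) k • waveOp P.HL (P.Heff lam ρs) (zeta k))) ∧
      ∀ f g, ⟪g, P.ρeff lam ρs f⟫_ℂ = ⟪waveOp P.HL (P.Heff lam ρs) g,
        P.ρi ρs (waveOp P.HL (P.Heff lam ρs) f)⟫_ℂ := by
  set W := waveOp P.HL P.H
  set R := P.ρi ρs
  have hRsa : IsSelfAdjoint R := P.isSelfAdjoint_ρi hρs
  have hR1 : ‖R‖ ≤ 1 := P.norm_ρi_le hρs1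
  have hWex := P.waveOpExists_HL_H hP
  have hW : ∀ f, Tendsto (fun t : ℝ => expI P.HL (-t) (expI P.H t f)) atTop (𝓝 (W f)) :=
    IsWaveOp.tendsto hWex hacH
  have hWn : ∀ f, ‖W f‖ = ‖f‖ := fun f => by
    refine tendsto_nhds_unique (hW f).norm ?_
    simp_rw [norm_expI_apply P.isSelfAdjoint_HL, norm_expI_apply P.isSelfAdjoint_H]
    exact tendsto_const_nhds
  set n : Fin N → ℂ := fun l => ⟪W (zeta l), R (W (zeta l))⟫_ℂ
  have hn1 : ∀ l, ‖n l‖ ≤ 1 := fun l =>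
    norm_density_le hR1 ((hWn _).trans (norm_zeta l)).le
  -- Through the adjoint relation the densities in H_eff become those of the free waves Wζ_l, in
  -- particular real and at most 1 in modulus.
  have hH : P.Heff lam ρs = P.H + samplePotential (P.pot lam n) := by
    rw [Heff_eq]
    congr 3
    funext k
    exact inner_waveOp_conj P.isSelfAdjoint_H P.isSelfAdjoint_HL hacH P.waveOpExists_H_HL hWex _ _ _
  have hreal : ∀ k, (starRingEnd ℂ) (P.pot lam n k) = P.pot lam n k :=
    P.conj_pot lam fun l => conj_inner_of_isSelfAdjoint hRsa _
  have hsa : IsSelfAdjoint (P.Heff lam ρs) := by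
    rw [hH]
    exact P.isSelfAdjoint_H_add_samplePotential hreal
  have hex1 : WaveOpExists (P.Heff lam ρs) P.HL := by
    rw [hH]
    exact P.waveOpExists_HL hreal
  obtain ⟨Y, v, hv, hY⟩ := P.exists_asymptotics hP hW (Z := expI (P.Heff lam ρs))
    (w := fun k _ => P.pot lam n k) (κ := P.potBound lam) (fun _ => continuous_const)
    (expI_zero _) (fun t => by rw [← hH]; exact hasDerivAt_expI _ t) (norm_expI_le hsa)
    (fun k _ => by simpa using P.norm_pot_le hlam hn1 k)
    (fun k δ t t' hδ => by
      rw [sub_self, norm_zero]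
      exact mul_nonneg (mul_nonneg zero_le_two (P.potBound_nonneg hlam k))
        ((norm_nonneg _).trans (hδ k))) hsmall (fun _ _ => ⟨_, fun _ => tendsto_const_nhds⟩)
  have hvn : v = P.pot lam n := funext fun k => tendsto_nhds_unique (hv k) tendsto_const_nhds
  subst hvn
  -- Convergence is known on the compactly supported site vectors and extends by density.
  have hex2 : WaveOpExists P.HL (P.Heff lam ρs) := by
    refine waveOpExists_of_tendsto fun x => ?_
    refine exists_tendsto_of_span_dense (T := fun t => expI P.HL (-t) * expI (P.Heff lam ρs) t)
      (s := Set.range siteVec) (fun t => ?_) ?_ (by rw [dense_span_siteVec]; trivial)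
    · exact (norm_mul_le _ _).trans (mul_le_one₀ (norm_expI_le P.isSelfAdjoint_HL _)
        (norm_nonneg _) (norm_expI_le hsa _))
    · rintro _ ⟨i, rfl⟩
      exact ⟨_, (hY _ (hasCompactSupp_siteVec i)).1⟩
  have hlimY := IsWaveOp.tendsto hex2 hac
  have hYeq : ∀ f, HasCompactSupp f → Y f = waveOp P.HL (P.Heff lam ρs) f := fun f hf =>
    tendsto_nhds_unique (hY f hf).1 (hlimY f)
  refine ⟨hex1, hex2, fun f => ?_, fun f hf => ?_, fun f g =>
    inner_waveOp_conj hsa P.isSelfAdjoint_HL hac hex1 hex2 _ _ _⟩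
  · refine tendsto_nhds_unique (hlimY f).norm ?_
    simp_rw [norm_expI_apply P.isSelfAdjoint_HL, norm_expI_apply hsa]
    exact tendsto_const_nhds
  · rw [← hYeq f hf, (hY f hf).2.2]
    simp_rw [hYeq _ (hasCompactSupp_zeta _)]

theorem IsLiouvilleSolution.hasDerivAt {lam : ℝ} {ρs : Sample N →L[ℂ] Sample N}
    {ρ : ℝ → Hilb N →L[ℂ] Hilb N} (h : P.IsLiouvilleSolution lam ρs ρ) {t : ℝ} (ht : 0 < t) :
    HasDerivAt ρ (-(Complex.I • ((P.H + P.V lam (ρ t)) * ρ t - ρ t * (P.H + P.V lam (ρ t))))) t := by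
  obtain ⟨ρ', hρ', e⟩ := h.2.2 t ht
  rw [← e, I_smul_I_smul, neg_neg]
  exact hρ'

set_option maxHeartbeats 2000000 in
/-- The Liouville equation is solved by conjugating the initial state with a unitary propagator, and
its solutions have asymptotic states. -/
theorem liouville_asymptotics (hP : P.Dispersive) {lam : ℝ} (hlam : 0 ≤ lam)
    (hsmall : 12 * ((∑ j, P.potBound lam j) * P.M.toReal) ≤ 1) {W : Hilb N → Hilb N}
    (hW : ∀ f, Tendsto (fun t : ℝ => expI P.HL (-t) (expI P.H t f)) atTop (𝓝 (W f)))
    {ρs : Sample N →L[ℂ] Sample N} (hρs : IsSelfAdjoint ρs) (hρs1 : ‖ρs‖ ≤ 1) :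
    (∃ ρ, P.IsLiouvilleSolution lam ρs ρ) ∧
    ∃ X : Hilb N → Hilb N, (∀ f, HasCompactSupp f → ‖X f‖ ≤ ‖f‖ ∧
      X f = W f + Complex.I • ∑ k, P.smear k f
        (P.pot lam (fun l => ⟪X (zeta l), P.ρi ρs (X (zeta l))⟫_ℂ) k • X (zeta k))) ∧
      ∀ ρ, P.IsLiouvilleSolution lam ρs ρ → ∀ f g, HasCompactSupp f → HasCompactSupp g →
        Tendsto (fun t : ℝ => ⟪g, ρ t f⟫_ℂ) atTop (𝓝 ⟪X g, P.ρi ρs (X f)⟫_ℂ) := by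
  set R := P.ρi ρs
  have hRsa : IsSelfAdjoint R := P.isSelfAdjoint_ρi hρs
  have hR1 : ‖R‖ ≤ 1 := P.norm_ρi_le hρs1
  have hC : 0 ≤ ∑ j, P.potBound lam j := Finset.sum_nonneg fun j _ => P.potBound_nonneg hlam j
  obtain ⟨U, hU0, hU, hU1⟩ := exists_propagator P.isSelfAdjoint_H hRsa hC (P.V_sub lam)
    (P.norm_V_le hlam) fun _ => P.isSelfAdjoint_V lam
  set σ : ℝ → Hilb N →L[ℂ] Hilb N := fun t => U t * R * star (U t)
  have hσsa : ∀ t, IsSelfAdjoint (σ t) := fun t => hRsa.conjugate _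
  have hK : ∀ t, IsSelfAdjoint (P.H + P.V lam (σ t)) := fun t =>
    IsSelfAdjoint.add (R := Hilb N →L[ℂ] Hilb N) P.isSelfAdjoint_H (P.isSelfAdjoint_V lam (hσsa t))
  have hσ : ∀ t, HasDerivAt σ
      (-(Complex.I • ((P.H + P.V lam (σ t)) * σ t - σ t * (P.H + P.V lam (σ t))))) t := fun t =>
    hasDerivAt_conj_propagator (hK t) (hU t)
  have hσ0 : σ 0 = R := by simp [σ, hU0]
  have hσc : Continuous σ := continuous_iff_continuousAt.2 fun t => (hσ t).continuousAt
  have hsol : P.IsLiouvilleSolution lam ρs σ := by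
    refine ⟨hσ0, hσc.continuousOn, fun t _ => ⟨_, hσ t, ?_⟩⟩
    rw [smul_neg, I_smul_I_smul, neg_neg]
  refine ⟨⟨σ, hsol⟩, ?_⟩
  have hZ : ∀ t, HasDerivAt (fun s => star (U s)) (Complex.I • (star (U t) * (P.H +
      samplePotential (P.pot lam fun k => ⟪zeta k, σ t (zeta k)⟫_ℂ)))) t := fun t => by
    rw [← V_eq_samplePotential]
    exact hasDerivAt_star_propagator (hK t) (hU t)
  -- Commutation of ρ_i with H_L turns matrix elements of ρ(t) into matrix elements of ρ_i between
  -- the rotated states, whose convergence is then the only issue.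
  have hconj : ∀ t f g, ⟪g, σ t f⟫_ℂ = ⟪expI P.HL (-t) (star (U t) g),
      R (expI P.HL (-t) (star (U t) f))⟫_ℂ := fun t f g => by
    have e : R (expI P.HL (-t) (star (U t) f)) = expI P.HL (-t) (R (star (U t) f)) :=
      congrArg (fun T => T (star (U t) f)) (commute_expI_of_commute (P.commute_ρi_HL ρs) (-t)).eq
    rw [e, inner_expI_expI P.isSelfAdjoint_HL]
    exact inner_conj_apply _ _ _ _
  have hb1 : ∀ t l, ‖expI P.HL (-t) (star (U t) (zeta l))‖ ≤ 1 := fun t l => by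
    rw [norm_expI_apply P.isSelfAdjoint_HL]
    have := (star (U t)).le_of_opNorm_le ((norm_star _).trans_le (hU1 t)) (zeta l)
    rwa [one_mul, norm_zeta] at this
  have hdens : ∀ (X : Fin N → Hilb N),
      (∀ j, Tendsto (fun t : ℝ => expI P.HL (-t) (star (U t) (zeta j))) atTop (𝓝 (X j))) →
      ∀ k, Tendsto (fun t => P.pot lam (fun k => ⟪zeta k, σ t (zeta k)⟫_ℂ) k) atTop
        (𝓝 (P.pot lam (fun k => ⟪X k, R (X k)⟫_ℂ) k)) := fun X hX k => by
    refine (tendsto_finsetSum _ fun l _ => ?_).const_mul _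
    refine Tendsto.const_mul _ ?_
    simp_rw [hconj]
    exact (hX l).inner ((R.continuous.tendsto _).comp (hX l))
  obtain ⟨X, v, hv, hX⟩ := P.exists_asymptotics hP hW (Z := fun t => star (U t))
    (w := fun k t => P.pot lam (fun k => ⟪zeta k, σ t (zeta k)⟫_ℂ) k) (κ := P.potBound lam)
    (fun k => by
      refine continuous_const.mul (continuous_finsetSum _ fun l _ => continuous_const.mul ?_)
      exact continuous_const.inner (hσc.clm_apply continuous_const))
    (by simp [hU0]) hZ (fun t => (norm_star _).trans_le (hU1 t))
    (fun k t => by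
      refine (P.norm_pot_le hlam (δ := 1) (fun l => ?_) k).trans_eq (mul_one _)
      rw [hconj]
      exact norm_density_le hR1 (hb1 t l))
    -- The density is quadratic in a state of norm at most 1, whence the factor 2.
    (fun k δ t t' hδ => by
      refine (P.norm_pot_sub_le hlam (δ := 2 * δ) (fun l => ?_) k).trans_eq (by ring)
      rw [hconj, hconj]
      exact (norm_density_sub_le hR1 (hb1 t l) (hb1 t' l)).trans
        (mul_le_mul_of_nonneg_left (hδ l) zero_le_two)) hsmall
    (fun X hX => ⟨_, hdens X hX⟩)
  -- Self-consistency: the limiting potential is the Hartree potential of the limiting states.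
  have hvX : v = P.pot lam (fun l => ⟪X (zeta l), R (X (zeta l))⟫_ℂ) := funext fun k =>
    tendsto_nhds_unique (hv k)
      (hdens (fun j => X (zeta j)) (fun j => (hX _ (hasCompactSupp_zeta j)).1) k)
  subst hvX
  refine ⟨X, fun f hf => (hX f hf).2, fun ρ hρ f g hf hg => ?_⟩
  have hlim : Tendsto (fun t : ℝ => ⟪g, σ t f⟫_ℂ) atTop (𝓝 ⟪X g, R (X f)⟫_ℂ) := by
    simp_rw [hconj]
    exact (hX g hg).1.inner ((R.continuous.tendsto _).comp (hX f hf).1)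
  refine hlim.congr' ?_
  filter_upwards [eventually_ge_atTop 0] with t ht
  rw [liouville_unique hC (P.V_sub lam) (P.norm_V_le hlam) (hρ.1.trans hσ0.symm) hρ.2.1
    hσc.continuousOn (fun t ht => IsLiouvilleSolution.hasDerivAt P hρ ht) (fun t _ => hσ t) ht]

end Model

end HartreeNESS

/-! ### The steady state up to second order. -/

open HartreeNESS in
theorem corollary3 {N : ℕ} (P : Model N) (hP : P.Dispersive)
    (lam1 : ℝ) (hlam1 : 0 < lam1) (hlam1_le : ENNReal.ofReal lam1 ≤ P.lambda0)
    (ρs : ℝ → Sample N →L[ℂ] Sample N)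
    (hρs : ∀ lam : ℝ, 0 ≤ lam → lam < lam1 → P.IsSampleEquilibrium lam (ρs lam))
    (hac : ∀ lam : ℝ, 0 ≤ lam → lam < lam1 → IsPurelyAC (P.Heff lam (ρs lam))) :
    (WaveOpExists P.H P.HL ∧ WaveOpExists P.HL P.H) ∧
    (∀ lam : ℝ, 0 ≤ lam → lam < lam1 →
      WaveOpExists (P.Heff lam (ρs lam)) P.HL ∧ WaveOpExists P.HL (P.Heff lam (ρs lam)) ∧
      ∃ ρ : ℝ → Hilb N →L[ℂ] Hilb N, P.IsLiouvilleSolution lam (ρs lam) ρ) ∧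
    ∀ f g : Hilb N, HasCompactSupp f → HasCompactSupp g →
      ∃ C : ℝ, ∀ lam : ℝ, 0 ≤ lam → lam < lam1 →
        ∀ ρ : ℝ → Hilb N →L[ℂ] Hilb N, P.IsLiouvilleSolution lam (ρs lam) ρ →
          Tendsto (fun t : ℝ => tr (ρ t * ketbra f g)) atTop
            (𝓝 (steadyState ρ (ketbra f g))) ∧
          ‖steadyState ρ (ketbra f g) - tr (P.ρeff lam (ρs lam) * ketbra f g)‖ ≤ C * lam ^ 2 := by
  -- At λ = 0 the effective Hamiltonian is H, so the spectral hypothesis covers H as well.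
  have hacH : IsPurelyAC P.H := by
    have h := hac 0 le_rfl hlam1
    rwa [P.Heff_zero] at h
  have hWex := P.waveOpExists_HL_H hP
  have hW : ∀ f, Tendsto (fun t : ℝ => expI P.HL (-t) (expI P.H t f)) atTop
      (𝓝 (waveOp P.HL P.H f)) := IsWaveOp.tendsto hWex hacH
  have hWn : ∀ k, ‖waveOp P.HL P.H (zeta k)‖ ≤ 1 := fun k => by
    refine le_of_tendsto' (hW (zeta k)).norm fun t => ?_
    rw [norm_expI_apply P.isSelfAdjoint_HL, norm_expI_apply P.isSelfAdjoint_H, norm_zeta]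
  -- The Fermi–Dirac form of ρ_s alone gives these bounds, uniformly in λ, however ρ_s depends on
  -- it.
  have hsa : ∀ lam : ℝ, 0 ≤ lam → lam < lam1 → IsSelfAdjoint (ρs lam) ∧ ‖ρs lam‖ ≤ 1 := by
    intro lam h0 h1
    obtain ⟨_, x, hx, _⟩ := hρs lam h0 h1
    rw [hx]
    exact ⟨isSelfAdjoint_fermiDirac _ _ _, norm_fermiDirac_le _ _ _⟩
  have hsm : ∀ lam : ℝ, 0 ≤ lam → lam < lam1 → _ := fun lam h0 h1 => P.smallness hlam1_le h0 h1
  have heff := fun (lam : ℝ) (h0 : 0 ≤ lam) (h1 : lam < lam1) =>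
    P.effective_asymptotics hP h0 (hsm lam h0 h1) hacH (hsa lam h0 h1).1 (hsa lam h0 h1).2
      (hac lam h0 h1)
  have hliou := fun (lam : ℝ) (h0 : 0 ≤ lam) (h1 : lam < lam1) =>
    P.liouville_asymptotics hP h0 (hsm lam h0 h1) hW (hsa lam h0 h1).1 (hsa lam h0 h1).2
  refine ⟨⟨P.waveOpExists_H_HL, hWex⟩, fun lam h0 h1 =>
    ⟨(heff lam h0 h1).1, (heff lam h0 h1).2.1, (hliou lam h0 h1).1⟩, fun f g hf hg => ?_⟩
  -- `D` involves only ν and the dynamics of H, so it depends neither on λ nor on ρ_s.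
  set D : Hilb N → ℝ := fun f => 4 * ((∑ k, P.potBound 1 k) * P.M.toReal) *
    (∑ k, P.potBound 1 k * P.ampNorm k f)
  -- The constant comes from |⟨Xg, RXf⟩ - ⟨Yg, RYf⟩| ≤ ‖Xg - Yg‖ ‖Xf‖ + ‖Yg‖ ‖Xf - Yf‖, with ‖R‖ ≤
  -- 1, ‖Xf‖ ≤ ‖f‖ and ‖Yg‖ = ‖g‖.
  refine ⟨D g * ‖f‖ + ‖g‖ * D f, fun lam h0 h1 ρ hρ => ?_⟩
  obtain ⟨_, X, hX, hXlim⟩ := hliou lam h0 h1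
  obtain ⟨_, _, hYn, hY, hYeff⟩ := heff lam h0 h1
  have hR1 : ‖P.ρi (ρs lam)‖ ≤ 1 := P.norm_ρi_le (hsa lam h0 h1).2
  have hlim : Tendsto (fun t : ℝ => tr (ρ t * ketbra f g)) atTop
      (𝓝 ⟪X g, P.ρi (ρs lam) (X f)⟫_ℂ) := by
    simp_rw [tr_mul_ketbra]
    exact hXlim ρ hρ f g hf hg
  have hss : steadyState ρ (ketbra f g) = _ := hlim.limUnder_eq
  rw [hss]
  refine ⟨hlim, ?_⟩
  rw [tr_mul_ketbra, hYeff]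
  have hdiff : ∀ {f : Hilb N}, HasCompactSupp f →
      ‖X f - waveOp P.HL (P.Heff lam (ρs lam)) f‖ ≤ D f * lam ^ 2 := fun hf =>
    P.norm_asymptotics_sub_le hP h0 hR1 hWn
      (fun k => ((hX _ (hasCompactSupp_zeta k)).1).trans (norm_zeta k).le)
      (fun k => (hYn _).trans_le (norm_zeta k).le) (fun f hf => (hX f hf).2) hY hf
  refine (Model.norm_inner_sub_inner_le hR1 _ _ _ _).trans ?_
  rw [hYn]
  calc _ ≤ D g * lam ^ 2 * ‖f‖ + ‖g‖ * (D f * lam ^ 2) :=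
        add_le_add (mul_le_mul (hdiff hg) (hX f hf).1 (norm_nonneg _)
          ((norm_nonneg _).trans (hdiff hg)))
          (mul_le_mul_of_nonneg_left (hdiff hf) (norm_nonneg _))
    _ = _ := by ring
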